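/- Setting. Let $(h_m)_{m\ge 0}$ be the Hermite (Fock) orthonormal basis of $L^2(\mathbb R)$. A quantum state is a positive operator $\rho$ of trace one on $L^2(\mathbb R)$, with matrix entries $\rho_{m,n}=\langle h_m,\rho h_n\rangle$. For $B>0$ and $0<r\le 2$ let $$\mathcal R(B,r)=\{\rho \text{ quantum state}: |\rho_{m,n}|\le e^{-B(m+n)^{r/2}}\text{ for all } m,n\ge 0\}.$$ The Wigner function $W_\rho:\mathbb R^2\to\mathbb R$ of $\rho$ is the function with Fourier transform $$\iint e^{-i(uq+vp)}W_\rho(q,p)\,dq\,dp=\mathrm{Tr}\big(\rho\, e^{-iu\mathbf Q-iv\mathbf P}\big),$$ where $\mathbf Q$ is multiplication by $x$ and $\mathbf P=-i\,d/dx$. Let $p_\rho(x,\phi)=\int_{\mathbb R} W_\rho(x\cos\phi-t\sin\phi,\,x\sin\phi+t\cos\phi)\,dt$ be its Radon transform. Let $0<\eta<1$ and $\gamma=\frac{1-\eta}{4\eta}$. The pairs $(X_\ell,\Phi_\ell)$, $\ell=1,\dots,n$, are i.i.d. on $\mathbb R\times[0,\pi]$ with density $p_\rho$ with respect to $\frac1\pi$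 times Lebesgue measure. One observes $(Y_\ell,\Phi_\ell)$ with $Y_\ell=\sqrt\eta\,X_\ell+\sqrt{(1-\eta)/2}\,\xi_\ell$, where the $\xi_\ell$ are i.i.d. standard Gaussian and independent of all the $(X_j,\Phi_j)$. Let $\widetilde N^\eta$ be the Fourier transform of the centered Gaussian density of variance $(1-\eta)/2$, and for $h>0$ let $$K_h^\eta(u)=\frac1{4\pi}\int_{-1/h}^{1/h}\frac{e^{-iut}|t|}{\widetilde N^\eta(t/\sqrt\eta)}\,dt,\qquad \widehat W_h^\eta(q,p)=\frac1n\sum_{\ell=1}^n K_h^\eta\Big(q\cos\Phi_\ell+p\sin\Phi_\ell-\frac{Y_\ell}{\sqrt\eta}\Big).$$ For $s>0$ let $D(s)=\{z\in\mathbb R^2:\|z\|\le s\}$, let $\overline D(s)$ be its complement, and write $\|f\|_S^2=\int_S f^2(z)\,dz$. Proposition. Let $B>0$ and $0<r\le 2$. If $0<r<2$ let $\beta<B$ be arbitrary, and if $r=2$ let $\beta=B/(1+\sqrt B)^2$. There are positive constants $C_1,C_2$ depending only on $\beta,B,r$, and $C_3$ depending only on $\eta$, such that for all positive $h=h_n\to0$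 and all $s_n\to\infty$, for all $n$ large enough, $$\sup_{\rho\in\mathcal R(B,r)}\|W_\rho\|^2_{\overline D(s_n)}\le C_1 s_n^{10-3r}e^{-2\beta s_n^r},$$ $$\sup_{\rho\in\mathcal R(B,r)}\big\|E[\widehat W_h^\eta]-W_\rho\big\|^2_{D(s_n)}\le C_2h^{3r-10}e^{-2^{1-r}\beta/h^r},$$ $$\sup_{\rho\in\mathcal R(B,r)}E\Big[\big\|\widehat W_h^\eta-E[\widehat W_h^\eta]\big\|^2_{D(s_n)}\Big]\le C_3\frac{s_n^2}{nh}\exp\Big(\frac{2\gamma}{h^2}\Big).$$ -/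

import Mathlib

open Set Filter Topology MeasureTheory ProbabilityTheory

noncomputable section

namespace HomodyneTomography

/-- The Hilbert space `L²(ℝ)` of complex square integrable functions. -/
abbrev L2 : Type := Lp ℂ 2 (volume : Measure ℝ)

/-! ### The Fock basis -/

/-- The physicists' Hermite polynomial `H_m(x) = (-1)^m e^{x²} (d/dx)^m e^{-x²}`. -/
def hermiteH (m : ℕ) (x : ℝ) : ℝ :=
  (-1) ^ m * Real.exp (x ^ 2) * iteratedDeriv m (fun y : ℝ => Real.exp (-y ^ 2)) x

/-- The Hermite function `h_m(x) = (2^m m! √π)^{-1/2} H_m(x) e^{-x²/2}`. -/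
def hermiteFun (m : ℕ) (x : ℝ) : ℝ :=
  (Real.sqrt (2 ^ m * (m.factorial : ℝ) * Real.sqrt Real.pi))⁻¹ * hermiteH m x *
    Real.exp (-x ^ 2 / 2)

theorem exists_poly_iteratedDeriv_gaussian (m : ℕ) :
    ∃ P : Polynomial ℝ, iteratedDeriv m (fun y : ℝ => Real.exp (-y ^ 2)) =
      fun x => P.eval x * Real.exp (-x ^ 2) := by
  induction m with
  | zero => exact ⟨1, by simp⟩
  | succ m ih =>
    obtain ⟨P, hP⟩ := ih
    refine ⟨P.derivative - 2 * Polynomial.X * P, ?_⟩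
    rw [iteratedDeriv_succ, hP]
    funext x
    have h1 : HasDerivAt (fun y : ℝ => Real.exp (-y ^ 2))
        (Real.exp (-x ^ 2) * (-(2 * x))) x := by
      have h := ((hasDerivAt_pow 2 x).neg).exp
      simpa using! h
    refine (HasDerivAt.deriv ((P.hasDerivAt x).mul h1)).trans ?_
    simp only [Polynomial.eval_sub, Polynomial.eval_mul, Polynomial.eval_X,
      Polynomial.eval_ofNat]
    ring

theorem exists_poly_hermiteFun (m : ℕ) :
    ∃ P : Polynomial ℝ, hermiteFun m = fun x => P.eval x * Real.exp (-x ^ 2 / 2) := by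
  obtain ⟨P, hP⟩ := exists_poly_iteratedDeriv_gaussian m
  refine ⟨Polynomial.C ((Real.sqrt (2 ^ m * (m.factorial : ℝ) * Real.sqrt Real.pi))⁻¹ *
    (-1) ^ m) * P, ?_⟩
  funext x
  have h : Real.exp (x ^ 2) * Real.exp (-x ^ 2) = 1 := by
    rw [← Real.exp_add]; simp
  simp only [hermiteFun, hermiteH, hP, Polynomial.eval_mul, Polynomial.eval_C]
  linear_combination ((Real.sqrt (2 ^ m * (m.factorial : ℝ) * Real.sqrt Real.pi))⁻¹ *
    (-1) ^ m * P.eval x * Real.exp (-x ^ 2 / 2)) * h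

theorem integrable_poly_mul_gaussian (P : Polynomial ℝ) :
    Integrable (fun x : ℝ => P.eval x * Real.exp (-x ^ 2)) := by
  induction P using Polynomial.induction_on' with
  | add p q hp hq =>
    have h := hp.add hq
    refine h.congr (Eventually.of_forall fun x => ?_)
    simp [add_mul]
  | monomial n a =>
    have h := (integrable_rpow_mul_exp_neg_mul_sq (b := 1) one_pos
      (s := (n : ℝ)) (by have : (0 : ℝ) ≤ n := n.cast_nonneg
                         linarith)).const_mul a
    refine h.congr (Eventually.of_forall fun x => ?_)
    simp [mul_assoc]

theorem memLp_hermiteFun (m : ℕ) :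
    MemLp (fun x : ℝ => (hermiteFun m x : ℂ)) 2 volume := by
  obtain ⟨P, hP⟩ := exists_poly_hermiteFun m
  have hcont : Continuous (hermiteFun m) := by
    rw [hP]
    exact P.continuous.mul (by fun_prop)
  have hreal : MemLp (hermiteFun m) 2 volume := by
    refine (memLp_two_iff_integrable_sq hcont.aestronglyMeasurable).2 ?_
    refine (integrable_poly_mul_gaussian (P ^ 2)).congr (Eventually.of_forall fun x => ?_)
    have h : Real.exp (-x ^ 2) = Real.exp (-x ^ 2 / 2) ^ 2 := by
      rw [← Real.exp_nat_mul]; congr 1; push_cast; ring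
    simp only [hP, Polynomial.eval_pow, h]
    ring
  exact hreal.ofReal

/-- The Fock basis of `L²(ℝ)`: its `m`-th vector is the class of the Hermite function `h_m`. -/
def fock (m : ℕ) : L2 := (memLp_hermiteFun m).toLp _

/-- The trace of an operator on `L²(ℝ)`, computed in the Fock basis. -/
def trace (A : L2 →L[ℂ] L2) : ℂ := ∑' m : ℕ, inner ℂ (fock m) (A (fock m))

/-! ### Quantum states -/

/-- A quantum state: a positive (in particular self-adjoint) operator on `L²(ℝ)`
of trace one. -/
structure QuantumState where
  /-- the underlying operator -/
  op : L2 →L[ℂ] L2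
  isPositive : op.IsPositive
  trace_one : HasSum (fun m : ℕ => inner ℂ (fock m) (op (fock m))) 1

/-- The density matrix `ρ_{m,n} = ⟨h_m, ρ h_n⟩` of a state in the Fock basis. -/
def QuantumState.entry (ρ : QuantumState) (m n : ℕ) : ℂ :=
  inner ℂ (fock m) (ρ.op (fock n))

/-- The class `𝓡(B, r)` of states with `|ρ_{m,n}| ≤ exp(-B (m+n)^{r/2})`. -/
def stateClass (B r : ℝ) : Set QuantumState :=
  {ρ | ∀ m n : ℕ, ‖ρ.entry m n‖ ≤ Real.exp (-B * ((m : ℝ) + (n : ℝ)) ^ (r / 2))}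

/-! ### The Wigner function -/

/-- The function `x ↦ e^{-iux + iuv/2} f(x - v)`. -/
def weylFun (u v : ℝ) (f : ℝ → ℂ) (x : ℝ) : ℂ :=
  Complex.exp (-Complex.I * u * x + Complex.I * u * v / 2) * f (x - v)

theorem norm_weylFun (u v : ℝ) (f : ℝ → ℂ) (x : ℝ) : ‖weylFun u v f x‖ = ‖f (x - v)‖ := by
  have h : -Complex.I * u * x + Complex.I * u * v / 2
      = ((-u * x + u * v / 2 : ℝ) : ℂ) * Complex.I := by
    push_cast; ring
  rw [weylFun, h, norm_mul, Complex.norm_exp_ofReal_mul_I, one_mul]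

theorem aestronglyMeasurable_weylFun (u v : ℝ) (f : L2) :
    AEStronglyMeasurable (weylFun u v f) volume := by
  have h1 : AEStronglyMeasurable (fun x : ℝ => (f : ℝ → ℂ) (x - v)) volume :=
    (Lp.aestronglyMeasurable f).comp_measurePreserving
      (measurePreserving_sub_right volume v)
  have h2 : Continuous (fun x : ℝ =>
      Complex.exp (-Complex.I * u * x + Complex.I * u * v / 2)) := by fun_prop
  exact h2.aestronglyMeasurable.mul h1

theorem eLpNorm_weylFun (u v : ℝ) (f : L2) :
    eLpNorm (weylFun u v f) 2 volume = eLpNorm f 2 volume := by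
  rw [eLpNorm_congr_norm_ae (g := fun x : ℝ => (f : ℝ → ℂ) (x - v))
    (Eventually.of_forall fun x => norm_weylFun u v f x)]
  exact eLpNorm_comp_measurePreserving (Lp.aestronglyMeasurable f)
    (measurePreserving_sub_right volume v)

theorem memLp_weylFun (u v : ℝ) (f : L2) : MemLp (weylFun u v f) 2 volume :=
  ⟨aestronglyMeasurable_weylFun u v f, by
    rw [eLpNorm_weylFun]; exact (Lp.memLp f).eLpNorm_lt_top⟩

/-- The unitary (Weyl) operator `exp(-iuQ - ivP)` on `L²(ℝ)`, where `Q` is multiplication by `x`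
and `P = -i d/dx`, so that `[Q, P] = i`:
`(exp(-iuQ - ivP) f)(x) = e^{-iux + iuv/2} f(x - v)`. -/
def weyl (u v : ℝ) : L2 →L[ℂ] L2 :=
  LinearIsometry.toContinuousLinearMap
    { toFun := fun f => (memLp_weylFun u v f).toLp _
      map_add' := fun f g => by
        rw [← MemLp.toLp_add]
        refine MemLp.toLp_congr _ _ ?_
        have h := (measurePreserving_sub_right (volume : Measure ℝ) v).quasiMeasurePreserving.ae
          (Lp.coeFn_add f g)
        filter_upwards [h] with x hx
        simp only [weylFun, Pi.add_apply, hx]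
        ring
      map_smul' := fun c f => by
        rw [RingHom.id_apply, ← MemLp.toLp_const_smul]
        refine MemLp.toLp_congr _ _ ?_
        have h := (measurePreserving_sub_right (volume : Measure ℝ) v).quasiMeasurePreserving.ae
          (Lp.coeFn_smul c f)
        filter_upwards [h] with x hx
        simp only [weylFun, Pi.smul_apply, hx, smul_eq_mul]
        ring
      norm_map' := fun f => by
        change ‖(memLp_weylFun u v f).toLp _‖ = ‖f‖
        rw [Lp.norm_toLp, eLpNorm_weylFun, Lp.norm_def] }

/-- The Fourier transform `W̃_ρ(u, v) = Tr(ρ exp(-iuQ - ivP))` of the Wigner function of `ρ`. -/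
def wignerFourier (ρ : QuantumState) (u v : ℝ) : ℂ := trace (ρ.op ∘L weyl u v)

/-- The Wigner function of `ρ`, i.e. the function on the plane whose Fourier transform
`∬ e^{-i(uq+vp)} W_ρ(q,p) dq dp` is `W̃_ρ(u,v) = Tr(ρ exp(-iuQ - ivP))`, given by Fourier inversion
(for the states of `𝓡(B, r)` the function `W̃_ρ` is continuous and integrable). The integral is real, because `W̃_ρ(-u,-v)` is the complex conjugate of `W̃_ρ(u,v)`. -/
def wigner (ρ : QuantumState) (z : ℝ × ℝ) : ℝ :=
  (1 / (2 * (Real.pi : ℂ)) ^ 2 * ∫ w : ℝ × ℝ,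
    Complex.exp (Complex.I * (w.1 * z.1 + w.2 * z.2)) * wignerFourier ρ w.1 w.2).re

/-- The Radon transform of a function on the plane. -/
def radon (f : ℝ × ℝ → ℝ) (x φ : ℝ) : ℝ :=
  ∫ t : ℝ, f (x * Real.cos φ - t * Real.sin φ, x * Real.sin φ + t * Real.cos φ)

/-! ### The observations -/

/-- The law `P_ρ` of `(X, Φ)` on `ℝ × [0, π]`: its density with respect to `(1/π)` times
Lebesgue measure is `p_ρ = Radon transform of W_ρ`. -/
def homodyneLaw (ρ : QuantumState) : Measure (ℝ × ℝ) :=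
  (ENNReal.ofReal (1 / Real.pi) •
    (volume : Measure (ℝ × ℝ)).restrict (univ ×ˢ Icc 0 Real.pi)).withDensity
      (fun a => ENNReal.ofReal (radon (wigner ρ) a.1 a.2))

/-- The ideal data and the noise: the `(X_ℓ, Φ_ℓ)` are i.i.d. with law `P_ρ`, the `ξ_ℓ` are
i.i.d. standard Gaussian, and the sequence `ξ` is independent of all the `(X_ℓ, Φ_ℓ)`. -/
structure IsHomodyneSample {Ω : Type*} [MeasurableSpace Ω] (μ : Measure Ω) (ρ : QuantumState)
    {n : ℕ} (X Φ ξ : Fin n → Ω → ℝ) : Prop where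
  law : ∀ l, HasLaw (fun ω => (X l ω, Φ l ω)) (homodyneLaw ρ) μ
  indep : iIndepFun (fun l ω => (X l ω, Φ l ω)) μ
  noise_law : ∀ l, HasLaw (ξ l) (gaussianReal 0 1) μ
  noise_indep : iIndepFun ξ μ
  indep_noise : IndepFun (fun ω l => (X l ω, Φ l ω)) (fun ω l => ξ l ω) μ

/-- The noisy observation `Y = √η X + √((1-η)/2) ξ`. -/
def noisy (η : ℝ) {Ω : Type*} {n : ℕ} (X ξ : Fin n → Ω → ℝ) (l : Fin n) (ω : Ω) : ℝ :=
  Real.sqrt η * X l ω + Real.sqrt ((1 - η) / 2) * ξ l ω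

/-! ### The kernel estimator -/

/-- The centered Gaussian density `N^η` of variance `(1-η)/2`. -/
def noiseDensity (η : ℝ) (x : ℝ) : ℝ := gaussianPDFReal 0 (Real.toNNReal ((1 - η) / 2)) x

/-- The Fourier transform of `N^η`. -/
def noiseFourier (η : ℝ) (t : ℝ) : ℂ :=
  ∫ x : ℝ, Complex.exp (-Complex.I * t * x) * noiseDensity η x

/-- The kernel `K_h^η(u) = (1/4π) ∫_{-1/h}^{1/h} e^{-iut} |t| / Ñ^η(t/√η) dt`. The integral is
real, because `Ñ^η` is real and even. -/
def kernel (η h u : ℝ) : ℝ :=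
  (1 / (4 * (Real.pi : ℂ)) * ∫ t in (-(1 / h))..(1 / h),
    Complex.exp (-Complex.I * u * t) * (|t| : ℝ) / noiseFourier η (t / Real.sqrt η)).re

/-- The estimator `Ŵ_h^η(q,p) = (1/n) ∑_ℓ K_h^η(q cos Φ_ℓ + p sin Φ_ℓ - Y_ℓ/√η)`. -/
def wignerEstimator (η h : ℝ) {Ω : Type*} {n : ℕ} (Y Φ : Fin n → Ω → ℝ) (z : ℝ × ℝ) (ω : Ω) :
    ℝ :=
  1 / (n : ℝ) * ∑ l : Fin n,
    kernel η h (z.1 * Real.cos (Φ l ω) + z.2 * Real.sin (Φ l ω) - Y l ω / Real.sqrt η)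

/-- The expectation of the estimator at a point of the plane. -/
def meanEstimator (η h : ℝ) {Ω : Type*} [MeasurableSpace Ω] (μ : Measure Ω) {n : ℕ}
    (Y Φ : Fin n → Ω → ℝ) (z : ℝ × ℝ) : ℝ :=
  ∫ ω, wignerEstimator η h Y Φ z ω ∂μ

/-- The closed Euclidean disc of radius `s` in the plane. -/
def disc (s : ℝ) : Set (ℝ × ℝ) := {z | Real.sqrt (z.1 ^ 2 + z.2 ^ 2) ≤ s}

/-- The squared `L²` norm of `f` on a set `S`, as a value in `[0, ∞]`. -/
def normSqOn (S : Set (ℝ × ℝ)) (f : ℝ × ℝ → ℝ) : ENNReal :=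
  ∫⁻ z in S, ENNReal.ofReal (f z ^ 2)

end HomodyneTomography

end

namespace HomodyneTomography

/-! ### Recurrences for the Hermite functions -/

/-! Everything rests on one estimate for the matrix elements `overlap k m u v` of the Weyl operators
in the Fock basis: if `0 ≤ c < 1`, `l > 0` and `(1 - c) l² = 1 + c`, then `norm_overlap_le` bounds
them by a constant times `l^(k+m) exp(-c (u² + v²)/4)`. Rotation covariance reduces this to `u = 0`.
There the element is an integral of `h_k(x) h_m(x - r)`, and giving each factor a Gaussian weight
reduces it to the moments `∫ h_k² e^{c x²}`, which `abs_hermiteMoment_le` controls through a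
recurrence.

Completeness of the Fock basis turns `Tr(ρ exp(-iuQ - ivP))` into the series of `ρ_{m,k} overlap k m
u v`. Combining the decay of `ρ_{m,k}` with that of the overlap, each term is at most a summable
coefficient times `exp(-b x^r)`, where `u² + v² = 4x²` and `b` is strictly larger than `β`
(`AdmissibleRate.exists_exp_mul_norm_overlap_le`). For `r < 2` one compares `m + k` with `x²`. For
`r = 2` two exponentials are multiplied; every rate below `tanh B` is reached this way, and `B/(1 +
√B)²` lies below it.

The plane Fourier transform sends an overlap to a sign times itself at a doubled, rotated argument
(`integral_exp_mul_overlap`). So one estimate gives decay of the Wigner function at rate `b` and of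
its Fourier transform at rate `b/2^r`. Integrating the former outside a disc is the first bound. As
`b > β`, an integrable exponential is left over, and the polynomial factors `s^(10-3r)` and
`h^(3r-10)`, which are at least one, are pure slack.

For the bias, the factor `exp(γt²)` in the kernel cancels the characteristic function of the noise.
The projection-slice theorem and polar coordinates then show that the mean of the estimator is the
Fourier inversion integral cut off at frequency `1/h` (`IsHomodyneSample.meanEstimator_eq`). The
bias is the high-frequency part, estimated by a Plancherel inequality on discs
(`setLIntegral_disc_sq_planeFourier_le`).

For the variance, the kernel is bounded by `exp(γ/h²)/(2γ)` (`abs_kernel_le`) and the observations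
are pairwise independent, so the pointwise variance is at most the square of that bound over `n`.
Integration over the disc gives the third bound. -/

theorem hasDerivAt_iteratedDeriv_gaussian (m : ℕ) (x : ℝ) :
    HasDerivAt (iteratedDeriv m (fun y : ℝ => Real.exp (-y ^ 2)))
      (iteratedDeriv (m + 1) (fun y : ℝ => Real.exp (-y ^ 2)) x) x := by
  rw [iteratedDeriv_succ]
  apply DifferentiableAt.hasDerivAt
  obtain ⟨P, hP⟩ := exists_poly_iteratedDeriv_gaussian m
  rw [hP]
  fun_prop

theorem iteratedDeriv_gaussian_one (x : ℝ) :
    iteratedDeriv 1 (fun y : ℝ => Real.exp (-y ^ 2)) x = -2 * x * Real.exp (-x ^ 2) := by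
  rw [iteratedDeriv_one]
  have h := ((hasDerivAt_pow 2 x).neg).exp
  rw [show (fun y : ℝ => Real.exp (-y ^ 2)) = fun y => Real.exp ((-fun x : ℝ => x ^ 2) y) from rfl,
    h.deriv]
  simp only [Pi.neg_apply]
  norm_num
  ring

/-- The equation `g' = -2xg` differentiated `m + 1` times: each induction step differentiates the
previous identity and uses uniqueness of derivatives. -/
theorem iteratedDeriv_gaussian_add_two (m : ℕ) (x : ℝ) :
    iteratedDeriv (m + 2) (fun y : ℝ => Real.exp (-y ^ 2)) x =
      -2 * x * iteratedDeriv (m + 1) (fun y : ℝ => Real.exp (-y ^ 2)) x -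
        2 * (m + 1) * iteratedDeriv m (fun y : ℝ => Real.exp (-y ^ 2)) x := by
  induction m generalizing x with
  | zero =>
    have h0 := hasDerivAt_iteratedDeriv_gaussian 0 x
    have h1 := hasDerivAt_iteratedDeriv_gaussian 1 x
    have h2 : iteratedDeriv 1 (fun y : ℝ => Real.exp (-y ^ 2)) =
        fun x => (-2 * x) * iteratedDeriv 0 (fun y : ℝ => Real.exp (-y ^ 2)) x := by
      funext y
      rw [iteratedDeriv_gaussian_one, iteratedDeriv_zero]
    have h3 := (((hasDerivAt_id x).const_mul (-2)).mul h0)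
    rw [h2] at h1
    have h4 := h1.unique h3
    simp only [zero_add] at h4 ⊢
    rw [h4]
    simp
    ring
  | succ m ih =>
    have h0 := hasDerivAt_iteratedDeriv_gaussian m x
    have h1 := hasDerivAt_iteratedDeriv_gaussian (m + 1) x
    have h2 := hasDerivAt_iteratedDeriv_gaussian (m + 2) x
    rw [funext ih] at h2
    have h3 := (((hasDerivAt_id x).const_mul (-2)).mul h1).sub (h0.const_mul (2 * ((m : ℝ) + 1)))
    have h4 := h2.unique h3
    rw [show m + 1 + 2 = m + 2 + 1 from rfl, h4]
    simp
    ring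

theorem hermiteFun_eq (m : ℕ) (x : ℝ) :
    hermiteFun m x = (Real.sqrt (2 ^ m * (m.factorial : ℝ) * Real.sqrt Real.pi))⁻¹ * (-1) ^ m *
      Real.exp (x ^ 2 / 2) * iteratedDeriv m (fun y : ℝ => Real.exp (-y ^ 2)) x := by
  have h : Real.exp (x ^ 2) * Real.exp (-x ^ 2 / 2) = Real.exp (x ^ 2 / 2) := by
    rw [← Real.exp_add]; congr 1; ring
  rw [hermiteFun, hermiteH, ← h]
  ring

/-- Expresses each normalising constant through the next one, so that in a recurrence all constants
are multiples of the last and only a polynomial identity remains. -/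
theorem hermiteNorm_succ (m : ℕ) :
    (Real.sqrt (2 ^ m * (m.factorial : ℝ) * Real.sqrt Real.pi))⁻¹ =
      Real.sqrt 2 * Real.sqrt (m + 1) *
        (Real.sqrt (2 ^ (m + 1) * ((m + 1).factorial : ℝ) * Real.sqrt Real.pi))⁻¹ := by
  have h : Real.sqrt (2 ^ (m + 1) * ((m + 1).factorial : ℝ) * Real.sqrt Real.pi) =
      Real.sqrt 2 * Real.sqrt (m + 1) *
        Real.sqrt (2 ^ m * (m.factorial : ℝ) * Real.sqrt Real.pi) := by
    rw [← Real.sqrt_mul (by norm_num), ← Real.sqrt_mul (by positivity)]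
    congr 1
    rw [Nat.factorial_succ]
    push_cast
    ring
  have h1 : Real.sqrt 2 * Real.sqrt ((m : ℝ) + 1) ≠ 0 := by positivity
  have h2 : Real.sqrt (2 ^ m * (m.factorial : ℝ) * Real.sqrt Real.pi) ≠ 0 := by positivity
  rw [h]
  field_simp

/-- `a* h_m = √(m+1) h_{m+1}`. -/
theorem hasDerivAt_hermiteFun (m : ℕ) (x : ℝ) :
    HasDerivAt (hermiteFun m)
      (x * hermiteFun m x - Real.sqrt 2 * Real.sqrt (m + 1) * hermiteFun (m + 1) x) x := by
  rw [funext (hermiteFun_eq m)]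
  have he : HasDerivAt (fun x : ℝ => Real.exp (x ^ 2 / 2)) (Real.exp (x ^ 2 / 2) * x) x := by
    have := ((hasDerivAt_pow 2 x).div_const 2).exp
    convert! this using 1
    norm_num
  have h := (he.const_mul ((Real.sqrt (2 ^ m * (m.factorial : ℝ) * Real.sqrt Real.pi))⁻¹ *
    (-1) ^ m)).mul (hasDerivAt_iteratedDeriv_gaussian m x)
  convert! h using 1
  rw [hermiteFun_eq, hermiteNorm_succ m]
  ring

theorem sqrt_two_mul_self_mul_hermiteFun_succ (m : ℕ) (x : ℝ) :
    Real.sqrt 2 * x * hermiteFun (m + 1) x =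
      Real.sqrt (m + 2) * hermiteFun (m + 2) x + Real.sqrt (m + 1) * hermiteFun m x := by
  rw [hermiteFun_eq m, hermiteFun_eq (m + 1), hermiteFun_eq (m + 2),
    iteratedDeriv_gaussian_add_two, hermiteNorm_succ m, hermiteNorm_succ (m + 1)]
  have h2 : Real.sqrt 2 * Real.sqrt 2 = 2 := Real.mul_self_sqrt (by norm_num)
  have h3 : Real.sqrt ((m : ℝ) + 1) * Real.sqrt ((m : ℝ) + 1) = m + 1 :=
    Real.mul_self_sqrt (by positivity)
  have h4 : ((m + 1 : ℕ) : ℝ) + 1 = (m : ℝ) + 2 := by push_cast; ring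
  rw [h4]
  set N := (Real.sqrt (2 ^ (m + 1 + 1) * ((m + 1 + 1).factorial : ℝ) * Real.sqrt Real.pi))⁻¹
  set e := Real.exp (x ^ 2 / 2)
  set s := Real.sqrt ((m : ℝ) + 2)
  set t := Real.sqrt ((m : ℝ) + 1)
  set d := iteratedDeriv (m + 1) (fun y : ℝ => Real.exp (-y ^ 2)) x
  set d' := iteratedDeriv m (fun y : ℝ => Real.exp (-y ^ 2)) x
  linear_combination (-x * s * N * (-1) ^ m * e * d - N * (-1) ^ m * e * d' * s * t * t) * h2 -
    (2 * s * N * (-1) ^ m * e * d') * h3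

/-- `√2 x h_m = √(m+1) h_{m+1} + √m h_{m-1}`. -/
theorem sqrt_two_mul_self_mul_hermiteFun (m : ℕ) (x : ℝ) :
    Real.sqrt 2 * x * hermiteFun m x =
      Real.sqrt (m + 1) * hermiteFun (m + 1) x + Real.sqrt m * hermiteFun (m - 1) x := by
  cases m with
  | zero =>
    have h2 : Real.sqrt 2 * Real.sqrt 2 = 2 := Real.mul_self_sqrt (by norm_num)
    rw [hermiteFun_eq 0, hermiteFun_eq (0 + 1), hermiteNorm_succ 0]
    simp only [zero_add, iteratedDeriv_gaussian_one, iteratedDeriv_zero]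
    set N := (Real.sqrt (2 ^ (1 : ℕ) * (Nat.factorial 1 : ℝ) * Real.sqrt Real.pi))⁻¹
    simp
    linear_combination (N * Real.exp (x ^ 2 / 2) * x * Real.exp (-x ^ 2)) * h2
  | succ m =>
    have h := sqrt_two_mul_self_mul_hermiteFun_succ m x
    have h4 : ((m + 1 : ℕ) : ℝ) + 1 = (m : ℝ) + 2 := by push_cast; ring
    rw [h4]
    simpa using h

/-- `a h_m = √m h_{m-1}`. -/
theorem hasDerivAt_hermiteFun' (m : ℕ) (x : ℝ) :
    HasDerivAt (hermiteFun m)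
      (-x * hermiteFun m x + Real.sqrt 2 * Real.sqrt m * hermiteFun (m - 1) x) x := by
  convert hasDerivAt_hermiteFun m x using 1
  have h := sqrt_two_mul_self_mul_hermiteFun m x
  have h2 : Real.sqrt 2 * Real.sqrt 2 = 2 := Real.mul_self_sqrt (by norm_num)
  linear_combination (-Real.sqrt 2) * h + (x * hermiteFun m x) * h2

theorem continuous_hermiteFun (m : ℕ) : Continuous (hermiteFun m) :=
  continuous_iff_continuousAt.2 fun x => (hasDerivAt_hermiteFun m x).continuousAt

/-- Parity travels along the three-term recurrence, whose factor `x` changes sign. It is the source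
of the sign in `integral_exp_mul_overlap`. -/
theorem hermiteFun_neg (m : ℕ) (x : ℝ) : hermiteFun m (-x) = (-1) ^ m * hermiteFun m x := by
  induction m using Nat.strong_induction_on with
  | _ m ih =>
    cases m with
    | zero => simp [hermiteFun_eq]
    | succ m =>
      have h1 := sqrt_two_mul_self_mul_hermiteFun m x
      have h2 := sqrt_two_mul_self_mul_hermiteFun m (-x)
      rw [ih m (by omega)] at h2
      have h3 : Real.sqrt m * hermiteFun (m - 1) (-x) =
          -(-1) ^ m * (Real.sqrt m * hermiteFun (m - 1) x) := by
        cases m with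
        | zero => simp
        | succ m =>
          rw [Nat.add_sub_cancel, ih m (by omega), pow_succ]
          ring
      have h4 : Real.sqrt ((m : ℝ) + 1) ≠ 0 := by positivity
      apply mul_left_cancel₀ h4
      rw [pow_succ]
      linear_combination (-(-1) ^ m) * h1 - h2 - h3

theorem hermiteFun_zero (x : ℝ) :
    hermiteFun 0 x = (Real.sqrt (Real.sqrt Real.pi))⁻¹ * Real.exp (-x ^ 2 / 2) := by
  simp [hermiteFun, hermiteH, ← Real.exp_add]

/-! ### Gaussian-weighted moments of Hermite functions -/

theorem integrable_poly_mul_exp_neg_mul_sq (P : Polynomial ℝ) {b : ℝ} (hb : 0 < b) :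
    Integrable (fun x : ℝ => P.eval x * Real.exp (-b * x ^ 2)) := by
  induction P using Polynomial.induction_on' with
  | add p q hp hq =>
    have h := hp.add hq
    refine h.congr (Eventually.of_forall fun x => ?_)
    simp [add_mul]
  | monomial n a =>
    have h := (integrable_rpow_mul_exp_neg_mul_sq hb
      (s := (n : ℝ)) (by have : (0 : ℝ) ≤ n := n.cast_nonneg
                         linarith)).const_mul a
    refine h.congr (Eventually.of_forall fun x => ?_)
    simp [mul_assoc]

theorem integrable_hermiteFun_mul_mul_exp (k m : ℕ) {c : ℝ} (hc : c < 1) :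
    Integrable (fun x : ℝ => hermiteFun k x * hermiteFun m x * Real.exp (c * x ^ 2)) := by
  obtain ⟨P, hP⟩ := exists_poly_hermiteFun k
  obtain ⟨R, hR⟩ := exists_poly_hermiteFun m
  refine (integrable_poly_mul_exp_neg_mul_sq (P * R) (b := 1 - c) (by linarith)).congr
    (Eventually.of_forall fun x => ?_)
  have h : Real.exp (-(1 - c) * x ^ 2) =
      Real.exp (-x ^ 2 / 2) * Real.exp (-x ^ 2 / 2) * Real.exp (c * x ^ 2) := by
    rw [← Real.exp_add, ← Real.exp_add]; congr 1; ring
  simp only [hP, hR, Polynomial.eval_mul, h]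
  ring

/-- The moments `∫ h_k h_m e^{c x²}`. -/
noncomputable def hermiteMoment (c : ℝ) (k m : ℕ) : ℝ :=
  ∫ x : ℝ, hermiteFun k x * hermiteFun m x * Real.exp (c * x ^ 2)

theorem hermiteMoment_comm (c : ℝ) (k m : ℕ) : hermiteMoment c k m = hermiteMoment c m k := by
  simp only [hermiteMoment, mul_comm (hermiteFun k _)]

/-- The derivative of `h_k h_m e^{c x²}` integrates to zero. Raising `h_k` and lowering `h_m`
cancels the terms in `x` except `2cx h_k h_m`, which the three-term recurrence removes. The
truncated indices at `k = 0` and `m = 0` are harmless, since their coefficients vanish. -/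
theorem hermiteMoment_recurrence {c : ℝ} (hc : c < 1) (k m : ℕ) :
    (1 - c) * Real.sqrt (k + 1) * hermiteMoment c (k + 1) m =
      Real.sqrt m * hermiteMoment c k (m - 1) + c * Real.sqrt k * hermiteMoment c (k - 1) m := by
  have hI := fun k m => integrable_hermiteFun_mul_mul_exp k m hc
  set f' : ℝ → ℝ := fun x =>
    Real.sqrt 2 * Real.sqrt m * (hermiteFun k x * hermiteFun (m - 1) x * Real.exp (c * x ^ 2)) +
    Real.sqrt 2 * c * Real.sqrt k *
      (hermiteFun (k - 1) x * hermiteFun m x * Real.exp (c * x ^ 2)) -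
    Real.sqrt 2 * (1 - c) * Real.sqrt (k + 1) *
      (hermiteFun (k + 1) x * hermiteFun m x * Real.exp (c * x ^ 2)) with hf'
  have hd : ∀ x, HasDerivAt
      (fun x => hermiteFun k x * hermiteFun m x * Real.exp (c * x ^ 2)) (f' x) x := by
    intro x
    have he : HasDerivAt (fun x : ℝ => Real.exp (c * x ^ 2))
        (Real.exp (c * x ^ 2) * (c * (2 * x))) x := by
      have := ((hasDerivAt_pow 2 x).const_mul c).exp
      convert! this using 1
      norm_num
    have h := ((hasDerivAt_hermiteFun k x).mul (hasDerivAt_hermiteFun' m x)).mul he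
    convert! h using 1
    have h1 := sqrt_two_mul_self_mul_hermiteFun k x
    have h2 : Real.sqrt 2 * Real.sqrt 2 = 2 := Real.mul_self_sqrt (by norm_num)
    simp only [hf', Pi.mul_apply]
    linear_combination (-Real.sqrt 2 * c * hermiteFun m x * Real.exp (c * x ^ 2)) * h1 +
      (c * x * hermiteFun k x * hermiteFun m x * Real.exp (c * x ^ 2)) * h2
  have h1 := (hI k (m - 1)).const_mul (Real.sqrt 2 * Real.sqrt m)
  have h2 := (hI (k - 1) m).const_mul (Real.sqrt 2 * c * Real.sqrt k)
  have h3 := (hI (k + 1) m).const_mul (Real.sqrt 2 * (1 - c) * Real.sqrt (k + 1))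
  have h0 := integral_eq_zero_of_hasDerivAt_of_integrable hd ((h1.add h2).sub h3) (hI k m)
  have e1 := integral_sub (h1.add h2) h3
  have e2 := integral_add h1 h2
  simp only [Pi.add_apply] at e1
  simp only [hf'] at h0
  rw [h0, e2, integral_const_mul, integral_const_mul, integral_const_mul] at e1
  have hs : Real.sqrt 2 ≠ 0 := by positivity
  apply mul_left_cancel₀ hs
  simp only [hermiteMoment]
  linear_combination e1

/-- Apply the recurrence to the larger index. Both square roots on its right are then at most the
one on its left, so lowering `k + m` by two costs a factor `(1 + c)/(1 - c) = l²`. -/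
theorem abs_hermiteMoment_le {c l : ℝ} (hc0 : 0 ≤ c) (hc : c < 1) (hl0 : 0 ≤ l)
    (hl : (1 - c) * l ^ 2 = 1 + c) (k m : ℕ) :
    |hermiteMoment c k m| ≤ hermiteMoment c 0 0 * l ^ (k + m) := by
  have h00 : 0 ≤ hermiteMoment c 0 0 :=
    integral_nonneg fun x => mul_nonneg (mul_self_nonneg _) (Real.exp_pos _).le
  suffices H : ∀ n k m, k + m = n → |hermiteMoment c k m| ≤ hermiteMoment c 0 0 * l ^ n from
    H _ k m rfl
  intro n
  induction n using Nat.strong_induction_on with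
  | _ n ih =>
    suffices H : ∀ k m, m ≤ k → k + m = n → |hermiteMoment c k m| ≤ hermiteMoment c 0 0 * l ^ n by
      intro k m hkm
      rcases le_total m k with h | h
      · exact H k m h hkm
      · rw [hermiteMoment_comm]
        exact H m k h (by omega)
    intro k m hmk hkm
    cases k with
    | zero =>
      obtain rfl : m = 0 := by omega
      obtain rfl : n = 0 := by omega
      simp [abs_of_nonneg h00]
    | succ k =>
      have hrec := hermiteMoment_recurrence hc k m
      have hs : 0 < Real.sqrt ((k : ℝ) + 1) := by positivity
      have hsm : Real.sqrt m ≤ Real.sqrt ((k : ℝ) + 1) := by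
        apply Real.sqrt_le_sqrt
        exact_mod_cast hmk
      have hsk : Real.sqrt k ≤ Real.sqrt ((k : ℝ) + 1) := Real.sqrt_le_sqrt (by linarith)
      have hpos : 0 < (1 - c) * Real.sqrt ((k : ℝ) + 1) := mul_pos (by linarith) hs
      -- In total degree one there is nothing two degrees below: both coefficients vanish, and so
      -- does the moment.
      by_cases hn : n = 1
      · obtain rfl : k = 0 := by omega
        obtain rfl : m = 0 := by omega
        have : hermiteMoment c (0 + 1) 0 = 0 := by
          have h0 : (1 - c) * Real.sqrt (((0 : ℕ) : ℝ) + 1) * hermiteMoment c (0 + 1) 0 = 0 := by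
            rw [hrec]; simp
          exact (mul_eq_zero.1 h0).resolve_left hpos.ne'
        rw [this, abs_zero]
        positivity
      obtain ⟨n, rfl⟩ : ∃ j, n = j + 2 := ⟨n - 2, by omega⟩
      set A := hermiteMoment c 0 0 * l ^ n with hA
      have hA0 : 0 ≤ A := by positivity
      have t1 : |Real.sqrt m * hermiteMoment c k (m - 1)| ≤ Real.sqrt ((k : ℝ) + 1) * A := by
        rw [abs_mul, abs_of_nonneg (Real.sqrt_nonneg _)]
        rcases Nat.eq_zero_or_pos m with rfl | hm
        · simp
          positivity
        · exact mul_le_mul hsm (ih n (by omega) _ _ (by omega)) (abs_nonneg _) hs.le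
      have t2 : |c * Real.sqrt k * hermiteMoment c (k - 1) m| ≤
          c * Real.sqrt ((k : ℝ) + 1) * A := by
        rw [abs_mul, abs_of_nonneg (mul_nonneg hc0 (Real.sqrt_nonneg _))]
        rcases Nat.eq_zero_or_pos k with rfl | hk
        · simp
          positivity
        · exact mul_le_mul (mul_le_mul_of_nonneg_left hsk hc0)
            (ih n (by omega) _ _ (by omega)) (abs_nonneg _) (by positivity)
      have h1 : (1 - c) * Real.sqrt ((k : ℝ) + 1) * |hermiteMoment c (k + 1) m| ≤
          (1 - c) * Real.sqrt ((k : ℝ) + 1) * (hermiteMoment c 0 0 * l ^ (n + 2)) := by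
        rw [← abs_of_pos hpos, ← abs_mul, hrec, abs_of_pos hpos]
        refine (abs_add_le _ _).trans ((add_le_add t1 t2).trans (le_of_eq ?_))
        rw [hA, pow_add]
        linear_combination (-(Real.sqrt ((k : ℝ) + 1) * hermiteMoment c 0 0 * l ^ n)) * hl
      exact le_of_mul_le_mul_left h1 hpos

/-! ### Matrix elements of the Weyl operators in the Fock basis -/

theorem weylFun_congr_ae (u v : ℝ) {f g : ℝ → ℂ} (h : f =ᵐ[volume] g) :
    weylFun u v f =ᵐ[volume] weylFun u v g := by
  have h' := (measurePreserving_sub_right (volume : Measure ℝ) v).quasiMeasurePreserving.ae h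
  filter_upwards [h'] with x hx
  simp only [weylFun, hx]

theorem coeFn_weyl (u v : ℝ) (f : L2) : weyl u v f =ᵐ[volume] weylFun u v f :=
  MemLp.coeFn_toLp (memLp_weylFun u v f)

theorem norm_weyl (u v : ℝ) (f : L2) : ‖weyl u v f‖ = ‖f‖ := by
  change ‖(memLp_weylFun u v f).toLp _‖ = ‖f‖
  rw [Lp.norm_toLp, eLpNorm_weylFun, Lp.norm_def]

theorem coeFn_fock (m : ℕ) : fock m =ᵐ[volume] fun x => (hermiteFun m x : ℂ) :=
  MemLp.coeFn_toLp _

/-- The Weyl transform of a Hermite function. -/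
noncomputable def weylHermite (u v : ℝ) (m : ℕ) : ℝ → ℂ :=
  weylFun u v (fun x => (hermiteFun m x : ℂ))

theorem coeFn_weyl_fock (u v : ℝ) (m : ℕ) : weyl u v (fock m) =ᵐ[volume] weylHermite u v m :=
  (coeFn_weyl u v _).trans (weylFun_congr_ae u v (coeFn_fock m))

theorem memLp_weylHermite (u v : ℝ) (m : ℕ) : MemLp (weylHermite u v m) 2 volume :=
  (Lp.memLp (weyl u v (fock m))).ae_eq (coeFn_weyl_fock u v m)

theorem norm_weylHermite (u v : ℝ) (m : ℕ) (x : ℝ) :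
    ‖weylHermite u v m x‖ = |hermiteFun m (x - v)| := by
  rw [weylHermite, norm_weylFun, Complex.norm_real, Real.norm_eq_abs]

/-- The matrix element `⟨h_k, exp(-iuQ - ivP) h_m⟩`. -/
noncomputable def overlap (k m : ℕ) (u v : ℝ) : ℂ :=
  ∫ x : ℝ, (hermiteFun k x : ℂ) * weylHermite u v m x

theorem integrable_hermiteFun_mul_weylHermite (k m : ℕ) (u v : ℝ) :
    Integrable (fun x : ℝ => (hermiteFun k x : ℂ) * weylHermite u v m x) :=
  (memLp_hermiteFun k).integrable_mul (memLp_weylHermite u v m)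

theorem inner_fock_weyl_fock (k m : ℕ) (u v : ℝ) :
    inner ℂ (fock k) (weyl u v (fock m)) = overlap k m u v := by
  rw [L2.inner_def, overlap]
  refine integral_congr_ae ?_
  filter_upwards [coeFn_fock k, coeFn_weyl_fock u v m] with x h1 h2
  rw [h1, h2]
  simp [mul_comm]

theorem weyl_zero_zero (f : L2) : weyl 0 0 f = f := by
  refine Lp.ext ((coeFn_weyl 0 0 f).trans (Eventually.of_forall fun x => ?_))
  simp [weylFun]

/-- The phase-space amplitude `(v - iu)/√2`. -/
noncomputable def amplitude (u v : ℝ) : ℂ := ((v : ℂ) - Complex.I * u) / (Real.sqrt 2 : ℝ)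

theorem conj_amplitude (u v : ℝ) :
    starRingEnd ℂ (amplitude u v) = ((v : ℂ) + Complex.I * u) / (Real.sqrt 2 : ℝ) := by
  simp only [amplitude, map_div₀, map_sub, map_mul, Complex.conj_ofReal, Complex.conj_I]
  ring

theorem hasDerivAt_weylFun (u v : ℝ) {f : ℝ → ℂ} {f' : ℂ} {x : ℝ}
    (h : HasDerivAt f f' (x - v)) :
    HasDerivAt (weylFun u v f) (-Complex.I * u * weylFun u v f x +
      Complex.exp (-Complex.I * u * x + Complex.I * u * v / 2) * f') x := by
  have h1 : HasDerivAt (fun x : ℝ => -Complex.I * u * (x : ℂ) + Complex.I * u * v / 2)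
      (-Complex.I * u) x := by
    have := ((Complex.ofRealCLM.hasDerivAt (x := x)).const_mul (-Complex.I * (u : ℂ))).add_const
      (Complex.I * u * v / 2)
    simpa using! this
  have h2 : HasDerivAt (fun x : ℝ => f (x - v)) f' x := by
    simpa using! h.scomp x ((hasDerivAt_id x).sub_const v)
  have h3 := h1.cexp.mul h2
  convert! h3 using 1
  simp only [weylFun]
  ring

/-- Again a total derivative is integrated, with `h_k` raised and the translated `h_m` lowered. The
terms `x` and `-(x - v)` and the derivative of the phase add up to the constant `v - iu`. -/
theorem overlap_succ_left (k m : ℕ) (u v : ℝ) :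
    (Real.sqrt (k + 1) : ℂ) * overlap (k + 1) m u v =
      amplitude u v * overlap k m u v + (Real.sqrt m : ℂ) * overlap k (m - 1) u v := by
  have hI := fun k m => integrable_hermiteFun_mul_weylHermite k m u v
  have h1 := (hI k m).const_mul ((v : ℂ) - Complex.I * u)
  have h2 := (hI k (m - 1)).const_mul ((Real.sqrt 2 : ℂ) * (Real.sqrt m : ℂ))
  have h3 := (hI (k + 1) m).const_mul ((Real.sqrt 2 : ℂ) * (Real.sqrt (k + 1) : ℂ))
  have hd : ∀ x : ℝ, HasDerivAt (fun x : ℝ => (hermiteFun k x : ℂ) * weylHermite u v m x)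
      (((v : ℂ) - Complex.I * u) * ((hermiteFun k x : ℂ) * weylHermite u v m x) +
        (Real.sqrt 2 : ℂ) * (Real.sqrt m : ℂ) *
          ((hermiteFun k x : ℂ) * weylHermite u v (m - 1) x) -
        (Real.sqrt 2 : ℂ) * (Real.sqrt (k + 1) : ℂ) *
          ((hermiteFun (k + 1) x : ℂ) * weylHermite u v m x)) x := by
    intro x
    have d1 := (hasDerivAt_hermiteFun k x).ofReal_comp
    have d2 := hasDerivAt_weylFun u v (hasDerivAt_hermiteFun' m (x - v)).ofReal_comp
    convert! d1.mul d2 using 1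
    simp only [weylHermite, weylFun]
    push_cast
    ring
  have h0 := integral_eq_zero_of_hasDerivAt_of_integrable hd ((h1.add h2).sub h3) (hI k m)
  have e1 := integral_sub (h1.add h2) h3
  have e2 := integral_add h1 h2
  simp only [Pi.add_apply] at e1
  rw [h0, e2, integral_const_mul, integral_const_mul, integral_const_mul] at e1
  have hs : (Real.sqrt 2 : ℂ) ≠ 0 := by
    rw [Complex.ofReal_ne_zero]; positivity
  apply mul_left_cancel₀ hs
  simp only [overlap, amplitude]
  field_simp
  linear_combination e1

theorem overlap_succ_right (k m : ℕ) (u v : ℝ) :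
    (Real.sqrt (m + 1) : ℂ) * overlap k (m + 1) u v =
      -starRingEnd ℂ (amplitude u v) * overlap k m u v +
        (Real.sqrt k : ℂ) * overlap (k - 1) m u v := by
  have hI := fun k m => integrable_hermiteFun_mul_weylHermite k m u v
  have h1 := (hI k m).const_mul (-((v : ℂ) + Complex.I * u))
  have h2 := (hI (k - 1) m).const_mul ((Real.sqrt 2 : ℂ) * (Real.sqrt k : ℂ))
  have h3 := (hI k (m + 1)).const_mul ((Real.sqrt 2 : ℂ) * (Real.sqrt (m + 1) : ℂ))
  have hd : ∀ x : ℝ, HasDerivAt (fun x : ℝ => (hermiteFun k x : ℂ) * weylHermite u v m x)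
      (-((v : ℂ) + Complex.I * u) * ((hermiteFun k x : ℂ) * weylHermite u v m x) +
        (Real.sqrt 2 : ℂ) * (Real.sqrt k : ℂ) *
          ((hermiteFun (k - 1) x : ℂ) * weylHermite u v m x) -
        (Real.sqrt 2 : ℂ) * (Real.sqrt (m + 1) : ℂ) *
          ((hermiteFun k x : ℂ) * weylHermite u v (m + 1) x)) x := by
    intro x
    have d1 := (hasDerivAt_hermiteFun' k x).ofReal_comp
    have d2 := hasDerivAt_weylFun u v (hasDerivAt_hermiteFun m (x - v)).ofReal_comp
    convert! d1.mul d2 using 1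
    simp only [weylHermite, weylFun]
    push_cast
    ring
  have h0 := integral_eq_zero_of_hasDerivAt_of_integrable hd ((h1.add h2).sub h3) (hI k m)
  have e1 := integral_sub (h1.add h2) h3
  have e2 := integral_add h1 h2
  simp only [Pi.add_apply] at e1
  rw [h0, e2, integral_const_mul, integral_const_mul, integral_const_mul] at e1
  have hs : (Real.sqrt 2 : ℂ) ≠ 0 := by
    rw [Complex.ofReal_ne_zero]; positivity
  apply mul_left_cancel₀ hs
  rw [conj_amplitude]
  simp only [overlap]
  field_simp
  linear_combination e1

theorem overlap_zero_zero (u v : ℝ) :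
    overlap 0 0 u v = Complex.exp (-((u : ℂ) ^ 2 + (v : ℂ) ^ 2) / 4) := by
  have hπ : (Real.sqrt (Real.sqrt Real.pi))⁻¹ * (Real.sqrt (Real.sqrt Real.pi))⁻¹ =
      (Real.sqrt Real.pi)⁻¹ := by
    rw [← mul_inv, Real.mul_self_sqrt (Real.sqrt_nonneg _)]
  have hπ2 : ((Real.pi : ℂ)) ^ (1 / 2 : ℂ) = (Real.sqrt Real.pi : ℂ) := by
    rw [Real.sqrt_eq_rpow, Complex.ofReal_cpow Real.pi_pos.le]
    norm_num
  have hs : (Real.sqrt Real.pi : ℂ) ≠ 0 := by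
    rw [Complex.ofReal_ne_zero]
    have := Real.pi_pos
    positivity
  have h : ∀ x : ℝ, (hermiteFun 0 x : ℂ) * weylHermite u v 0 x =
      (Real.sqrt Real.pi : ℂ)⁻¹ * Complex.exp ((-1 : ℂ) * x ^ 2 + ((v : ℂ) - Complex.I * u) * x +
        (-(v : ℂ) ^ 2 / 2 + Complex.I * u * v / 2)) := by
    intro x
    simp only [weylHermite, weylFun, hermiteFun_zero]
    rw [← Complex.ofReal_inv, ← hπ]
    push_cast
    have hsplit : Complex.exp ((-1 : ℂ) * x ^ 2 + ((v : ℂ) - Complex.I * u) * x +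
        (-(v : ℂ) ^ 2 / 2 + Complex.I * u * v / 2)) = Complex.exp (-(x : ℂ) ^ 2 / 2) *
        Complex.exp (-Complex.I * u * x + Complex.I * u * v / 2) *
        Complex.exp (-((x : ℂ) - v) ^ 2 / 2) := by
      rw [← Complex.exp_add, ← Complex.exp_add]
      congr 1
      ring
    rw [hsplit]
    ring
  rw [overlap, integral_congr_ae (Eventually.of_forall h), integral_const_mul,
    integral_cexp_quadratic (by simp)]
  rw [neg_neg, div_one, hπ2, ← mul_assoc, inv_mul_cancel₀ hs, one_mul]
  congr 1
  linear_combination ((u : ℂ) ^ 2 / 4) * Complex.I_sq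

theorem continuous_amplitude : Continuous fun w : ℝ × ℝ => amplitude w.1 w.2 := by
  unfold amplitude
  fun_prop

theorem sqrt_natCast_add_one_ne_zero (k : ℕ) : (Real.sqrt (k + 1) : ℂ) ≠ 0 := by
  rw [Complex.ofReal_ne_zero]; positivity

/-- Induction on the two indices of `overlap` along its recurrences. -/
theorem overlap_induction {p : ℕ → ℕ → Prop} (h00 : p 0 0)
    (h0 : ∀ m, p 0 m → p 0 (m + 1))
    (h1 : ∀ k, p k 0 → p (k + 1) 0)
    (h : ∀ k m, p k (m + 1) → p k m → p (k + 1) (m + 1)) (k m : ℕ) : p k m := by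
  induction k generalizing m with
  | zero =>
    induction m with
    | zero => exact h00
    | succ m ih => exact h0 m ih
  | succ k ih =>
    cases m with
    | zero => exact h1 k (ih 0)
    | succ m => exact h k m (ih _) (ih _)

theorem overlap_zero_succ (m : ℕ) (u v : ℝ) :
    overlap 0 (m + 1) u v =
      (Real.sqrt (m + 1) : ℂ)⁻¹ * (-starRingEnd ℂ (amplitude u v) * overlap 0 m u v) := by
  have h := overlap_succ_right 0 m u v
  rw [eq_inv_mul_iff_mul_eq₀ (sqrt_natCast_add_one_ne_zero m), h]
  simp

theorem overlap_succ_zero (k : ℕ) (u v : ℝ) :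
    overlap (k + 1) 0 u v =
      (Real.sqrt (k + 1) : ℂ)⁻¹ * (amplitude u v * overlap k 0 u v) := by
  have h := overlap_succ_left k 0 u v
  rw [eq_inv_mul_iff_mul_eq₀ (sqrt_natCast_add_one_ne_zero k), h]
  simp

theorem overlap_succ_succ (k m : ℕ) (u v : ℝ) :
    overlap (k + 1) (m + 1) u v = (Real.sqrt (k + 1) : ℂ)⁻¹ *
      (amplitude u v * overlap k (m + 1) u v + (Real.sqrt (m + 1) : ℂ) * overlap k m u v) := by
  have h := overlap_succ_left k (m + 1) u v
  rw [eq_inv_mul_iff_mul_eq₀ (sqrt_natCast_add_one_ne_zero k), h]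
  simp

theorem continuous_overlap (k m : ℕ) : Continuous fun w : ℝ × ℝ => overlap k m w.1 w.2 := by
  have ha := continuous_amplitude
  have hc := Complex.continuous_conj.comp ha
  refine overlap_induction (p := fun k m => Continuous fun w : ℝ × ℝ => overlap k m w.1 w.2)
    ?_ ?_ ?_ ?_ k m
  · simp only [overlap_zero_zero]
    fun_prop
  · intro m h
    simp only [overlap_zero_succ]
    exact (hc.neg.mul h).const_mul _
  · intro m h
    simp only [overlap_succ_zero]
    exact (ha.mul h).const_mul _
  · intro k m h h'
    simp only [overlap_succ_succ]
    exact ((ha.mul h).add (h'.const_mul _)).const_mul _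

/-- `overlap 0 0` is radial, raising `k` brings a factor `amplitude` and raising `m` a factor of its
conjugate; hence a rotation multiplies the element by `c^(k-m)`. Powers on both sides avoid negative
exponents. -/
theorem overlap_rotate (k m : ℕ) {u v u' v' : ℝ} {c : ℂ} (hc : c * starRingEnd ℂ c = 1)
    (hn : u' ^ 2 + v' ^ 2 = u ^ 2 + v ^ 2) (h : amplitude u' v' = c * amplitude u v) :
    c ^ m * overlap k m u' v' = c ^ k * overlap k m u v := by
  have h' : starRingEnd ℂ (amplitude u' v') =
      starRingEnd ℂ c * starRingEnd ℂ (amplitude u v) := by rw [h, map_mul]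
  refine overlap_induction
    (p := fun k m => c ^ m * overlap k m u' v' = c ^ k * overlap k m u v) ?_ ?_ ?_ ?_ k m
  · rw [overlap_zero_zero, overlap_zero_zero]
    have : (u' : ℂ) ^ 2 + (v' : ℂ) ^ 2 = (u : ℂ) ^ 2 + (v : ℂ) ^ 2 := by exact_mod_cast hn
    rw [this]
  · intro m ih
    rw [overlap_zero_succ, overlap_zero_succ, h', pow_succ]
    linear_combination (-(Real.sqrt (m + 1) : ℂ)⁻¹ * starRingEnd ℂ (amplitude u v) *
      c ^ m * overlap 0 m u' v') * hc -
      ((Real.sqrt (m + 1) : ℂ)⁻¹ * starRingEnd ℂ (amplitude u v)) * ih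
  · intro k ih
    rw [overlap_succ_zero, overlap_succ_zero, h, pow_succ]
    linear_combination (c * (Real.sqrt (k + 1) : ℂ)⁻¹ * amplitude u v) * ih
  · intro k m ih ih'
    rw [overlap_succ_succ, overlap_succ_succ, h]
    simp only [pow_succ] at ih ⊢
    linear_combination (c * (Real.sqrt (k + 1) : ℂ)⁻¹ * amplitude u v) * ih +
      (c * (Real.sqrt (k + 1) : ℂ)⁻¹ * (Real.sqrt (m + 1) : ℂ)) * ih'

theorem norm_overlap_eq (k m : ℕ) (u v : ℝ) :
    ‖overlap k m u v‖ = ‖overlap k m 0 (Real.sqrt (u ^ 2 + v ^ 2))‖ := by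
  set r := Real.sqrt (u ^ 2 + v ^ 2) with hr
  have hr2 : r ^ 2 = u ^ 2 + v ^ 2 := Real.sq_sqrt (by positivity)
  have hr2' : (r : ℂ) ^ 2 = (u : ℂ) ^ 2 + (v : ℂ) ^ 2 := by exact_mod_cast hr2
  by_cases h0 : r = 0
  · have hu : u = 0 := by nlinarith [sq_nonneg u, sq_nonneg v]
    have hv : v = 0 := by nlinarith [sq_nonneg u, sq_nonneg v]
    rw [h0, hu, hv]
  have h0' : (r : ℂ) ≠ 0 := by exact_mod_cast h0
  -- The phase that carries the amplitude at `(0, r)` to the amplitude at `(u, v)`.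
  set c : ℂ := ((v : ℂ) - Complex.I * u) / r with hcdef
  have hc : c * starRingEnd ℂ c = 1 := by
    simp only [hcdef, map_div₀, map_sub, map_mul, Complex.conj_ofReal, Complex.conj_I]
    field_simp
    linear_combination -hr2' - (u : ℂ) ^ 2 * Complex.I_sq
  have hcn : ‖c‖ = 1 := by
    have : ‖c‖ ^ 2 = 1 := by
      have h1 := Complex.mul_conj' c
      rw [hc] at h1
      exact_mod_cast h1.symm
    nlinarith [norm_nonneg c]
  have key := overlap_rotate k m (u := 0) (v := r) (u' := u) (v' := v) hc
    (by rw [hr2]; ring) (by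
      simp only [amplitude, hcdef]
      field_simp
      simp)
  have := congrArg norm key
  simpa [norm_mul, norm_pow, hcn] using this

/-- At the origin the Weyl operator is the identity, so this is orthonormality of the Fock vectors,
read off from the recurrences with zero amplitude. -/
theorem overlap_zero_zero_eq_ite (k m : ℕ) : overlap k m 0 0 = if k = m then 1 else 0 := by
  have ha : amplitude 0 0 = 0 := by simp [amplitude]
  refine overlap_induction (p := fun k m => overlap k m 0 0 = if k = m then 1 else 0)
    ?_ ?_ ?_ ?_ k m
  · simp [overlap_zero_zero]
  · intro m _
    rw [overlap_zero_succ, ha]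
    simp
  · intro k _
    rw [overlap_succ_zero, ha]
    simp
  · intro k m _ h
    rw [overlap_succ_succ, ha, h]
    by_cases hkm : k = m
    · subst hkm
      have := sqrt_natCast_add_one_ne_zero k
      simp [this]
    · simp [hkm]

theorem orthonormal_fock : Orthonormal ℂ fock := by
  rw [orthonormal_iff_ite]
  intro i j
  rw [← overlap_zero_zero_eq_ite i j, ← inner_fock_weyl_fock, weyl_zero_zero]

theorem norm_overlap_le_one (k m : ℕ) (u v : ℝ) : ‖overlap k m u v‖ ≤ 1 := by
  rw [← inner_fock_weyl_fock]
  refine (norm_inner_le_norm _ _).trans ?_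
  rw [norm_weyl, orthonormal_fock.1 k, orthonormal_fock.1 m, one_mul]

/-! ### Gaussian decay of the matrix elements -/

/-- The arithmetic-geometric inequality, weighted to offset the growth `l^(2k)` and `l^(2m)` of the
two diagonal moments in `norm_overlap_le`. -/
theorem abs_mul_le_of_pow {a b l : ℝ} (hl : 0 < l) (k m : ℕ) :
    |a * b| ≤ l ^ (k + m) / 2 * (a ^ 2 * (l ^ (2 * k))⁻¹ + b ^ 2 * (l ^ (2 * m))⁻¹) := by
  have hk : 0 < l ^ k := pow_pos hl k
  have hm : 0 < l ^ m := pow_pos hl m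
  have h : l ^ (k + m) / 2 * (a ^ 2 * (l ^ (2 * k))⁻¹ + b ^ 2 * (l ^ (2 * m))⁻¹) =
      (|a| ^ 2 * l ^ m * (l ^ k)⁻¹ + |b| ^ 2 * l ^ k * (l ^ m)⁻¹) / 2 := by
    rw [sq_abs, sq_abs, pow_add, pow_mul', pow_mul']
    field_simp
  rw [h, abs_mul]
  have h2 : 0 ≤ (l ^ k * l ^ m)⁻¹ * (|a| * l ^ m - |b| * l ^ k) ^ 2 := by positivity
  have h3 : (l ^ k * l ^ m)⁻¹ * (|a| * l ^ m - |b| * l ^ k) ^ 2 =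
      |a| ^ 2 * l ^ m * (l ^ k)⁻¹ + |b| ^ 2 * l ^ k * (l ^ m)⁻¹ - 2 * (|a| * |b|) := by
    field_simp
    ring
  linarith

/-- After rotation to `(0, r)`, weights `e^{c x²/2}` on `h_k(x)` and `e^{c (x-r)²/2}` on `h_m(x -
r)` are affordable at the price `e^{-c r²/4}`, which is the Gaussian gained. The weighted squares
integrate to diagonal moments. -/
theorem norm_overlap_le {c l : ℝ} (hc0 : 0 ≤ c) (hc : c < 1) (hl0 : 0 < l)
    (hl : (1 - c) * l ^ 2 = 1 + c) (k m : ℕ) (u v : ℝ) :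
    ‖overlap k m u v‖ ≤
      hermiteMoment c 0 0 * (l ^ (k + m) * Real.exp (-c * (u ^ 2 + v ^ 2) / 4)) := by
  set D := hermiteMoment c 0 0
  rw [norm_overlap_eq]
  set r := Real.sqrt (u ^ 2 + v ^ 2) with hr
  have hr2 : u ^ 2 + v ^ 2 = r ^ 2 := (Real.sq_sqrt (by positivity)).symm
  rw [hr2, overlap]
  have hk := integrable_hermiteFun_mul_mul_exp k k hc
  have hm := (integrable_hermiteFun_mul_mul_exp m m hc).comp_sub_right r
  set e := Real.exp (-c * r ^ 2 / 4) with he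
  have hI := (((hk.mul_const (l ^ (2 * k))⁻¹).add (hm.mul_const (l ^ (2 * m))⁻¹)).const_mul
    (e * (l ^ (k + m) / 2)))
  refine (norm_integral_le_integral_norm _).trans ?_
  refine (integral_mono (integrable_hermiteFun_mul_weylHermite k m 0 r).norm hI ?_).trans ?_
  · intro x
    simp only [norm_mul, norm_weylHermite, Complex.norm_real, Real.norm_eq_abs, Pi.add_apply]
    have h1 := abs_mul_le_of_pow (a := hermiteFun k x * Real.exp (c * x ^ 2 / 2))
      (b := hermiteFun m (x - r) * Real.exp (c * (x - r) ^ 2 / 2)) hl0 k m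
    have h2 : ∀ y : ℝ, Real.exp (c * y ^ 2) = Real.exp (c * y ^ 2 / 2) ^ 2 := by
      intro y; rw [← Real.exp_nat_mul]; congr 1; push_cast; ring
    -- Completing the square, the total exponent is `c (x - r/2)²`.
    have h3 : (1 : ℝ) ≤ e * (Real.exp (c * x ^ 2 / 2) * Real.exp (c * (x - r) ^ 2 / 2)) := by
      rw [he, ← Real.exp_add, ← Real.exp_add]
      apply Real.one_le_exp
      nlinarith [mul_nonneg hc0 (sq_nonneg (x - r / 2))]
    calc |hermiteFun k x| * |hermiteFun m (x - r)|
        ≤ |hermiteFun k x| * |hermiteFun m (x - r)| *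
          (e * (Real.exp (c * x ^ 2 / 2) * Real.exp (c * (x - r) ^ 2 / 2))) :=
          le_mul_of_one_le_right (by positivity) h3
      _ = e * |hermiteFun k x * Real.exp (c * x ^ 2 / 2) *
          (hermiteFun m (x - r) * Real.exp (c * (x - r) ^ 2 / 2))| := by
          simp only [abs_mul, Real.abs_exp]
          ring
      _ ≤ _ := mul_le_mul_of_nonneg_left h1 (Real.exp_pos _).le
      _ = _ := by
          rw [h2 x, h2 (x - r)]
          ring
  · have hA : ∀ j : ℕ, hermiteMoment c j j * (l ^ (2 * j))⁻¹ ≤ D := by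
      intro j
      have h := (le_abs_self _).trans (abs_hermiteMoment_le hc0 hc hl0.le hl j j)
      rw [← div_eq_mul_inv, div_le_iff₀ (by positivity), two_mul]
      exact h
    have e2 := integral_add (hk.mul_const (l ^ (2 * k))⁻¹) (hm.mul_const (l ^ (2 * m))⁻¹)
    have e3 := integral_sub_right_eq_self
      (fun x : ℝ => hermiteFun m x * hermiteFun m x * Real.exp (c * x ^ 2)) (μ := volume) r
    simp only [Pi.add_apply]
    rw [integral_const_mul, e2, integral_mul_const, integral_mul_const, e3]
    have := add_le_add (hA k) (hA m)
    simp only [hermiteMoment] at this ⊢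
    have h5 : 0 ≤ e * (l ^ (k + m) / 2) := by positivity
    calc _ ≤ e * (l ^ (k + m) / 2) * (D + D) := mul_le_mul_of_nonneg_left this h5
      _ = _ := by ring

/-! ### Completeness of the Fock basis -/

/-- A smooth compactly supported test function is the Fourier transform of a Schwartz function `F`,
so its pairing with `g` equals that of `F` with the transform of `g`, which is zero. -/
theorem ae_eq_zero_of_fourier_eq_zero {g : ℝ → ℂ} (hg : Integrable g)
    (h : ∀ u : ℝ, ∫ x : ℝ, Complex.exp (-Complex.I * u * x) * g x = 0) : ∀ᵐ x, g x = 0 := by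
  have hF : FourierTransform.fourier g = 0 := by
    funext w
    rw [Real.fourier_real_eq_integral_exp_smul, Pi.zero_apply, ← h (2 * Real.pi * w)]
    refine integral_congr_ae (Eventually.of_forall fun x => ?_)
    simp only [smul_eq_mul]
    congr 2
    push_cast
    ring
  refine ae_eq_zero_of_integral_contDiff_smul_eq_zero hg.locallyIntegrable fun ψ hψ hc => ?_
  have hc' : HasCompactSupport fun x => (ψ x : ℂ) := hc.comp_left Complex.ofReal_zero
  set φ : SchwartzMap ℝ ℂ := hc'.toSchwartzMap (Complex.ofRealCLM.contDiff.comp hψ) with hφ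
  set F : SchwartzMap ℝ ℂ := FourierTransformInv.fourierInv φ with hFdef
  have h1 : ∀ x, FourierTransform.fourier (F : ℝ → ℂ) x = (ψ x : ℂ) := by
    intro x
    rw [← SchwartzMap.fourier_coe, hFdef, FourierTransform.fourier_fourierInv_eq]
    rfl
  have h2 : ∫ ξ, FourierTransform.fourier (F : ℝ → ℂ) ξ • g ξ =
      ∫ x, F x • FourierTransform.fourier g x := by
    simpa using! (VectorFourier.integral_fourierIntegral_smul_eq_flip (L := innerₗ ℝ)
      Real.continuous_fourierChar continuous_inner F.integrable hg)
  rw [hF] at h2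
  simp only [h1] at h2
  simpa using h2

/-- Parseval's equality for the single vector `x` already puts `x` in the closed span of `e`. This
is what makes it usable before completeness is known. -/
theorem inner_eq_zero_of_hasSum_sq {e : ℕ → L2} (he : Orthonormal ℂ e) {x f : L2}
    (hx : HasSum (fun k => ‖(inner ℂ (e k) x : ℂ)‖ ^ 2) (‖x‖ ^ 2))
    (hf : ∀ k, (inner ℂ f (e k) : ℂ) = 0) : (inner ℂ f x : ℂ) = 0 := by
  set c : ℕ → ℂ := fun k => inner ℂ (e k) x with hc
  set p : ℕ → L2 := fun N => ∑ k ∈ Finset.range N, c k • e k with hp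
  have h1 : ∀ N, ‖x - p N‖ ^ 2 = ‖x‖ ^ 2 - ∑ k ∈ Finset.range N, ‖c k‖ ^ 2 := by
    intro N
    have hxp : (inner ℂ x (p N) : ℂ) = ((∑ k ∈ Finset.range N, ‖c k‖ ^ 2 : ℝ) : ℂ) := by
      rw [hp, inner_sum]
      push_cast
      refine Finset.sum_congr rfl fun k _ => ?_
      rw [inner_smul_right, ← inner_conj_symm, ← Complex.mul_conj']
    have hpp : (inner ℂ (p N) (p N) : ℂ) = ((∑ k ∈ Finset.range N, ‖c k‖ ^ 2 : ℝ) : ℂ) := by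
      rw [hp, he.inner_sum]
      push_cast
      refine Finset.sum_congr rfl fun k _ => ?_
      rw [← Complex.conj_mul']
    have hpn : ‖p N‖ ^ 2 = ∑ k ∈ Finset.range N, ‖c k‖ ^ 2 := by
      have h : ((‖p N‖ ^ 2 : ℝ) : ℂ) = ((∑ k ∈ Finset.range N, ‖c k‖ ^ 2 : ℝ) : ℂ) := by
        rw [← hpp, inner_self_eq_norm_sq_to_K (𝕜 := ℂ) (p N)]
        push_cast
        rfl
      exact Complex.ofReal_injective h
    rw [norm_sub_sq (𝕜 := ℂ), hxp, hpn]
    simp only [RCLike.re_to_complex, Complex.ofReal_re]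
    ring
  have h2 : ∀ N, ‖(inner ℂ f x : ℂ)‖ ^ 2 ≤
      ‖f‖ ^ 2 * (‖x‖ ^ 2 - ∑ k ∈ Finset.range N, ‖c k‖ ^ 2) := by
    intro N
    have h3 : (inner ℂ f x : ℂ) = inner ℂ f (x - p N) := by
      rw [inner_sub_right, hp, inner_sum]
      simp [inner_smul_right, hf]
    rw [h3, ← h1, ← mul_pow]
    exact pow_le_pow_left₀ (norm_nonneg _) (norm_inner_le_norm _ _) 2
  have h4 : Tendsto (fun N => ‖f‖ ^ 2 * (‖x‖ ^ 2 - ∑ k ∈ Finset.range N, ‖c k‖ ^ 2)) atTop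
      (𝓝 (‖f‖ ^ 2 * (‖x‖ ^ 2 - ‖x‖ ^ 2))) :=
    (hx.tendsto_sum_nat.const_sub _).const_mul _
  rw [sub_self, mul_zero] at h4
  have h5 := ge_of_tendsto' h4 h2
  have h6 : ‖(inner ℂ f x : ℂ)‖ = 0 := by
    have := norm_nonneg (inner ℂ f x : ℂ)
    nlinarith
  simpa using h6

theorem sq_norm_amplitude (u v : ℝ) : ‖amplitude u v‖ ^ 2 = (u ^ 2 + v ^ 2) / 2 := by
  have h := Complex.mul_conj' (amplitude u v)
  rw [conj_amplitude, amplitude] at h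
  have h2 : (Real.sqrt 2 : ℂ) * (Real.sqrt 2 : ℂ) = 2 := by
    exact_mod_cast Real.mul_self_sqrt (by norm_num : (0 : ℝ) ≤ 2)
  rw [div_mul_div_comm, h2] at h
  have h3 : (((u ^ 2 + v ^ 2) / 2 : ℝ) : ℂ) = (‖amplitude u v‖ : ℂ) ^ 2 := by
    rw [amplitude, ← h]
    push_cast
    linear_combination ((u : ℂ) ^ 2 / 2) * Complex.I_sq
  exact_mod_cast h3.symm

/-- A displaced ground state is a coherent state: its Fock weights are Poisson with mean `(u² +
v²)/2`. -/
theorem sq_norm_overlap_zero_right (k : ℕ) (u v : ℝ) :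
    ‖overlap k 0 u v‖ ^ 2 = Real.exp (-((u ^ 2 + v ^ 2) / 2)) *
      (((u ^ 2 + v ^ 2) / 2) ^ k / (k.factorial : ℝ)) := by
  induction k with
  | zero =>
    rw [overlap_zero_zero, Complex.norm_exp, ← Real.exp_nat_mul]
    have : (-((u : ℂ) ^ 2 + (v : ℂ) ^ 2) / 4).re = -(u ^ 2 + v ^ 2) / 4 := by
      rw [show (-((u : ℂ) ^ 2 + (v : ℂ) ^ 2) / 4) = ((-(u ^ 2 + v ^ 2) / 4 : ℝ) : ℂ) by
        push_cast; ring, Complex.ofReal_re]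
    rw [this]
    simp
    ring
  | succ k ih =>
    rw [overlap_succ_zero, norm_mul, norm_mul, mul_pow, mul_pow, ih, sq_norm_amplitude, norm_inv,
      Complex.norm_real, Real.norm_eq_abs, abs_of_nonneg (Real.sqrt_nonneg _), inv_pow,
      Real.sq_sqrt (by positivity), Nat.factorial_succ, pow_succ]
    push_cast
    field_simp
    ring

theorem hasSum_sq_norm_overlap_zero_right (u v : ℝ) :
    HasSum (fun k => ‖overlap k 0 u v‖ ^ 2) 1 := by
  simp only [sq_norm_overlap_zero_right]
  have h := (NormedSpace.expSeries_div_hasSum_exp ((u ^ 2 + v ^ 2) / 2)).mul_left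
    (Real.exp (-((u ^ 2 + v ^ 2) / 2)))
  rw [← Real.exp_eq_exp_ℝ, ← Real.exp_add, neg_add_cancel, Real.exp_zero] at h
  exact h

/-- The Poisson weights sum to one, so each `e^{-iux} h_0` lies in the closed span of the Fock
vectors. If `f` is orthogonal to them, the Fourier transform of `conj f · h_0` vanishes, and `h_0`
has no zero. -/
theorem eq_zero_of_inner_fock_eq_zero {f : L2} (hf : ∀ k, (inner ℂ f (fock k) : ℂ) = 0) :
    f = 0 := by
  have h1 : ∀ u : ℝ, (inner ℂ f (weyl u 0 (fock 0)) : ℂ) = 0 := by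
    intro u
    refine inner_eq_zero_of_hasSum_sq orthonormal_fock ?_ hf
    simp only [inner_fock_weyl_fock, norm_weyl, orthonormal_fock.1 0, one_pow]
    exact hasSum_sq_norm_overlap_zero_right u 0
  set g : ℝ → ℂ := fun x => starRingEnd ℂ (f x) * (hermiteFun 0 x : ℂ) with hg
  have hgi : Integrable g := by
    have : MemLp (fun x => starRingEnd ℂ (f x)) 2 volume := (Lp.memLp f).star
    exact this.integrable_mul (memLp_hermiteFun 0)
  have h2 : ∀ u : ℝ, ∫ x : ℝ, Complex.exp (-Complex.I * u * x) * g x = 0 := by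
    intro u
    rw [← h1 u, L2.inner_def]
    refine integral_congr_ae ?_
    filter_upwards [coeFn_weyl_fock u 0 0] with x hx
    rw [hx]
    simp only [hg, weylHermite, weylFun, RCLike.inner_apply]
    simp
    ring
  have h3 := ae_eq_zero_of_fourier_eq_zero hgi h2
  refine Lp.ext ?_
  filter_upwards [h3, Lp.coeFn_zero ℂ 2 (volume : Measure ℝ)] with x hx h0
  rw [h0]
  have hpos : (hermiteFun 0 x : ℂ) ≠ 0 := by
    rw [Complex.ofReal_ne_zero, hermiteFun_zero]
    have := Real.pi_pos
    positivity
  simpa [hg, hpos] using hx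

/-- The Fock basis as a Hilbert basis. -/
noncomputable def fockBasis : HilbertBasis ℕ ℂ L2 :=
  HilbertBasis.mkOfOrthogonalEqBot orthonormal_fock (by
    rw [Submodule.eq_bot_iff]
    intro f hf
    apply eq_zero_of_inner_fock_eq_zero
    intro k
    rw [Submodule.mem_orthogonal'] at hf
    exact hf _ (Submodule.subset_span ⟨k, rfl⟩))

theorem fockBasis_apply (k : ℕ) : fockBasis k = fock k := by
  rw [fockBasis, HilbertBasis.coe_mkOfOrthogonalEqBot]

/-! ### Expansion of the Fourier transform of the Wigner function -/

theorem QuantumState.inner_op_left (ρ : QuantumState) (f g : L2) :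
    (inner ℂ (ρ.op f) g : ℂ) = inner ℂ f (ρ.op g) :=
  ρ.isPositive.isSymmetric f g

theorem QuantumState.conj_entry (ρ : QuantumState) (m k : ℕ) :
    starRingEnd ℂ (ρ.entry m k) = ρ.entry k m := by
  rw [QuantumState.entry, inner_conj_symm, ρ.inner_op_left, QuantumState.entry]

/-- The Fock basis is inserted between `ρ` and the Weyl operator. Overlaps are at most one in norm,
so summable entries allow a single sum over pairs. -/
theorem wignerFourier_eq_tsum (ρ : QuantumState)
    (hρ : Summable fun p : ℕ × ℕ => ‖ρ.entry p.1 p.2‖) (u v : ℝ) :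
    wignerFourier ρ u v = ∑' p : ℕ × ℕ, ρ.entry p.1 p.2 * overlap p.2 p.1 u v := by
  have hs : Summable fun p : ℕ × ℕ => ρ.entry p.1 p.2 * overlap p.2 p.1 u v := by
    refine Summable.of_norm_bounded hρ fun p => ?_
    rw [norm_mul]
    exact mul_le_of_le_one_right (norm_nonneg _) (norm_overlap_le_one _ _ _ _)
  rw [hs.tsum_prod, wignerFourier, trace]
  refine tsum_congr fun m => ?_
  rw [ContinuousLinearMap.comp_apply, ← ρ.inner_op_left,
    ← fockBasis.tsum_inner_mul_inner]
  refine tsum_congr fun k => ?_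
  rw [fockBasis_apply, ρ.inner_op_left, inner_fock_weyl_fock]
  rfl

theorem wignerFourier_zero_zero (ρ : QuantumState) : wignerFourier ρ 0 0 = 1 := by
  rw [wignerFourier, trace, ← ρ.trace_one.tsum_eq]
  refine tsum_congr fun m => ?_
  rw [ContinuousLinearMap.comp_apply, weyl_zero_zero]

/-! ### Exponential bounds -/

/-- The exponent four serves twice: it splits into two summable squares for sums over `ℕ × ℕ`, and
it is integrable on the plane. -/
theorem exists_exp_neg_mul_rpow_le {ε p : ℝ} (hε : 0 < ε) (hp : 0 < p) :
    ∃ C : ℝ, 0 < C ∧ ∀ x : ℝ, 0 ≤ x → Real.exp (-ε * x ^ p) ≤ C * (1 + x) ^ (-4 : ℝ) := by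
  obtain ⟨n, hn⟩ := exists_nat_ge (4 / p)
  rw [div_le_iff₀ hp] at hn
  -- The factor `16` bounds `(1 + x)^4` on `[0, 1]`; beyond, the `n`-th term of the exponential
  -- series dominates `x^4` because `n p ≥ 4`.
  refine ⟨16 * (1 + n.factorial / ε ^ n), by positivity, fun x hx => ?_⟩
  have h1x : (0 : ℝ) < 1 + x := by linarith
  have h4 : (1 + x) ^ (-4 : ℝ) = ((1 + x) ^ 4)⁻¹ := by
    rw [Real.rpow_neg h1x.le, show (4 : ℝ) = ((4 : ℕ) : ℝ) by norm_num, Real.rpow_natCast]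
  have hf : (0 : ℝ) ≤ n.factorial / ε ^ n := by positivity
  rw [h4, ← div_eq_mul_inv, le_div_iff₀ (by positivity)]
  have hxp : 0 ≤ x ^ p := Real.rpow_nonneg hx p
  rcases le_total x 1 with h | h
  · have h1 : Real.exp (-ε * x ^ p) ≤ 1 := Real.exp_le_one_iff.2 (by nlinarith)
    have h2 : (1 + x) ^ 4 ≤ 16 := by
      calc (1 + x) ^ 4 ≤ 2 ^ 4 := pow_le_pow_left₀ h1x.le (by linarith) 4
        _ = 16 := by norm_num
    calc Real.exp (-ε * x ^ p) * (1 + x) ^ 4 ≤ 1 * 16 :=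
          mul_le_mul h1 h2 (by positivity) (by norm_num)
      _ ≤ _ := by linarith
  · have hx0 : 0 < x := by linarith
    have h1 : (ε * x ^ p) ^ n / n.factorial ≤ Real.exp (ε * x ^ p) :=
      Real.pow_div_factorial_le_exp _ (by positivity) n
    have h2 : x ^ 4 ≤ (x ^ p) ^ n := by
      rw [← Real.rpow_natCast (x ^ p) n, ← Real.rpow_mul hx, ← Real.rpow_natCast x 4]
      exact Real.rpow_le_rpow_of_exponent_le h (by push_cast; linarith)
    have h3 : (1 + x) ^ 4 ≤ 16 * x ^ 4 := by
      calc (1 + x) ^ 4 ≤ (2 * x) ^ 4 := pow_le_pow_left₀ h1x.le (by linarith) 4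
        _ = 16 * x ^ 4 := by ring
    have h5 : x ^ 4 ≤ n.factorial / ε ^ n * Real.exp (ε * x ^ p) := by
      rw [mul_pow, div_le_iff₀ (by positivity)] at h1
      rw [div_mul_eq_mul_div, le_div_iff₀ (by positivity)]
      nlinarith [pow_pos hε n]
    have h6 : Real.exp (-ε * x ^ p) * Real.exp (ε * x ^ p) = 1 := by
      rw [← Real.exp_add]; simp
    calc Real.exp (-ε * x ^ p) * (1 + x) ^ 4
        ≤ Real.exp (-ε * x ^ p) * (16 * (n.factorial / ε ^ n * Real.exp (ε * x ^ p))) :=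
          mul_le_mul_of_nonneg_left (by linarith) (Real.exp_pos _).le
      _ = 16 * (n.factorial / ε ^ n) * (Real.exp (-ε * x ^ p) * Real.exp (ε * x ^ p)) := by ring
      _ ≤ _ := by rw [h6]; linarith

theorem summable_exp_neg_mul_rpow {ε p : ℝ} (hε : 0 < ε) (hp : 0 < p) :
    Summable fun q : ℕ × ℕ => Real.exp (-ε * ((q.1 : ℝ) + (q.2 : ℝ)) ^ p) := by
  obtain ⟨C, hC, h⟩ := exists_exp_neg_mul_rpow_le hε hp
  have h1 : Summable fun m : ℕ => ((m + 1 : ℕ) : ℝ) ^ (-2 : ℝ) :=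
    (summable_nat_add_iff 1).2 (Real.summable_nat_rpow.2 (by norm_num))
  have h2 := (h1.mul_of_nonneg h1 (fun m => by positivity) (fun m => by positivity)).mul_left C
  refine Summable.of_nonneg_of_le (fun q => (Real.exp_pos _).le) (fun q => ?_) h2
  refine (h _ (by positivity)).trans (mul_le_mul_of_nonneg_left ?_ hC.le)
  have ha : (1 + ((q.1 : ℝ) + q.2)) ^ (-2 : ℝ) ≤ ((q.1 + 1 : ℕ) : ℝ) ^ (-2 : ℝ) := by
    refine Real.rpow_le_rpow_of_nonpos (by positivity) ?_ (by norm_num)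
    push_cast
    linarith [(Nat.cast_nonneg q.2 : (0 : ℝ) ≤ q.2)]
  have hb : (1 + ((q.1 : ℝ) + q.2)) ^ (-2 : ℝ) ≤ ((q.2 + 1 : ℕ) : ℝ) ^ (-2 : ℝ) := by
    refine Real.rpow_le_rpow_of_nonpos (by positivity) ?_ (by norm_num)
    push_cast
    linarith [(Nat.cast_nonneg q.1 : (0 : ℝ) ≤ q.1)]
  have hab : (1 + ((q.1 : ℝ) + q.2)) ^ (-4 : ℝ) =
      (1 + ((q.1 : ℝ) + q.2)) ^ (-2 : ℝ) * (1 + ((q.1 : ℝ) + q.2)) ^ (-2 : ℝ) := by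
    rw [← Real.rpow_add (by positivity)]; norm_num
  rw [hab]
  exact mul_le_mul ha hb (by positivity) (by positivity)

theorem exists_mul_rpow_le_add {a b r : ℝ} (ha : 0 < a) (hb : 0 < b) (hr : 0 < r) (hr2 : r < 2) :
    ∃ K : ℝ, ∀ x : ℝ, 0 ≤ x → b * x ^ r ≤ a * x ^ 2 + K := by
  -- The point where `b x^r` and `a x²` cross.
  set R : ℝ := (b / a) ^ (1 / (2 - r)) with hR
  have hRpos : 0 < R := by positivity
  refine ⟨b * R ^ r, fun x hx => ?_⟩
  rcases le_total x R with h | h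
  · have := mul_le_mul_of_nonneg_left (Real.rpow_le_rpow hx h hr.le) hb.le
    nlinarith [mul_nonneg ha.le (sq_nonneg x)]
  · have hxpos : 0 < x := hRpos.trans_le h
    have h1 : b / a ≤ x ^ (2 - r) := by
      have := Real.rpow_le_rpow hRpos.le h (by linarith : (0 : ℝ) ≤ 2 - r)
      rwa [hR, ← Real.rpow_mul (by positivity), one_div,
        inv_mul_cancel₀ (by linarith : (2 : ℝ) - r ≠ 0), Real.rpow_one] at this
    rw [div_le_iff₀ ha] at h1
    have h2 : x ^ (2 - r) * x ^ r = x ^ 2 := by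
      rw [← Real.rpow_add hxpos, ← Real.rpow_natCast]; norm_num
    have h3 : 0 < x ^ r := Real.rpow_pos_of_pos hxpos r
    have h4 : 0 < b * R ^ r := by positivity
    nlinarith

/-- The admissible rates: any `β < B` for `r < 2`, and `β = B / (1 + √B)²` for `r = 2`. -/
def AdmissibleRate (B r β : ℝ) : Prop :=
  (0 < r ∧ r < 2 ∧ β < B) ∨ (r = 2 ∧ β = B / (1 + Real.sqrt B) ^ 2)

theorem AdmissibleRate.pos {B r β : ℝ} (h : AdmissibleRate B r β) : 0 < r := by
  rcases h with h | h
  · exact h.1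
  · rw [h.1]; norm_num

theorem AdmissibleRate.le_two {B r β : ℝ} (h : AdmissibleRate B r β) : r ≤ 2 := by
  rcases h with h | h
  · exact h.2.1.le
  · exact h.1.le

theorem hermiteMoment_zero_zero_nonneg (c : ℝ) : 0 ≤ hermiteMoment c 0 0 :=
  integral_nonneg fun _ => mul_nonneg (mul_self_nonneg _) (Real.exp_pos _).le

/-- Compare `M = m + k` with `(1 - 2c) x²`. If `M` is larger, the matrix decay alone suffices.
Otherwise `l^M` cannot offset the Gaussian, and the overlap is `O(exp(-c² x²))`, which beats `exp(-b
x^r)` since `r < 2`. The gap between `b'` and `B` pays for summability. -/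
theorem exists_exp_mul_norm_overlap_le_of_lt_two {B r β : ℝ} (hB : 0 < B) (hr : 0 < r)
    (hr2 : r < 2) (hβ : β < B) :
    ∃ b ε C : ℝ, β < b ∧ 0 < b ∧ 0 < ε ∧ 0 < C ∧ ∀ (k m : ℕ) (u v x : ℝ), 0 ≤ x →
      u ^ 2 + v ^ 2 = 4 * x ^ 2 →
      Real.exp (-B * ((m : ℝ) + k) ^ (r / 2)) * ‖overlap k m u v‖ ≤
        C * Real.exp (-ε * ((m : ℝ) + k) ^ (r / 2)) * Real.exp (-b * x ^ r) := by
  have hb0 : max β 0 < B := max_lt hβ hB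
  obtain ⟨b, hb1, hb2⟩ := exists_between hb0
  obtain ⟨b', hb3, hb4⟩ := exists_between hb2
  have hb : 0 < b := (le_max_right _ _).trans_lt hb1
  have hb' : 0 < b' := hb.trans hb3
  -- Chosen so that the threshold `1 - 2c` equals `b/b'`, the loss between the rates `b'` and `b`.
  set c : ℝ := (1 - b / b') / 2 with hc
  have hq1 : b / b' < 1 := (div_lt_one hb').2 hb3
  have hq0 : 0 < b / b' := by positivity
  have hc0 : 0 < c := by rw [hc]; linarith
  have hc1 : c < 1 := by rw [hc]; linarith
  have hq : b / b' = 1 - 2 * c := by rw [hc]; ring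
  set l : ℝ := Real.sqrt ((1 + c) / (1 - c)) with hl
  have h1c : 0 < 1 - c := by linarith
  have hl2 : l ^ 2 = (1 + c) / (1 - c) := Real.sq_sqrt (by positivity)
  have hlpos : 0 < l := by positivity
  have hll : (1 - c) * l ^ 2 = 1 + c := by rw [hl2]; field_simp
  -- Since `l² = 1 + 2c/(1 - c)`.
  have hlexp : l ≤ Real.exp (c / (1 - c)) := by
    refine Real.sqrt_le_iff.2 ⟨(Real.exp_pos _).le, ?_⟩
    have h1 := Real.add_one_le_exp (2 * (c / (1 - c)))
    rw [← Real.exp_nat_mul]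
    push_cast
    refine le_trans (le_of_eq ?_) h1
    field_simp
    ring
  obtain ⟨K, hK⟩ := exists_mul_rpow_le_add (a := c ^ 2) (by positivity) hb hr hr2
  set D := hermiteMoment c 0 0 with hD
  have hD0 : 0 ≤ D := hermiteMoment_zero_zero_nonneg c
  refine ⟨b, B - b', 1 + D * Real.exp K, (le_max_left _ _).trans_lt hb1, hb, by linarith,
    by positivity, fun k m u v x hx hxuv => ?_⟩
  set M : ℝ := (m : ℝ) + k with hM
  have hM0 : 0 ≤ M := by positivity
  have hMr : 0 ≤ M ^ (r / 2) := Real.rpow_nonneg hM0 _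
  have hDK : 0 ≤ D * Real.exp K := by positivity
  rcases le_total ((1 - 2 * c) * x ^ 2) M with h | h
  · have h1 : b * x ^ r ≤ b' * M ^ (r / 2) := by
      have h2 : ((1 - 2 * c) * x ^ 2) ^ (r / 2) ≤ M ^ (r / 2) :=
        Real.rpow_le_rpow (by rw [← hq]; positivity) h (by linarith)
      rw [Real.mul_rpow (by rw [← hq]; positivity) (by positivity), ← Real.rpow_natCast x 2,
        ← Real.rpow_mul hx] at h2
      have h3 : (1 - 2 * c) ≤ (1 - 2 * c) ^ (r / 2) := by
        have := Real.rpow_le_rpow_of_exponent_ge (x := 1 - 2 * c) (by rw [← hq]; exact hq0)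
          (by linarith) (by linarith : r / 2 ≤ 1)
        rwa [Real.rpow_one] at this
      have h4 : ((2 : ℕ) : ℝ) * (r / 2) = r := by push_cast; ring
      rw [h4] at h2
      have h5 := (mul_le_mul_of_nonneg_right h3 (Real.rpow_nonneg hx r)).trans h2
      rw [← hq, div_mul_eq_mul_div, div_le_iff₀ hb'] at h5
      linarith
    calc Real.exp (-B * M ^ (r / 2)) * ‖overlap k m u v‖
        ≤ Real.exp (-B * M ^ (r / 2)) * 1 :=
          mul_le_mul_of_nonneg_left (norm_overlap_le_one _ _ _ _) (Real.exp_pos _).le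
      _ ≤ Real.exp (-(B - b') * M ^ (r / 2)) * Real.exp (-b * x ^ r) := by
          rw [mul_one, ← Real.exp_add]
          apply Real.exp_le_exp.2
          linarith
      _ ≤ _ := by
          rw [mul_assoc]
          exact le_mul_of_one_le_left (by positivity) (by linarith)
  · have h1 := norm_overlap_le hc0.le hc1 hlpos hll k m u v
    rw [hxuv] at h1
    have h2 : l ^ (k + m) ≤ Real.exp (M * (c / (1 - c))) := by
      refine (pow_le_pow_left₀ hlpos.le hlexp _).trans (le_of_eq ?_)
      rw [← Real.exp_nat_mul]
      congr 1
      rw [hM]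
      push_cast
      ring
    have h3 : M * (c / (1 - c)) + -c * (4 * x ^ 2) / 4 ≤ -b * x ^ r + K := by
      have h4 := hK x hx
      have h5 : M * (c / (1 - c)) ≤ (1 - 2 * c) * x ^ 2 * (c / (1 - c)) :=
        mul_le_mul_of_nonneg_right h (by positivity)
      -- From `1 - 2c ≤ (1 - c)²`: the growth of `l^M` leaves `exp(-c² x²)` of the Gaussian `exp(-c
      -- x²)`.
      have h6 : (1 - 2 * c) * x ^ 2 * (c / (1 - c)) ≤ c * x ^ 2 - c ^ 2 * x ^ 2 := by
        rw [← mul_div_assoc, div_le_iff₀ h1c]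
        nlinarith [mul_nonneg (pow_nonneg hc0.le 3) (sq_nonneg x)]
      linarith
    have h7 : ‖overlap k m u v‖ ≤ D * Real.exp K * Real.exp (-b * x ^ r) := by
      refine h1.trans ?_
      rw [mul_assoc, ← Real.exp_add]
      refine mul_le_mul_of_nonneg_left ?_ hD0
      calc _ ≤ Real.exp (M * (c / (1 - c))) * Real.exp (-c * (4 * x ^ 2) / 4) :=
            mul_le_mul_of_nonneg_right h2 (Real.exp_pos _).le
        _ ≤ _ := by
            rw [← Real.exp_add]
            exact Real.exp_le_exp.2 (by linarith)
    calc Real.exp (-B * M ^ (r / 2)) * ‖overlap k m u v‖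
        ≤ Real.exp (-(B - b') * M ^ (r / 2)) * (D * Real.exp K * Real.exp (-b * x ^ r)) :=
          mul_le_mul (Real.exp_le_exp.2 (by nlinarith)) h7 (norm_nonneg _) (Real.exp_pos _).le
      _ = D * Real.exp K * (Real.exp (-(B - b') * M ^ (r / 2)) * Real.exp (-b * x ^ r)) := by ring
      _ ≤ (1 + D * Real.exp K) *
          (Real.exp (-(B - b') * M ^ (r / 2)) * Real.exp (-b * x ^ r)) :=
          mul_le_mul_of_nonneg_right (by linarith) (by positivity)
      _ = _ := by ring

/-- Here both factors are exponential in `m + k`, so `l < e^B`, that is `c < tanh B`, is all that is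
needed. As `β` satisfies it strictly, by continuity so does some `c > β`. -/
theorem exists_exp_mul_norm_overlap_le_of_eq_two {B β : ℝ} (hB : 0 < B)
    (hβ : β = B / (1 + Real.sqrt B) ^ 2) :
    ∃ b ε C : ℝ, β < b ∧ 0 < b ∧ 0 < ε ∧ 0 < C ∧ ∀ (k m : ℕ) (u v x : ℝ), 0 ≤ x →
      u ^ 2 + v ^ 2 = 4 * x ^ 2 →
      Real.exp (-B * ((m : ℝ) + k)) * ‖overlap k m u v‖ ≤
        C * Real.exp (-ε * ((m : ℝ) + k)) * Real.exp (-b * x ^ 2) := by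
  set t := Real.sqrt B with ht
  have htpos : 0 < t := Real.sqrt_pos.2 hB
  have ht2 : t ^ 2 = B := Real.sq_sqrt hB.le
  have hβ0 : 0 < β := by rw [hβ]; positivity
  have hβ1 : β < 1 := by
    rw [hβ, div_lt_one (by positivity)]
    nlinarith
  -- Using `1 + 2B ≤ e^{2B}` this reduces to `β (1 + B) < B`, true because `1 + B < (1 + √B)²`.
  have hf : (1 + β) / (1 - β) < Real.exp (2 * B) := by
    have h1 : 2 * B + 1 ≤ Real.exp (2 * B) := Real.add_one_le_exp _
    refine lt_of_lt_of_le ?_ h1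
    rw [div_lt_iff₀ (by linarith)]
    have h2 : β * (1 + t) ^ 2 = B := by rw [hβ]; field_simp
    have h3 : β * (1 + B) < B := by
      rw [← ht2] at h2 ⊢
      nlinarith [mul_pos hβ0 htpos]
    nlinarith
  have hcont : ContinuousAt (fun c : ℝ => (1 + c) / (1 - c)) β :=
    ContinuousAt.div (by fun_prop) (by fun_prop) (by linarith)
  have hev : ∀ᶠ c in 𝓝[>] β, (1 + c) / (1 - c) < Real.exp (2 * B) ∧ c < 1 :=
    ((hcont.eventually_lt_const hf).and (eventually_lt_nhds hβ1)).filter_mono nhdsWithin_le_nhds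
  obtain ⟨c, ⟨hc2, hc1⟩, hcβ⟩ := (hev.and self_mem_nhdsWithin).exists
  have hcβ' : β < c := hcβ
  have hc0 : 0 < c := hβ0.trans hcβ'
  have h1c : 0 < 1 - c := by linarith
  set l : ℝ := Real.sqrt ((1 + c) / (1 - c)) with hl
  have hl2 : l ^ 2 = (1 + c) / (1 - c) := Real.sq_sqrt (by positivity)
  have hlpos : 0 < l := by positivity
  have hll : (1 - c) * l ^ 2 = 1 + c := by rw [hl2]; field_simp
  have hlB : Real.log l < B := by
    have h1 := Real.log_lt_log (by positivity) hc2
    rw [← hl2, Real.log_pow, Real.log_exp] at h1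
    push_cast at h1
    linarith
  set D := hermiteMoment c 0 0 with hD
  have hD0 : 0 ≤ D := hermiteMoment_zero_zero_nonneg c
  refine ⟨c, B - Real.log l, 1 + D, hcβ', hc0, by linarith, by linarith,
    fun k m u v x hx hxuv => ?_⟩
  have h1 := norm_overlap_le hc0.le hc1 hlpos hll k m u v
  rw [hxuv] at h1
  have h2 : l ^ (k + m) = Real.exp (Real.log l * ((m : ℝ) + k)) := by
    rw [mul_comm, ← Nat.cast_add, Real.exp_nat_mul, Real.exp_log hlpos, add_comm]
  have h3 : -c * (4 * x ^ 2) / 4 = -c * x ^ 2 := by ring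
  rw [h2, h3] at h1
  calc Real.exp (-B * ((m : ℝ) + k)) * ‖overlap k m u v‖
      ≤ Real.exp (-B * ((m : ℝ) + k)) *
        (D * (Real.exp (Real.log l * ((m : ℝ) + k)) * Real.exp (-c * x ^ 2))) :=
        mul_le_mul_of_nonneg_left h1 (Real.exp_pos _).le
    _ = D * (Real.exp (-B * ((m : ℝ) + k)) * Real.exp (Real.log l * ((m : ℝ) + k))) *
        Real.exp (-c * x ^ 2) := by ring
    _ = D * Real.exp (-(B - Real.log l) * ((m : ℝ) + k)) * Real.exp (-c * x ^ 2) := by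
        rw [← Real.exp_add]
        congr 3
        ring
    _ ≤ _ := mul_le_mul_of_nonneg_right
        (mul_le_mul_of_nonneg_right (by linarith) (Real.exp_pos _).le) (Real.exp_pos _).le

theorem AdmissibleRate.exists_exp_mul_norm_overlap_le {B r β : ℝ} (hB : 0 < B)
    (h : AdmissibleRate B r β) :
    ∃ b ε C : ℝ, β < b ∧ 0 < b ∧ 0 < ε ∧ 0 < C ∧ ∀ (k m : ℕ) (u v x : ℝ), 0 ≤ x →
      u ^ 2 + v ^ 2 = 4 * x ^ 2 →
      Real.exp (-B * ((m : ℝ) + k) ^ (r / 2)) * ‖overlap k m u v‖ ≤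
        C * Real.exp (-ε * ((m : ℝ) + k) ^ (r / 2)) * Real.exp (-b * x ^ r) := by
  rcases h with ⟨hr, hr2, hβ⟩ | ⟨rfl, hβ⟩
  · exact exists_exp_mul_norm_overlap_le_of_lt_two hB hr hr2 hβ
  · simpa using exists_exp_mul_norm_overlap_le_of_eq_two hB hβ

/-! ### Similarities of the plane -/

/-- The similarity `z ↦ (a + ib) z` of the plane. -/
def planeSimilarity (a b : ℝ) (z : ℝ × ℝ) : ℝ × ℝ := (a * z.1 - b * z.2, b * z.1 + a * z.2)

theorem continuous_planeSimilarity (a b : ℝ) : Continuous (planeSimilarity a b) := by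
  unfold planeSimilarity
  fun_prop

theorem measurableEmbedding_planeSimilarity {a b : ℝ} (hab : a ^ 2 + b ^ 2 ≠ 0) :
    MeasurableEmbedding (planeSimilarity a b) := by
  refine (continuous_planeSimilarity a b).measurableEmbedding fun z w h => ?_
  simp only [planeSimilarity, Prod.mk.injEq] at h
  obtain ⟨h1, h2⟩ := h
  ext
  · apply mul_left_cancel₀ hab
    linear_combination a * h1 + b * h2
  · apply mul_left_cancel₀ hab
    linear_combination -b * h1 + a * h2

theorem map_planeSimilarity {a b : ℝ} (hab : a ^ 2 + b ^ 2 ≠ 0) :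
    Measure.map (planeSimilarity a b) volume =
      ENNReal.ofReal (a ^ 2 + b ^ 2)⁻¹ • (volume : Measure (ℝ × ℝ)) := by
  have h1 : planeSimilarity a b =
      Matrix.toLin (Module.Basis.finTwoProd ℝ) (Module.Basis.finTwoProd ℝ) !![a, -b; b, a] := by
    funext z
    rw [Matrix.toLin_finTwoProd_apply]
    simp [planeSimilarity, sub_eq_add_neg]
  have hdet : LinearMap.det (Matrix.toLin (Module.Basis.finTwoProd ℝ) (Module.Basis.finTwoProd ℝ)
      !![a, -b; b, a]) = a ^ 2 + b ^ 2 := by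
    rw [LinearMap.det_toLin, Matrix.det_fin_two_of]
    ring
  rw [h1, Measure.map_linearMap_addHaar_eq_smul_addHaar _ (by rwa [hdet]), hdet,
    abs_of_nonneg (by positivity)]

/-- Used for the rotations of the Radon transform, with factor one, and for `z ↦ 2iz` in Fourier
inversion, with factor `1/4`. -/
theorem integral_comp_planeSimilarity {E : Type*} [NormedAddCommGroup E] [NormedSpace ℝ E]
    {a b : ℝ} (hab : a ^ 2 + b ^ 2 ≠ 0) (f : ℝ × ℝ → E) :
    ∫ z, f (planeSimilarity a b z) = ((a ^ 2 + b ^ 2)⁻¹ : ℝ) • ∫ z, f z := by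
  rw [← (measurableEmbedding_planeSimilarity hab).integral_map, map_planeSimilarity hab,
    integral_smul_measure, ENNReal.toReal_ofReal (by positivity)]

theorem integrable_comp_planeSimilarity {E : Type*} [NormedAddCommGroup E] {a b : ℝ}
    (hab : a ^ 2 + b ^ 2 ≠ 0) {f : ℝ × ℝ → E} (hf : Integrable f) : Integrable fun z => f (planeSimilarity a b z) := by
  refine (measurableEmbedding_planeSimilarity hab).integrable_map_iff.1 ?_
  rw [map_planeSimilarity hab]
  exact hf.smul_measure ENNReal.ofReal_ne_top

/-! ### Integrable envelopes -/

theorem norm_le_sqrt_sq_add_sq (z : ℝ × ℝ) : ‖z‖ ≤ Real.sqrt (z.1 ^ 2 + z.2 ^ 2) := by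
  rw [Prod.norm_def]
  refine max_le ?_ ?_
  · rw [Real.norm_eq_abs]
    exact Real.abs_le_sqrt (by nlinarith [sq_nonneg z.2])
  · rw [Real.norm_eq_abs]
    exact Real.abs_le_sqrt (by nlinarith [sq_nonneg z.1])

theorem continuous_exp_neg_mul_sqrt_rpow (b : ℝ) {r : ℝ} (hr : 0 < r) :
    Continuous fun z : ℝ × ℝ => Real.exp (-b * Real.sqrt (z.1 ^ 2 + z.2 ^ 2) ^ r) := by
  have : Continuous fun z : ℝ × ℝ => Real.sqrt (z.1 ^ 2 + z.2 ^ 2) ^ r :=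
    Continuous.rpow_const (by fun_prop) fun _ => Or.inr hr.le
  fun_prop

theorem integrable_exp_neg_mul_sqrt_rpow {b r : ℝ} (hb : 0 < b) (hr : 0 < r) :
    Integrable fun z : ℝ × ℝ => Real.exp (-b * Real.sqrt (z.1 ^ 2 + z.2 ^ 2) ^ r) := by
  obtain ⟨C, hC, h⟩ := exists_exp_neg_mul_rpow_le hb hr
  have h1 : Integrable fun z : ℝ × ℝ => C * (1 + ‖z‖) ^ (-4 : ℝ) :=
    (integrable_one_add_norm (by simp; norm_num)).const_mul C
  refine h1.mono' (continuous_exp_neg_mul_sqrt_rpow b hr).aestronglyMeasurable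
    (Eventually.of_forall fun z => ?_)
  rw [Real.norm_eq_abs, Real.abs_exp]
  refine (h _ (Real.sqrt_nonneg _)).trans (mul_le_mul_of_nonneg_left ?_ hC.le)
  exact Real.rpow_le_rpow_of_nonpos (by positivity)
    (by linarith [norm_le_sqrt_sq_add_sq z]) (by norm_num)

theorem exp_neg_mul_half_rpow (b : ℝ) {x r : ℝ} (hx : 0 ≤ x) :
    Real.exp (-b * (x / 2) ^ r) = Real.exp (-(b / 2 ^ r) * x ^ r) := by
  rw [Real.div_rpow hx (by norm_num)]
  congr 1
  ring

/-! ### The Fourier transform of the matrix elements -/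

theorem continuous_overlap_comp (k m : ℕ) {X : Type*} [TopologicalSpace X] {f g : X → ℝ}
    (hf : Continuous f) (hg : Continuous g) : Continuous fun x => overlap k m (f x) (g x) := by
  have h := continuous_overlap k m
  generalize overlap k m = o at *
  exact h.comp (hf.prodMk hg)

theorem exists_norm_overlap_le_gaussian (k m : ℕ) :
    ∃ D : ℝ, 0 ≤ D ∧ ∀ u v : ℝ, ‖overlap k m u v‖ ≤ D * Real.exp (-(1 / 8) * (u ^ 2 + v ^ 2)) := by
  -- Any fixed `c` in `(0, 1)` would do, since only integrability for each pair is wanted; `c = 1/2`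
  -- gives `l = √3`.
  have hl : (1 - (1 / 2 : ℝ)) * Real.sqrt 3 ^ 2 = 1 + 1 / 2 := by
    rw [Real.sq_sqrt (by norm_num)]; norm_num
  refine ⟨hermiteMoment (1 / 2) 0 0 * Real.sqrt 3 ^ (k + m),
    mul_nonneg (hermiteMoment_zero_zero_nonneg _) (by positivity), fun u v => ?_⟩
  have h2 := norm_overlap_le (c := 1 / 2) (by norm_num) (by norm_num) (by positivity) hl k m u v
  rw [← mul_assoc, show -(1 / 2 : ℝ) * (u ^ 2 + v ^ 2) / 4 = -(1 / 8) * (u ^ 2 + v ^ 2) by ring]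
    at h2
  exact h2

theorem integrable_overlap (k m : ℕ) : Integrable fun w : ℝ × ℝ => overlap k m w.1 w.2 := by
  obtain ⟨D, hD, h⟩ := exists_norm_overlap_le_gaussian k m
  have h1 := (integrable_exp_neg_mul_sqrt_rpow (b := 1 / 8) (r := 2) (by norm_num)
    (by norm_num)).const_mul D
  refine h1.mono' (continuous_overlap k m).aestronglyMeasurable
    (Eventually.of_forall fun w => (h w.1 w.2).trans (le_of_eq ?_))
  rw [Real.rpow_two, Real.sq_sqrt (by positivity)]

theorem integrable_overlap_left (k m : ℕ) (v : ℝ) : Integrable fun u : ℝ => overlap k m u v := by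
  obtain ⟨D, hD, h⟩ := exists_norm_overlap_le_gaussian k m
  have h1 := (integrable_exp_neg_mul_sq (b := 1 / 8) (by norm_num)).const_mul D
  have hc : Continuous fun u : ℝ => overlap k m u v :=
    continuous_overlap_comp k m continuous_id continuous_const
  refine h1.mono' hc.aestronglyMeasurable (Eventually.of_forall fun u => (h u v).trans ?_)
  refine mul_le_mul_of_nonneg_left (Real.exp_le_exp.2 ?_) hD
  linarith [sq_nonneg v]

/-- The shift by `v/2` absorbs the phase `e^{iuv/2}`; in the variable `u` the overlap becomes a
plain Fourier transform. -/
theorem overlap_eq_integral_symm (k m : ℕ) (u v : ℝ) :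
    overlap k m u v = ∫ y : ℝ, Complex.exp (-Complex.I * u * y) *
      ((hermiteFun k (y + v / 2) * hermiteFun m (y - v / 2) : ℝ) : ℂ) := by
  rw [overlap, ← integral_add_right_eq_self _ (v / 2)]
  refine integral_congr_ae (Eventually.of_forall fun y => ?_)
  simp only [weylHermite, weylFun]
  rw [show y + v / 2 - v = y - v / 2 by ring]
  push_cast
  rw [show -Complex.I * (u : ℂ) * (y + v / 2) + Complex.I * u * v / 2 = -Complex.I * u * y by ring]
  ring

theorem integrable_hermiteFun_mul_shift (k m : ℕ) (v : ℝ) :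
    Integrable fun y : ℝ =>
      ((hermiteFun k (y + v / 2) * hermiteFun m (y - v / 2) : ℝ) : ℂ) := by
  have h := (integrable_hermiteFun_mul_weylHermite k m 0 v).comp_add_right (v / 2)
  refine h.congr (Eventually.of_forall fun y => ?_)
  simp only [weylHermite, weylFun]
  rw [show y + v / 2 - v = y - v / 2 by ring]
  simp

/-- One-dimensional Fourier inversion of `overlap_eq_integral_symm`; the Gaussian decay of the
overlap makes the transform integrable. -/
theorem integral_exp_mul_overlap_left (k m : ℕ) (q v : ℝ) :
    ∫ u : ℝ, Complex.exp (Complex.I * u * q) * overlap k m u v =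
      2 * Real.pi * ((hermiteFun k (q + v / 2) * hermiteFun m (q - v / 2) : ℝ) : ℂ) := by
  set F : ℝ → ℂ := fun y => ((hermiteFun k (y + v / 2) * hermiteFun m (y - v / 2) : ℝ) : ℂ)
    with hF
  have hFc : Continuous F := by
    have h1 := continuous_hermiteFun k
    have h2 := continuous_hermiteFun m
    fun_prop
  have hπ : (2 * Real.pi) ≠ 0 := by have := Real.pi_pos; positivity
  have h1 : FourierTransform.fourier F = fun ξ => overlap k m (2 * Real.pi * ξ) v := by
    funext ξ
    rw [Real.fourier_real_eq_integral_exp_smul, overlap_eq_integral_symm]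
    refine integral_congr_ae (Eventually.of_forall fun y => ?_)
    simp only [smul_eq_mul, hF]
    congr 2
    push_cast
    ring
  have h2 : Integrable (FourierTransform.fourier F) := by
    rw [h1]
    exact (integrable_overlap_left k m v).comp_mul_left' hπ
  have h3 := congrFun
    (hFc.fourierInv_fourier_eq (integrable_hermiteFun_mul_shift k m v) h2) q
  rw [h1, Real.fourierInv_eq'] at h3
  have h4 := Measure.integral_comp_mul_left
    (fun u : ℝ => Complex.exp (Complex.I * u * q) * overlap k m u v) (2 * Real.pi)
  have h5 : ∫ ξ : ℝ, Complex.exp (Complex.I * ((2 * Real.pi * ξ : ℝ) : ℂ) * q) *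
      overlap k m (2 * Real.pi * ξ) v = F q := by
    rw [← h3]
    refine integral_congr_ae (Eventually.of_forall fun ξ => ?_)
    simp only [smul_eq_mul, RCLike.inner_apply, conj_trivial]
    congr 2
    push_cast
    ring
  rw [h4, abs_of_pos (by positivity), Complex.real_smul] at h5
  have hπ' : ((2 * Real.pi : ℝ) : ℂ) ≠ 0 := by exact_mod_cast hπ
  change _ = 2 * Real.pi * F q
  rw [← h5, ← mul_assoc, show (2 * (Real.pi : ℂ)) = ((2 * Real.pi : ℝ) : ℂ) by push_cast; ring,
    Complex.ofReal_inv, mul_inv_cancel₀ hπ', one_mul]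

theorem norm_exp_I_mul_add (w z : ℝ × ℝ) :
    ‖Complex.exp (Complex.I * (w.1 * z.1 + w.2 * z.2))‖ = 1 := by
  rw [show Complex.I * ((w.1 : ℂ) * z.1 + w.2 * z.2) =
    ((w.1 * z.1 + w.2 * z.2 : ℝ) : ℂ) * Complex.I by push_cast; ring, Complex.norm_exp_ofReal_mul_I]

theorem integrable_exp_I_mul {g : ℝ × ℝ → ℂ} (hg : Integrable g) (z : ℝ × ℝ) :
    Integrable fun w : ℝ × ℝ => Complex.exp (Complex.I * (w.1 * z.1 + w.2 * z.2)) * g w := by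
  refine hg.bdd_mul (c := 1) (by fun_prop) (Eventually.of_forall fun w => ?_)
  rw [norm_exp_I_mul_add]

/-- The symplectic Fourier transform of a matrix element is a reflected and rescaled copy of it. -/
theorem integral_exp_mul_overlap (k m : ℕ) (z : ℝ × ℝ) :
    ∫ w : ℝ × ℝ, Complex.exp (Complex.I * (w.1 * z.1 + w.2 * z.2)) * overlap k m w.1 w.2 =
      4 * Real.pi * (-1) ^ m * overlap k m (-2 * z.2) (2 * z.1) := by
  have hI := integrable_exp_I_mul (integrable_overlap k m) z
  rw [Measure.volume_eq_prod, integral_prod_symm _ (by rwa [Measure.volume_eq_prod] at hI)]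
  have h1 : ∀ v : ℝ, ∫ u : ℝ, Complex.exp (Complex.I * ((u : ℂ) * z.1 + v * z.2)) *
      overlap k m u v = 2 * Real.pi * (Complex.exp (Complex.I * v * z.2) *
        ((hermiteFun k (z.1 + v / 2) * hermiteFun m (z.1 - v / 2) : ℝ) : ℂ)) := by
    intro v
    rw [mul_left_comm, ← integral_exp_mul_overlap_left, ← integral_const_mul]
    refine integral_congr_ae (Eventually.of_forall fun u => ?_)
    simp only
    rw [← mul_assoc, ← Complex.exp_add]
    congr 2
    ring
  simp only [h1]
  rw [integral_const_mul]
  set G : ℝ → ℂ := fun v => Complex.exp (Complex.I * v * z.2) *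
        ((hermiteFun k (z.1 + v / 2) * hermiteFun m (z.1 - v / 2) : ℝ) : ℂ) with hG
  have h2 := Measure.integral_comp_mul_left G 2
  have h3 := integral_sub_right_eq_self (fun x : ℝ => G (2 * x)) (μ := volume) z.1
  -- Under `v = 2(x - z₁)` the second factor is `h_m` at `-(x - 2z₁)`. Parity gives the sign, and
  -- the rest is the integrand of an overlap at `(-2z₂, 2z₁)`.
  have h4 : ∀ x : ℝ, G (2 * (x - z.1)) =
      (-1) ^ m * ((hermiteFun k x : ℂ) * weylHermite (-2 * z.2) (2 * z.1) m x) := by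
    intro x
    simp only [hG, weylHermite, weylFun]
    rw [show z.1 + 2 * (x - z.1) / 2 = x by ring,
      show z.1 - 2 * (x - z.1) / 2 = -(x - 2 * z.1) by ring, hermiteFun_neg]
    have : Complex.I * ((2 * (x - z.1) : ℝ) : ℂ) * z.2 = -Complex.I * ((-2 * z.2 : ℝ) : ℂ) * x +
      Complex.I * ((-2 * z.2 : ℝ) : ℂ) * ((2 * z.1 : ℝ) : ℂ) / 2 := by push_cast; ring
    rw [this]
    push_cast
    ring
  simp only [h4] at h3
  rw [integral_const_mul] at h3
  rw [← h3] at h2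
  rw [overlap]
  have h5 : ∫ v, G v = 2 * ((-1) ^ m *
      ∫ x : ℝ, (hermiteFun k x : ℂ) * weylHermite (-2 * z.2) (2 * z.1) m x) := by
    rw [h2, Complex.real_smul]
    rw [abs_of_pos (by norm_num)]
    push_cast
    ring
  rw [h5]
  ring

/-- The adjoint of a Weyl operator is the one with opposite parameters. -/
theorem conj_overlap (k m : ℕ) (u v : ℝ) :
    starRingEnd ℂ (overlap k m u v) = overlap m k (-u) (-v) := by
  rw [overlap, ← integral_conj, ← integral_add_right_eq_self _ v, overlap]
  refine integral_congr_ae (Eventually.of_forall fun x => ?_)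
  simp only [weylHermite, weylFun, map_mul, Complex.conj_ofReal, ← Complex.exp_conj, map_add,
    map_neg, map_div₀, Complex.conj_I, map_ofNat]
  rw [add_sub_cancel_right, sub_neg_eq_add]
  have : - -Complex.I * (u : ℂ) * ((x + v : ℝ) : ℂ) + -Complex.I * u * v / 2 =
    -Complex.I * ((-u : ℝ) : ℂ) * x + Complex.I * ((-u : ℝ) : ℂ) * ((-v : ℝ) : ℂ) / 2 := by
    push_cast; ring
  rw [this]
  ring

/-! ### States with rapidly decaying density matrix -/

/-- The terms of the Fock expansion of `ρ` are dominated by a summable sequence times a stretched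
exponential in the phase-space variable. -/
structure FockDecay (ρ : QuantumState) (b r : ℝ) (a : ℕ × ℕ → ℝ) : Prop where
  rate_pos : 0 < b
  exponent_pos : 0 < r
  summable : Summable a
  summable_entry : Summable fun p : ℕ × ℕ => ‖ρ.entry p.1 p.2‖
  bound : ∀ (p : ℕ × ℕ) (u v x : ℝ), 0 ≤ x → u ^ 2 + v ^ 2 = 4 * x ^ 2 →
    ‖ρ.entry p.1 p.2 * overlap p.2 p.1 u v‖ ≤ a p * Real.exp (-b * x ^ r)

/-- The rate `b` and the sequence `a` are chosen before `ρ`; this makes the constants uniform over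
the class. -/
theorem AdmissibleRate.exists_fockDecay {B r β : ℝ} (hB : 0 < B) (h : AdmissibleRate B r β) :
    ∃ (b : ℝ) (a : ℕ × ℕ → ℝ), β < b ∧ 0 < b ∧ ∀ ρ ∈ stateClass B r, FockDecay ρ b r a := by
  obtain ⟨b, ε, C, hβ, hb, hε, hC, H⟩ := h.exists_exp_mul_norm_overlap_le hB
  have hr2 : 0 < r / 2 := by linarith [h.pos]
  refine ⟨b, fun p => C * Real.exp (-ε * ((p.1 : ℝ) + p.2) ^ (r / 2)), hβ, hb, fun ρ hρ => ?_⟩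
  refine ⟨hb, h.pos, (summable_exp_neg_mul_rpow hε hr2).mul_left C,
    Summable.of_nonneg_of_le (fun _ => norm_nonneg _) (fun p => hρ p.1 p.2)
      (summable_exp_neg_mul_rpow hB hr2), fun p u v x hx hxuv => ?_⟩
  rw [norm_mul]
  exact (mul_le_mul_of_nonneg_right (hρ p.1 p.2) (norm_nonneg _)).trans
    (H p.2 p.1 u v x hx hxuv)

namespace FockDecay

variable {ρ : QuantumState} {b r : ℝ} {a : ℕ × ℕ → ℝ}

theorem nonneg (h : FockDecay ρ b r a) (p : ℕ × ℕ) : 0 ≤ a p := by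
  have h1 := (norm_nonneg _).trans (h.bound p 0 0 0 le_rfl (by simp))
  rwa [Real.zero_rpow h.exponent_pos.ne', mul_zero, Real.exp_zero, mul_one] at h1

/-- In frequency variables `x` is half the Euclidean norm of `w`. The resulting `2^r` is the source
of `2^(1-r)` in the bias. -/
theorem norm_le_half (h : FockDecay ρ b r a) (p : ℕ × ℕ) (w : ℝ × ℝ) :
    ‖ρ.entry p.1 p.2 * overlap p.2 p.1 w.1 w.2‖ ≤
      a p * Real.exp (-(b / 2 ^ r) * Real.sqrt (w.1 ^ 2 + w.2 ^ 2) ^ r) := by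
  have h1 := h.bound p w.1 w.2 (Real.sqrt (w.1 ^ 2 + w.2 ^ 2) / 2) (by positivity) (by
    rw [div_pow, Real.sq_sqrt (by positivity)]; ring)
  rwa [exp_neg_mul_half_rpow b (Real.sqrt_nonneg _)] at h1

theorem norm_le_coeff (h : FockDecay ρ b r a) (p : ℕ × ℕ) (u v : ℝ) :
    ‖ρ.entry p.1 p.2 * overlap p.2 p.1 u v‖ ≤ a p := by
  refine (h.norm_le_half p (u, v)).trans (mul_le_of_le_one_right (h.nonneg p) ?_)
  rw [Real.exp_le_one_iff]
  have h1 : 0 ≤ b / 2 ^ r * Real.sqrt (u ^ 2 + v ^ 2) ^ r := by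
    have := h.rate_pos
    positivity
  linarith

theorem rate_half_pos (h : FockDecay ρ b r a) : 0 < b / 2 ^ r := by
  have := h.rate_pos
  positivity

theorem wignerFourier_eq (h : FockDecay ρ b r a) (u v : ℝ) :
    wignerFourier ρ u v = ∑' p : ℕ × ℕ, ρ.entry p.1 p.2 * overlap p.2 p.1 u v :=
  wignerFourier_eq_tsum ρ h.summable_entry u v

theorem norm_wignerFourier_le (h : FockDecay ρ b r a) (w : ℝ × ℝ) :
    ‖wignerFourier ρ w.1 w.2‖ ≤
      (∑' p, a p) * Real.exp (-(b / 2 ^ r) * Real.sqrt (w.1 ^ 2 + w.2 ^ 2) ^ r) := by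
  rw [h.wignerFourier_eq, ← tsum_mul_right]
  exact tsum_of_norm_bounded (h.summable.mul_right _).hasSum (fun p => h.norm_le_half p w)

theorem continuous_wignerFourier (h : FockDecay ρ b r a) :
    Continuous fun w : ℝ × ℝ => wignerFourier ρ w.1 w.2 := by
  simp only [h.wignerFourier_eq]
  exact continuous_tsum (fun p => (continuous_overlap p.2 p.1).const_mul _) h.summable
    (fun p w => h.norm_le_coeff p w.1 w.2)

theorem integrable_wignerFourier (h : FockDecay ρ b r a) :
    Integrable fun w : ℝ × ℝ => wignerFourier ρ w.1 w.2 :=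
  ((integrable_exp_neg_mul_sqrt_rpow h.rate_half_pos h.exponent_pos).const_mul
    (∑' p, a p)).mono' h.continuous_wignerFourier.aestronglyMeasurable
    (Eventually.of_forall h.norm_wignerFourier_le)

theorem conj_wignerFourier (h : FockDecay ρ b r a) (u v : ℝ) :
    starRingEnd ℂ (wignerFourier ρ u v) = wignerFourier ρ (-u) (-v) := by
  rw [h.wignerFourier_eq, h.wignerFourier_eq, Complex.conj_tsum,
    ← (Equiv.prodComm ℕ ℕ).tsum_eq]
  refine tsum_congr fun p => ?_
  simp [map_mul, ρ.conj_entry, conj_overlap]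

/-- Termwise Fourier transformation of a series of matrix elements. -/
theorem integral_exp_mul_tsum (h : FockDecay ρ b r a) {σ : ℕ × ℕ → ℂ} (hσ : ∀ p, ‖σ p‖ = 1)
    (z : ℝ × ℝ) :
    ∫ w : ℝ × ℝ, Complex.exp (Complex.I * (w.1 * z.1 + w.2 * z.2)) *
        ∑' p : ℕ × ℕ, σ p * (ρ.entry p.1 p.2 * overlap p.2 p.1 w.1 w.2) =
      4 * Real.pi * ∑' p : ℕ × ℕ,
        (-1) ^ p.1 * (σ p * (ρ.entry p.1 p.2 * overlap p.2 p.1 (-2 * z.2) (2 * z.1))) := by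
  -- The unimodular `σ` covers two uses: `σ = 1` for the Wigner function, the parity sign for the
  -- inverse transform.
  set T : ℕ × ℕ → ℝ × ℝ → ℂ := fun p w =>
    Complex.exp (Complex.I * (w.1 * z.1 + w.2 * z.2)) *
      (σ p * (ρ.entry p.1 p.2 * overlap p.2 p.1 w.1 w.2)) with hT
  have hTi : ∀ p, Integrable (T p) := fun p =>
    integrable_exp_I_mul (((integrable_overlap p.2 p.1).const_mul (ρ.entry p.1 p.2)).const_mul
      (σ p)) z
  have hE := integrable_exp_neg_mul_sqrt_rpow h.rate_half_pos h.exponent_pos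
  have hTs : Summable fun p => ∫ w, ‖T p w‖ := by
    refine Summable.of_nonneg_of_le (fun p => integral_nonneg fun w => norm_nonneg _)
      (fun p => ?_) (h.summable.mul_right
        (∫ w : ℝ × ℝ, Real.exp (-(b / 2 ^ r) * Real.sqrt (w.1 ^ 2 + w.2 ^ 2) ^ r)))
    rw [← integral_const_mul]
    refine integral_mono (hTi p).norm (hE.const_mul _) fun w => ?_
    simp only [hT]
    rw [norm_mul, norm_exp_I_mul_add, one_mul, norm_mul, hσ, one_mul]
    exact h.norm_le_half p w
  have h1 := integral_tsum_of_summable_integral_norm hTi hTs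
  have h2 : ∀ w : ℝ × ℝ, ∑' p, T p w =
      Complex.exp (Complex.I * (w.1 * z.1 + w.2 * z.2)) *
        ∑' p : ℕ × ℕ, σ p * (ρ.entry p.1 p.2 * overlap p.2 p.1 w.1 w.2) := by
    intro w
    rw [← tsum_mul_left]
  simp only [h2] at h1
  rw [← h1, ← tsum_mul_left]
  refine tsum_congr fun p => ?_
  have h3 : ∀ w, T p w = σ p * ρ.entry p.1 p.2 *
      (Complex.exp (Complex.I * (w.1 * z.1 + w.2 * z.2)) * overlap p.2 p.1 w.1 w.2) := by
    intro w
    simp only [hT]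
    ring
  simp only [h3]
  rw [integral_const_mul, integral_exp_mul_overlap]
  ring

/-- Taking the real part loses nothing: the reflection `w ↦ -w` exchanges the integrand with its
conjugate. -/
theorem wigner_eq_integral (h : FockDecay ρ b r a) (z : ℝ × ℝ) :
    (wigner ρ z : ℂ) = 1 / (2 * (Real.pi : ℂ)) ^ 2 * ∫ w : ℝ × ℝ,
      Complex.exp (Complex.I * (w.1 * z.1 + w.2 * z.2)) * wignerFourier ρ w.1 w.2 := by
  rw [wigner, eq_comm]
  refine Complex.conj_eq_iff_re.1 ?_ |>.symm
  rw [show 1 / (2 * (Real.pi : ℂ)) ^ 2 = ((1 / (2 * Real.pi) ^ 2 : ℝ) : ℂ) by push_cast; rfl,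
    map_mul, ← integral_conj, Complex.conj_ofReal]
  have h1 := integral_neg_eq_self (fun w : ℝ × ℝ =>
    Complex.exp (Complex.I * (w.1 * z.1 + w.2 * z.2)) * wignerFourier ρ w.1 w.2) volume
  rw [← h1]
  congr 1
  refine integral_congr_ae (Eventually.of_forall fun w => ?_)
  simp only [map_mul, h.conj_wignerFourier, ← Complex.exp_conj, map_add, Complex.conj_ofReal,
    Complex.conj_I, Prod.fst_neg, Prod.snd_neg]
  congr 2
  push_cast
  ring

theorem wigner_eq_tsum (h : FockDecay ρ b r a) (z : ℝ × ℝ) :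
    (wigner ρ z : ℂ) = (Real.pi : ℂ)⁻¹ * ∑' p : ℕ × ℕ,
        (-1) ^ p.1 * (ρ.entry p.1 p.2 * overlap p.2 p.1 (-2 * z.2) (2 * z.1)) := by
  have h1 := h.integral_exp_mul_tsum (σ := fun _ => 1) (fun _ => norm_one) z
  simp only [one_mul] at h1
  simp only [← h.wignerFourier_eq] at h1
  rw [h.wigner_eq_integral, h1]
  have : (Real.pi : ℂ) ≠ 0 := by exact_mod_cast Real.pi_ne_zero
  field_simp
  ring

theorem norm_sign_mul (p : ℕ × ℕ) (c : ℂ) : ‖(-1) ^ p.1 * c‖ = ‖c‖ := by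
  rw [norm_mul, norm_pow, norm_neg, norm_one, one_pow, one_mul]

/-- The argument `(-2z₂, 2z₁)` has squared Euclidean norm four times that of `z`, so the full rate
`b` survives. -/
theorem abs_wigner_le (h : FockDecay ρ b r a) (z : ℝ × ℝ) :
    |wigner ρ z| ≤ (∑' p, a p) * Real.exp (-b * Real.sqrt (z.1 ^ 2 + z.2 ^ 2) ^ r) := by
  have h0 : |wigner ρ z| = ‖(wigner ρ z : ℂ)‖ := by rw [Complex.norm_real, Real.norm_eq_abs]
  rw [h0, h.wigner_eq_tsum, norm_mul, norm_inv, Complex.norm_real, Real.norm_eq_abs,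
    abs_of_pos Real.pi_pos]
  have h1 : ‖∑' p : ℕ × ℕ,
        (-1) ^ p.1 * (ρ.entry p.1 p.2 * overlap p.2 p.1 (-2 * z.2) (2 * z.1))‖ ≤
      (∑' p, a p) * Real.exp (-b * Real.sqrt (z.1 ^ 2 + z.2 ^ 2) ^ r) := by
    rw [← tsum_mul_right]
    refine tsum_of_norm_bounded (h.summable.mul_right _).hasSum fun p => ?_
    rw [norm_sign_mul]
    refine h.bound p _ _ _ (Real.sqrt_nonneg _) ?_
    rw [Real.sq_sqrt (by positivity)]
    ring
  refine le_trans (mul_le_of_le_one_left (norm_nonneg _) ?_) h1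
  exact inv_le_one_of_one_le₀ (by linarith [Real.pi_gt_three])

theorem continuous_wigner (h : FockDecay ρ b r a) : Continuous (wigner ρ) := by
  have h1 : Continuous fun z : ℝ × ℝ => ∑' p : ℕ × ℕ,
        (-1) ^ p.1 * (ρ.entry p.1 p.2 * overlap p.2 p.1 (-2 * z.2) (2 * z.1)) := by
    refine continuous_tsum (fun p => ?_) h.summable (fun p z => ?_)
    · have h2 : Continuous fun z : ℝ × ℝ => overlap p.2 p.1 (-2 * z.2) (2 * z.1) :=
        continuous_overlap_comp p.2 p.1 (by fun_prop) (by fun_prop)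
      exact (h2.const_mul _).const_mul _
    · rw [norm_sign_mul]
      exact h.norm_le_coeff p _ _
  have h2 : wigner ρ = fun z => ((Real.pi : ℂ)⁻¹ * ∑' p : ℕ × ℕ,
        (-1) ^ p.1 * (ρ.entry p.1 p.2 * overlap p.2 p.1 (-2 * z.2) (2 * z.1))).re := by
    funext z
    rw [← h.wigner_eq_tsum, Complex.ofReal_re]
  rw [h2]
  exact Complex.continuous_re.comp (h1.const_mul _)

theorem integrable_wigner (h : FockDecay ρ b r a) : Integrable (wigner ρ) :=
  ((integrable_exp_neg_mul_sqrt_rpow h.rate_pos h.exponent_pos).const_mul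
    (∑' p, a p)).mono' h.continuous_wigner.aestronglyMeasurable
    (Eventually.of_forall h.abs_wigner_le)

/-- Fourier inversion on phase space. -/
theorem integral_exp_mul_wigner (h : FockDecay ρ b r a) (u v : ℝ) :
    ∫ z : ℝ × ℝ, Complex.exp (-Complex.I * (u * z.1 + v * z.2)) * wigner ρ z =
      wignerFourier ρ u v := by
  set f : ℝ × ℝ → ℂ := fun w => ∑' p : ℕ × ℕ,
    (-1) ^ p.1 * (ρ.entry p.1 p.2 * overlap p.2 p.1 w.1 w.2) with hf
  -- Chosen so that `(-2y₂, 2y₁) = (u, v)`: applying the termwise identity a second time returns to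
  -- `(u, v)`, and the two parity signs cancel.
  set y : ℝ × ℝ := (v / 2, -u / 2) with hy
  set g : ℝ × ℝ → ℂ := fun w => (Real.pi : ℂ)⁻¹ *
    (Complex.exp (Complex.I * (w.1 * y.1 + w.2 * y.2)) * f w) with hg
  have h02 : (0 : ℝ) ^ 2 + 2 ^ 2 ≠ 0 := by norm_num
  have h1 := integral_comp_planeSimilarity h02 g
  have h2 : ∀ z : ℝ × ℝ, g (planeSimilarity 0 2 z) =
      Complex.exp (-Complex.I * (u * z.1 + v * z.2)) * wigner ρ z := by
    intro z
    have hsim : planeSimilarity 0 2 z = (-2 * z.2, 2 * z.1) := by simp [planeSimilarity]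
    rw [hsim, h.wigner_eq_tsum]
    simp only [hg, hf, hy]
    have : Complex.I * (((-2 * z.2 : ℝ) : ℂ) * ((v / 2 : ℝ) : ℂ) +
          ((2 * z.1 : ℝ) : ℂ) * ((-u / 2 : ℝ) : ℂ)) = -Complex.I * ((u : ℂ) * z.1 + v * z.2) := by
      push_cast; ring
    rw [this]
    ring
  simp only [h2] at h1
  have h3 := h.integral_exp_mul_tsum (σ := fun p => (-1) ^ p.1) (fun p => by simp) y
  have h4 : ∀ p : ℕ × ℕ, (-1 : ℂ) ^ p.1 *
      ((-1) ^ p.1 * (ρ.entry p.1 p.2 * overlap p.2 p.1 (-2 * y.2) (2 * y.1))) =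
      ρ.entry p.1 p.2 * overlap p.2 p.1 u v := by
    intro p
    rw [← mul_assoc, ← mul_pow, neg_one_mul, neg_neg, one_pow, one_mul, hy]
    congr 2 <;> ring
  simp only [h4] at h3
  rw [← h.wignerFourier_eq] at h3
  have hπ : (Real.pi : ℂ) ≠ 0 := by exact_mod_cast Real.pi_ne_zero
  rw [h1, hg, integral_const_mul, h3, Complex.real_smul]
  push_cast
  field_simp
  norm_num

end FockDecay

/-! ### A Plancherel inequality on discs -/

theorem integrable_gaussian_plane {ε : ℝ} (hε : 0 < ε) :
    Integrable fun z : ℝ × ℝ => Real.exp (-ε * z.1 ^ 2) * Real.exp (-ε * z.2 ^ 2) :=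
  (integrable_exp_neg_mul_sq hε).mul_prod (integrable_exp_neg_mul_sq hε)

theorem integral_gaussian_plane {ε : ℝ} (hε : 0 < ε) :
    ∫ z : ℝ × ℝ, Real.exp (-ε * z.1 ^ 2) * Real.exp (-ε * z.2 ^ 2) = Real.pi / ε := by
  rw [Measure.volume_eq_prod, integral_prod_mul (fun x : ℝ => Real.exp (-ε * x ^ 2))
    (fun x : ℝ => Real.exp (-ε * x ^ 2)), integral_gaussian, Real.mul_self_sqrt]
  have := Real.pi_pos
  positivity

theorem norm_integral_exp_mul_gaussian {ε : ℝ} (hε : 0 < ε) (t : ℝ) :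
    ‖∫ x : ℝ, Complex.exp (Complex.I * t * x) * Complex.exp (-(ε : ℂ) * x ^ 2)‖ =
      Real.sqrt (Real.pi / ε) * Real.exp (-(1 / (4 * ε)) * t ^ 2) := by
  rw [fourierIntegral_gaussian (by simpa using hε), norm_mul]
  congr 1
  · rw [← Complex.ofReal_div, show (1 / 2 : ℂ) = ((1 / 2 : ℝ) : ℂ) by push_cast; rfl,
      ← Complex.ofReal_cpow (by have := Real.pi_pos; positivity), Complex.norm_real,
      ← Real.sqrt_eq_rpow, Real.norm_eq_abs, abs_of_nonneg (Real.sqrt_nonneg _)]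
  · rw [show -(t : ℂ) ^ 2 / (4 * ε) = ((-(1 / (4 * ε)) * t ^ 2 : ℝ) : ℂ) by push_cast; ring,
      ← Complex.ofReal_exp, Complex.norm_real, Real.norm_eq_abs, Real.abs_exp]

theorem norm_integral_exp_mul_gaussian_plane {ε : ℝ} (hε : 0 < ε) (w : ℝ × ℝ) :
    ‖∫ z : ℝ × ℝ, Complex.exp (Complex.I * (w.1 * z.1 + w.2 * z.2)) *
      ((Real.exp (-ε * z.1 ^ 2) * Real.exp (-ε * z.2 ^ 2) : ℝ) : ℂ)‖ =
      Real.pi / ε * (Real.exp (-(1 / (4 * ε)) * w.1 ^ 2) * Real.exp (-(1 / (4 * ε)) * w.2 ^ 2)) := by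
  have h1 : ∀ z : ℝ × ℝ, Complex.exp (Complex.I * (w.1 * z.1 + w.2 * z.2)) *
      ((Real.exp (-ε * z.1 ^ 2) * Real.exp (-ε * z.2 ^ 2) : ℝ) : ℂ) =
      (Complex.exp (Complex.I * w.1 * z.1) * Complex.exp (-(ε : ℂ) * z.1 ^ 2)) *
      (Complex.exp (Complex.I * w.2 * z.2) * Complex.exp (-(ε : ℂ) * z.2 ^ 2)) := by
    intro z
    push_cast
    rw [show Complex.I * ((w.1 : ℂ) * z.1 + w.2 * z.2) =
      Complex.I * w.1 * z.1 + Complex.I * w.2 * z.2 by ring, Complex.exp_add]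
    ring
  simp only [h1]
  rw [Measure.volume_eq_prod, integral_prod_mul
    (fun x : ℝ => Complex.exp (Complex.I * w.1 * x) * Complex.exp (-(ε : ℂ) * x ^ 2))
    (fun x : ℝ => Complex.exp (Complex.I * w.2 * x) * Complex.exp (-(ε : ℂ) * x ^ 2)), norm_mul,
    norm_integral_exp_mul_gaussian hε, norm_integral_exp_mul_gaussian hε]
  have : Real.sqrt (Real.pi / ε) * Real.sqrt (Real.pi / ε) = Real.pi / ε :=
    Real.mul_self_sqrt (by have := Real.pi_pos; positivity)
  linear_combination (Real.exp (-(1 / (4 * ε)) * w.1 ^ 2) *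
    Real.exp (-(1 / (4 * ε)) * w.2 ^ 2)) * this

/-- The Fourier integral `∫ e^{i w·z} g(w) dw` on the plane. -/
noncomputable def planeFourier (g : ℝ × ℝ → ℂ) (z : ℝ × ℝ) : ℂ :=
  ∫ w : ℝ × ℝ, Complex.exp (Complex.I * (w.1 * z.1 + w.2 * z.2)) * g w

theorem integrable_gaussian_mul_fourier_kernel {g : ℝ × ℝ → ℂ} (hg : Integrable g) {ε : ℝ}
    (hε : 0 < ε) :
    Integrable fun q : (ℝ × ℝ) × ((ℝ × ℝ) × (ℝ × ℝ)) =>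
      Complex.exp (Complex.I * ((q.2.1.1 - q.2.2.1) * q.1.1 + (q.2.1.2 - q.2.2.2) * q.1.2)) *
      (((Real.exp (-ε * q.1.1 ^ 2) * Real.exp (-ε * q.1.2 ^ 2) : ℝ) : ℂ) *
        (g q.2.1 * starRingEnd ℂ (g q.2.2))) := by
  have hg' : Integrable fun w => starRingEnd ℂ (g w) :=
    (Complex.conjCLE : ℂ →L[ℝ] ℂ).integrable_comp hg
  have h1 : Integrable fun q : (ℝ × ℝ) × ((ℝ × ℝ) × (ℝ × ℝ)) =>
      (((Real.exp (-ε * q.1.1 ^ 2) * Real.exp (-ε * q.1.2 ^ 2) : ℝ) : ℂ) *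
        (g q.2.1 * starRingEnd ℂ (g q.2.2))) :=
    (integrable_gaussian_plane hε).ofReal.mul_prod (hg.mul_prod hg')
  refine h1.bdd_mul (c := 1) (by fun_prop) (Eventually.of_forall fun q => ?_)
  rw [show Complex.I * (((q.2.1.1 : ℂ) - q.2.2.1) * q.1.1 + ((q.2.1.2 : ℂ) - q.2.2.2) * q.1.2) =
    (((q.2.1.1 - q.2.2.1) * q.1.1 + (q.2.1.2 - q.2.2.2) * q.1.2 : ℝ) : ℂ) * Complex.I by
      push_cast; ring, Complex.norm_exp_ofReal_mul_I]

theorem integral_fourier_kernel_eq (g : ℝ × ℝ → ℂ) (z : ℝ × ℝ) (c : ℝ) :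
    ∫ q : (ℝ × ℝ) × (ℝ × ℝ),
      Complex.exp (Complex.I * ((q.1.1 - q.2.1) * z.1 + (q.1.2 - q.2.2) * z.2)) *
      ((c : ℂ) * (g q.1 * starRingEnd ℂ (g q.2))) = ((c * ‖planeFourier g z‖ ^ 2 : ℝ) : ℂ) := by
  have h1 : ∀ q : (ℝ × ℝ) × (ℝ × ℝ),
      Complex.exp (Complex.I * ((q.1.1 - q.2.1) * z.1 + (q.1.2 - q.2.2) * z.2)) *
      ((c : ℂ) * (g q.1 * starRingEnd ℂ (g q.2))) =
      (c : ℂ) * ((Complex.exp (Complex.I * (q.1.1 * z.1 + q.1.2 * z.2)) * g q.1) *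
        starRingEnd ℂ (Complex.exp (Complex.I * (q.2.1 * z.1 + q.2.2 * z.2)) * g q.2)) := by
    intro q
    simp only [map_mul, ← Complex.exp_conj, map_add, Complex.conj_ofReal, Complex.conj_I]
    rw [show Complex.I * (((q.1.1 : ℂ) - q.2.1) * z.1 + ((q.1.2 : ℂ) - q.2.2) * z.2) =
      Complex.I * (q.1.1 * z.1 + q.1.2 * z.2) + -Complex.I * (q.2.1 * z.1 + q.2.2 * z.2) by ring,
      Complex.exp_add]
    ring
  simp only [h1]
  rw [integral_const_mul, Measure.volume_eq_prod, integral_prod_mul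
    (fun w : ℝ × ℝ => Complex.exp (Complex.I * (w.1 * z.1 + w.2 * z.2)) * g w)
    (fun w : ℝ × ℝ => starRingEnd ℂ (Complex.exp (Complex.I * (w.1 * z.1 + w.2 * z.2)) * g w)),
    integral_conj]
  change (c : ℂ) * (planeFourier g z * starRingEnd ℂ (planeFourier g z)) = _
  rw [Complex.mul_conj']
  push_cast
  ring

/-- Schur's test: the Gaussian kernel has mass `4π²` in either variable, whatever `ε` is. Bounding
the product by the sum of both squares gives twice that. -/
theorem lintegral_gaussian_convolution_le (g : ℝ × ℝ → ℂ) (hg : AEStronglyMeasurable g)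
    {ε : ℝ} (hε : 0 < ε) :
    ∫⁻ q : (ℝ × ℝ) × (ℝ × ℝ), ENNReal.ofReal (Real.pi / ε *
      (Real.exp (-(1 / (4 * ε)) * (q.1.1 - q.2.1) ^ 2) *
        Real.exp (-(1 / (4 * ε)) * (q.1.2 - q.2.2) ^ 2))) * (‖g q.1‖ₑ * ‖g q.2‖ₑ) ≤
      ENNReal.ofReal (8 * Real.pi ^ 2) * ∫⁻ w, ‖g w‖ₑ ^ 2 := by
  have hπ := Real.pi_pos
  have hε' : 0 < 1 / (4 * ε) := by positivity
  set κ : ℝ × ℝ → ENNReal := fun w => ENNReal.ofReal (Real.pi / ε *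
      (Real.exp (-(1 / (4 * ε)) * w.1 ^ 2) * Real.exp (-(1 / (4 * ε)) * w.2 ^ 2))) with hκ
  have hκm : Measurable κ := by
    apply Measurable.ennreal_ofReal
    fun_prop
  have hκI : ∫⁻ w, κ w = ENNReal.ofReal (4 * Real.pi ^ 2) := by
    rw [hκ, ← ofReal_integral_eq_lintegral_ofReal
      ((integrable_gaussian_plane hε').const_mul _) (Eventually.of_forall fun w => by positivity),
      integral_const_mul, integral_gaussian_plane hε']
    congr 1
    field_simp
  have hge : AEMeasurable (fun w => ‖g w‖ₑ ^ 2) volume := hg.enorm.pow_const 2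
  have h1 : ∀ q : (ℝ × ℝ) × (ℝ × ℝ), κ (q.1 - q.2) * (‖g q.1‖ₑ * ‖g q.2‖ₑ) ≤
      κ (q.1 - q.2) * ‖g q.1‖ₑ ^ 2 + κ (q.1 - q.2) * ‖g q.2‖ₑ ^ 2 := by
    intro q
    rw [← mul_add]
    gcongr
    rcases le_total ‖g q.1‖ₑ ‖g q.2‖ₑ with h | h
    · calc ‖g q.1‖ₑ * ‖g q.2‖ₑ ≤ ‖g q.2‖ₑ * ‖g q.2‖ₑ := by gcongr
        _ = ‖g q.2‖ₑ ^ 2 := (sq _).symm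
        _ ≤ _ := le_add_self
    · calc ‖g q.1‖ₑ * ‖g q.2‖ₑ ≤ ‖g q.1‖ₑ * ‖g q.1‖ₑ := by gcongr
        _ = ‖g q.1‖ₑ ^ 2 := (sq _).symm
        _ ≤ _ := le_self_add
  have hsub : Measurable fun q : (ℝ × ℝ) × (ℝ × ℝ) => κ (q.1 - q.2) :=
    hκm.comp (measurable_fst.sub measurable_snd)
  have hm1 : AEMeasurable (fun q : (ℝ × ℝ) × (ℝ × ℝ) => κ (q.1 - q.2) * ‖g q.1‖ₑ ^ 2)
      (volume.prod volume) :=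
    hsub.aemeasurable.mul (hge.comp_quasiMeasurePreserving Measure.quasiMeasurePreserving_fst)
  have hm2 : AEMeasurable (fun q : (ℝ × ℝ) × (ℝ × ℝ) => κ (q.1 - q.2) * ‖g q.2‖ₑ ^ 2)
      (volume.prod volume) :=
    hsub.aemeasurable.mul (hge.comp_quasiMeasurePreserving Measure.quasiMeasurePreserving_snd)
  have e1 : ∫⁻ q : (ℝ × ℝ) × (ℝ × ℝ), κ (q.1 - q.2) * ‖g q.1‖ₑ ^ 2 =
      ENNReal.ofReal (4 * Real.pi ^ 2) * ∫⁻ w, ‖g w‖ₑ ^ 2 := by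
    rw [Measure.volume_eq_prod, lintegral_prod _ hm1, ← lintegral_const_mul'' _ hge]
    refine lintegral_congr fun w => ?_
    simp only
    have hm : Measurable fun y => κ (w - y) := hκm.comp (measurable_const.sub measurable_id)
    rw [lintegral_mul_const _ hm,
      lintegral_sub_left_eq_self κ w, hκI]
  have e2 : ∫⁻ q : (ℝ × ℝ) × (ℝ × ℝ), κ (q.1 - q.2) * ‖g q.2‖ₑ ^ 2 =
      ENNReal.ofReal (4 * Real.pi ^ 2) * ∫⁻ w, ‖g w‖ₑ ^ 2 := by
    rw [Measure.volume_eq_prod, lintegral_prod_symm _ hm2, ← lintegral_const_mul'' _ hge]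
    refine lintegral_congr fun w => ?_
    simp only
    have hm : Measurable fun y => κ (y - w) := hκm.comp (measurable_id.sub measurable_const)
    rw [lintegral_mul_const _ hm,
      lintegral_sub_right_eq_self κ w, hκI]
  calc _ ≤ ∫⁻ q : (ℝ × ℝ) × (ℝ × ℝ),
        (κ (q.1 - q.2) * ‖g q.1‖ₑ ^ 2 + κ (q.1 - q.2) * ‖g q.2‖ₑ ^ 2) := lintegral_mono h1
    _ = (ENNReal.ofReal (4 * Real.pi ^ 2) * ∫⁻ w, ‖g w‖ₑ ^ 2) +
        ENNReal.ofReal (4 * Real.pi ^ 2) * ∫⁻ w, ‖g w‖ₑ ^ 2 := by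
        rw [Measure.volume_eq_prod] at e1 e2 ⊢
        rw [lintegral_add_left' hm1, e1, e2]
    _ = _ := by
        rw [← add_mul, ← ENNReal.ofReal_add (by positivity) (by positivity)]
        congr 2
        ring

theorem measurableSet_disc (s : ℝ) : MeasurableSet (disc s) :=
  measurableSet_le (by fun_prop) measurable_const

/-- A local form of Plancherel's inequality. -/
theorem setLIntegral_disc_sq_planeFourier_le {g : ℝ × ℝ → ℂ} (hg : Integrable g) {s : ℝ}
    (hs : 0 < s) :
    ∫⁻ z in disc s, ENNReal.ofReal (‖planeFourier g z‖ ^ 2) ≤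
      ENNReal.ofReal (Real.exp 1 * (8 * Real.pi ^ 2)) * ∫⁻ w, ‖g w‖ₑ ^ 2 := by
  -- At this width the Gaussian is at least `1/e` on the disc; the constant stays independent of
  -- `s`.
  set ε : ℝ := 1 / s ^ 2 with hεdef
  have hε : 0 < ε := by positivity
  set Γ : ℝ × ℝ → ℝ := fun z => Real.exp (-ε * z.1 ^ 2) * Real.exp (-ε * z.2 ^ 2) with hΓ
  have hF := integrable_gaussian_mul_fourier_kernel hg hε
  rw [Measure.volume_eq_prod] at hF
  have hΓint : Integrable fun z => ((Γ z * ‖planeFourier g z‖ ^ 2 : ℝ) : ℂ) := by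
    refine hF.integral_prod_left.congr (Eventually.of_forall fun z => ?_)
    exact integral_fourier_kernel_eq g z (Γ z)
  have hΓint' : Integrable fun z => Γ z * ‖planeFourier g z‖ ^ 2 := by
    refine hΓint.re.congr (Eventually.of_forall fun z => ?_)
    exact Complex.ofReal_re _
  have hΓpos : ∀ z, 0 < Γ z := fun z => by simp only [hΓ]; positivity
  have hdisc : ∀ z ∈ disc s, 1 ≤ Real.exp 1 * Γ z := by
    intro z hz
    have h1 : Real.sqrt (z.1 ^ 2 + z.2 ^ 2) ≤ s := hz
    have h2 : z.1 ^ 2 + z.2 ^ 2 ≤ s ^ 2 := (Real.sqrt_le_left hs.le).1 h1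
    simp only [hΓ]
    rw [← Real.exp_add, ← Real.exp_add]
    apply Real.one_le_exp
    have h3 : ε * (z.1 ^ 2 + z.2 ^ 2) ≤ 1 := by
      rw [hεdef, one_div, inv_mul_le_iff₀ (by positivity)]
      linarith
    linarith
  -- Expand the square as a double integral and integrate in `z` first: `Γ` becomes its Fourier
  -- transform at the difference of the two frequencies, a Gaussian convolution kernel.
  have key : ENNReal.ofReal (∫ z, Γ z * ‖planeFourier g z‖ ^ 2) ≤
      ENNReal.ofReal (8 * Real.pi ^ 2) * ∫⁻ w, ‖g w‖ₑ ^ 2 := by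
    have h1 : ENNReal.ofReal (∫ z, Γ z * ‖planeFourier g z‖ ^ 2) =
        ‖∫ z, ((Γ z * ‖planeFourier g z‖ ^ 2 : ℝ) : ℂ)‖ₑ := by
      rw [integral_complex_ofReal, ← ofReal_norm, Complex.norm_real, Real.norm_eq_abs,
        abs_of_nonneg]
      exact integral_nonneg fun z => mul_nonneg (hΓpos z).le (by positivity)
    rw [h1]
    have h2 : ∀ z, ((Γ z * ‖planeFourier g z‖ ^ 2 : ℝ) : ℂ) = ∫ q : (ℝ × ℝ) × (ℝ × ℝ),
      Complex.exp (Complex.I * ((q.1.1 - q.2.1) * z.1 + (q.1.2 - q.2.2) * z.2)) *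
      ((Γ z : ℂ) * (g q.1 * starRingEnd ℂ (g q.2))) := fun z =>
      (integral_fourier_kernel_eq g z (Γ z)).symm
    simp only [h2]
    rw [integral_integral_swap (f := fun (z : ℝ × ℝ) (q : (ℝ × ℝ) × (ℝ × ℝ)) =>
      Complex.exp (Complex.I * ((q.1.1 - q.2.1) * z.1 + (q.1.2 - q.2.2) * z.2)) *
      ((Γ z : ℂ) * (g q.1 * starRingEnd ℂ (g q.2)))) hF]
    refine (enorm_integral_le_lintegral_enorm _).trans ((lintegral_mono fun q => ?_).trans
      (lintegral_gaussian_convolution_le g hg.aestronglyMeasurable hε))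
    have h3 : ∀ z : ℝ × ℝ,
        Complex.exp (Complex.I * ((q.1.1 - q.2.1) * z.1 + (q.1.2 - q.2.2) * z.2)) *
        ((Γ z : ℂ) * (g q.1 * starRingEnd ℂ (g q.2))) = (g q.1 * starRingEnd ℂ (g q.2)) *
        (Complex.exp (Complex.I * (((q.1 - q.2).1 : ℝ) * z.1 + ((q.1 - q.2).2 : ℝ) * z.2)) *
          (Γ z : ℂ)) := by
      intro z
      simp only [Prod.fst_sub, Prod.snd_sub, Complex.ofReal_sub]
      ring
    simp only [h3]
    rw [integral_const_mul, enorm_mul, enorm_mul]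
    have h4 := norm_integral_exp_mul_gaussian_plane hε (q.1 - q.2)
    rw [← ofReal_norm (∫ z : ℝ × ℝ, _), h4, RCLike.enorm_conj, mul_comm]
    simp only [Prod.fst_sub, Prod.snd_sub]
    exact le_rfl
  calc ∫⁻ z in disc s, ENNReal.ofReal (‖planeFourier g z‖ ^ 2)
      ≤ ∫⁻ z in disc s, ENNReal.ofReal (Real.exp 1 * (Γ z * ‖planeFourier g z‖ ^ 2)) := by
        refine setLIntegral_mono' (measurableSet_disc s) fun z hz => ?_
        apply ENNReal.ofReal_le_ofReal
        rw [← mul_assoc]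
        exact le_mul_of_one_le_left (by positivity) (hdisc z hz)
    _ ≤ ∫⁻ z, ENNReal.ofReal (Real.exp 1 * (Γ z * ‖planeFourier g z‖ ^ 2)) :=
        setLIntegral_le_lintegral _ _
    _ = ENNReal.ofReal (Real.exp 1) *
        ENNReal.ofReal (∫ z, Γ z * ‖planeFourier g z‖ ^ 2) := by
        rw [← ENNReal.ofReal_mul (Real.exp_pos _).le, ← integral_const_mul,
          ofReal_integral_eq_lintegral_ofReal (hΓint'.const_mul _)]
        exact Eventually.of_forall fun z =>
          mul_nonneg (Real.exp_pos _).le (mul_nonneg (hΓpos z).le (by positivity))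
    _ ≤ ENNReal.ofReal (Real.exp 1) *
        (ENNReal.ofReal (8 * Real.pi ^ 2) * ∫⁻ w, ‖g w‖ₑ ^ 2) := by gcongr
    _ = _ := by rw [← mul_assoc, ← ENNReal.ofReal_mul (Real.exp_pos _).le]

/-! ### The Radon transform of the Wigner function -/

theorem cos_sq_add_sin_sq_ne_zero (φ : ℝ) : Real.cos φ ^ 2 + Real.sin φ ^ 2 ≠ 0 := by
  rw [Real.cos_sq_add_sin_sq]
  exact one_ne_zero

theorem radon_eq_integral_planeSimilarity (f : ℝ × ℝ → ℝ) (x φ : ℝ) :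
    radon f x φ = ∫ t : ℝ, f (planeSimilarity (Real.cos φ) (Real.sin φ) (x, t)) := by
  simp only [radon, planeSimilarity, mul_comm]

theorem stronglyMeasurable_radon {f : ℝ × ℝ → ℝ} (hf : Continuous f) :
    StronglyMeasurable fun a : ℝ × ℝ => radon f a.1 a.2 := by
  have h : Continuous fun q : (ℝ × ℝ) × ℝ =>
      f (q.1.1 * Real.cos q.1.2 - q.2 * Real.sin q.1.2,
        q.1.1 * Real.sin q.1.2 + q.2 * Real.cos q.1.2) := by fun_prop
  exact h.stronglyMeasurable.integral_prod_right

theorem integrable_radon {f : ℝ × ℝ → ℝ} (hf : Integrable f) (φ : ℝ) :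
    Integrable fun x : ℝ => radon f x φ := by
  have h := integrable_comp_planeSimilarity (cos_sq_add_sin_sq_ne_zero φ) hf
  rw [Measure.volume_eq_prod] at h
  simp only [radon_eq_integral_planeSimilarity]
  exact h.integral_prod_left

theorem integral_norm_radon_le {f : ℝ × ℝ → ℝ} (hf : Integrable f) (φ : ℝ) :
    ∫ x : ℝ, ‖radon f x φ‖ ≤ ∫ z, ‖f z‖ := by
  have hφ := cos_sq_add_sin_sq_ne_zero φ
  have h := (integrable_comp_planeSimilarity hφ hf).norm
  have h1 := integral_comp_planeSimilarity hφ fun z => ‖f z‖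
  rw [Real.cos_sq_add_sin_sq, inv_one, one_smul] at h1
  rw [← h1]
  rw [Measure.volume_eq_prod] at h ⊢
  rw [integral_prod _ h]
  refine integral_mono (integrable_radon hf φ).norm h.integral_prod_left fun x => ?_
  simp only [radon_eq_integral_planeSimilarity]
  exact norm_integral_le_integral_norm _

/-- The projection-slice theorem. -/
theorem FockDecay.integral_exp_mul_radon {ρ : QuantumState} {b r : ℝ} {a : ℕ × ℕ → ℝ}
    (h : FockDecay ρ b r a) (τ φ : ℝ) :
    ∫ x : ℝ, Complex.exp (-Complex.I * τ * x) * (radon (wigner ρ) x φ : ℂ) =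
      wignerFourier ρ (τ * Real.cos φ) (τ * Real.sin φ) := by
  have hφ := cos_sq_add_sin_sq_ne_zero φ
  set u : ℝ := τ * Real.cos φ with hu
  set v : ℝ := τ * Real.sin φ with hv
  set G : ℝ × ℝ → ℂ := fun z =>
    Complex.exp (-Complex.I * (u * z.1 + v * z.2)) * wigner ρ z with hG
  have hGi : Integrable G := by
    refine h.integrable_wigner.ofReal.bdd_mul (c := 1) (by fun_prop)
      (Eventually.of_forall fun z => ?_)
    rw [show -Complex.I * ((u : ℂ) * z.1 + v * z.2) =
      ((-(u * z.1 + v * z.2) : ℝ) : ℂ) * Complex.I by push_cast; ring,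
      Complex.norm_exp_ofReal_mul_I]
  have h1 := integral_comp_planeSimilarity hφ G
  have h2 := integrable_comp_planeSimilarity hφ hGi
  rw [Real.cos_sq_add_sin_sq, inv_one, one_smul, hG, h.integral_exp_mul_wigner] at h1
  rw [← h1]
  rw [Measure.volume_eq_prod] at h2 ⊢
  rw [integral_prod _ h2]
  refine integral_congr_ae (Eventually.of_forall fun x => ?_)
  simp only [radon_eq_integral_planeSimilarity]
  rw [← integral_complex_ofReal, ← integral_const_mul]
  refine integral_congr_ae (Eventually.of_forall fun t => ?_)
  simp only [planeSimilarity]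
  congr 2
  have : Real.cos φ ^ 2 + Real.sin φ ^ 2 = 1 := Real.cos_sq_add_sin_sq φ
  have h3 : u * (Real.cos φ * x - Real.sin φ * t) + v * (Real.sin φ * x + Real.cos φ * t) =
      τ * x := by
    rw [hu, hv]
    linear_combination (τ * x) * this
  rw [mul_assoc]
  congr 1
  exact_mod_cast h3.symm

/-! ### Characteristic functions under the homodyne law -/

/-- Lebesgue measure on `ℝ × [0, π]`. -/
noncomputable def stripMeasure : Measure (ℝ × ℝ) :=
  (volume : Measure ℝ).prod ((volume : Measure ℝ).restrict (Icc 0 Real.pi))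

theorem homodyneLaw_eq (ρ : QuantumState) :
    homodyneLaw ρ = (ENNReal.ofReal (1 / Real.pi) • stripMeasure).withDensity
      (fun a => ENNReal.ofReal (radon (wigner ρ) a.1 a.2)) := by
  rw [homodyneLaw, stripMeasure, Measure.volume_eq_prod, ← Measure.prod_restrict,
    Measure.restrict_univ]

namespace FockDecay

variable {ρ : QuantumState} {b r : ℝ} {a : ℕ × ℕ → ℝ}

theorem integrable_radon_strip (h : FockDecay ρ b r a) :
    Integrable (fun a : ℝ × ℝ => radon (wigner ρ) a.1 a.2) stripMeasure := by
  have hm := stronglyMeasurable_radon h.continuous_wigner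
  rw [stripMeasure, integrable_prod_iff' hm.aestronglyMeasurable]
  refine ⟨Eventually.of_forall fun φ => integrable_radon h.integrable_wigner φ, ?_⟩
  refine (integrable_const (∫ z, ‖wigner ρ z‖)).mono'
    (hm.norm.prod_swap.integral_prod_right).aestronglyMeasurable ?_
  refine Eventually.of_forall fun φ => ?_
  rw [Real.norm_eq_abs, abs_of_nonneg (integral_nonneg fun _ => norm_nonneg _)]
  exact integral_norm_radon_le h.integrable_wigner φ

/-- At frequency zero the projection-slice theorem says that every angular slice has mass `Tr ρ =
1`. -/
theorem integral_radon_strip (h : FockDecay ρ b r a) :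
    ∫ a, radon (wigner ρ) a.1 a.2 ∂stripMeasure = Real.pi := by
  have hi := h.integrable_radon_strip
  rw [stripMeasure] at hi ⊢
  rw [integral_prod_symm _ hi]
  have h1 : ∀ φ : ℝ, ∫ x : ℝ, radon (wigner ρ) x φ = 1 := by
    intro φ
    have h2 := h.integral_exp_mul_radon 0 φ
    simp only [Complex.ofReal_zero, mul_zero, zero_mul, Complex.exp_zero, one_mul,
      wignerFourier_zero_zero] at h2
    rw [integral_complex_ofReal] at h2
    exact_mod_cast h2
  simp only [h1]
  simp [Real.pi_pos.le]

/-- The homodyne density is nonnegative as soon as the truncated density has total mass one. -/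
theorem ae_radon_nonneg (h : FockDecay ρ b r a) [IsProbabilityMeasure (homodyneLaw ρ)] :
    ∀ᵐ a ∂stripMeasure, 0 ≤ radon (wigner ρ) a.1 a.2 := by
  set p : ℝ × ℝ → ℝ := fun a => radon (wigner ρ) a.1 a.2 with hp
  have hi : Integrable p stripMeasure := h.integrable_radon_strip
  have hi' : Integrable (fun a => max (p a) 0) stripMeasure := hi.pos_part
  have h1 : ∫⁻ a, ENNReal.ofReal (p a) ∂stripMeasure = ENNReal.ofReal Real.pi := by
    have h2 := measure_univ (μ := homodyneLaw ρ)
    rw [homodyneLaw_eq, withDensity_apply _ MeasurableSet.univ, Measure.restrict_univ,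
      lintegral_smul_measure, smul_eq_mul] at h2
    have h3 : ENNReal.ofReal Real.pi * ENNReal.ofReal (1 / Real.pi) = 1 := by
      rw [← ENNReal.ofReal_mul Real.pi_pos.le, mul_one_div_cancel Real.pi_ne_zero,
        ENNReal.ofReal_one]
    calc _ = ENNReal.ofReal Real.pi * (ENNReal.ofReal (1 / Real.pi) *
          ∫⁻ a, ENNReal.ofReal (p a) ∂stripMeasure) := by rw [← mul_assoc, h3, one_mul]
      _ = _ := by rw [h2, mul_one]
  have h4 : ∫ a, max (p a) 0 ∂stripMeasure = Real.pi := by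
    rw [integral_eq_lintegral_of_nonneg_ae (f := fun a => max (p a) 0) (Eventually.of_forall fun a => le_max_right _ _)
      hi'.aestronglyMeasurable]
    have : ∀ a, ENNReal.ofReal (max (p a) 0) = ENNReal.ofReal (p a) := by
      intro a
      rcases le_total (p a) 0 with h | h
      · rw [max_eq_right h, ENNReal.ofReal_of_nonpos h, ENNReal.ofReal_zero]
      · rw [max_eq_left h]
    simp only [this]
    rw [h1, ENNReal.toReal_ofReal Real.pi_pos.le]
  -- The law truncates `p` at zero. Having total mass one, it forces the positive part of `p` to
  -- have the same integral as `p`, so the negative part is null.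
  have h5 : ∫ a, (max (p a) 0 - p a) ∂stripMeasure = 0 := by
    rw [integral_sub hi' hi, h4, h.integral_radon_strip, sub_self]
  rw [integral_eq_zero_iff_of_nonneg (fun a => sub_nonneg.2 (le_max_left _ _)) (hi'.sub hi)] at h5
  filter_upwards [h5] with a ha
  have : max (p a) 0 = p a := sub_eq_zero.1 ha
  exact max_eq_left_iff.1 this

/-- The joint characteristic function of `z · (cos Φ, sin Φ) - X` under the homodyne law. -/
theorem integral_exp_homodyneLaw (h : FockDecay ρ b r a) [IsProbabilityMeasure (homodyneLaw ρ)]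
    (z : ℝ × ℝ) (t : ℝ) :
    ∫ a, Complex.exp (-Complex.I * t * (z.1 * Real.cos a.2 + z.2 * Real.sin a.2 - a.1 : ℝ))
        ∂(homodyneLaw ρ) =
      (Real.pi : ℂ)⁻¹ * ∫ φ in Icc 0 Real.pi,
        Complex.exp (Complex.I * ((-t * Real.cos φ : ℝ) * z.1 + (-t * Real.sin φ : ℝ) * z.2)) *
          wignerFourier ρ (-t * Real.cos φ) (-t * Real.sin φ) := by
  have hm : Measurable fun a : ℝ × ℝ => ENNReal.ofReal (radon (wigner ρ) a.1 a.2) :=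
    (stronglyMeasurable_radon h.continuous_wigner).measurable.ennreal_ofReal
  rw [homodyneLaw_eq, integral_withDensity_eq_integral_toReal_smul hm
    (Eventually.of_forall fun a => ENNReal.ofReal_lt_top), integral_smul_measure,
    ENNReal.toReal_ofReal (by have := Real.pi_pos; positivity), Complex.real_smul]
  congr 1
  · push_cast
    rw [one_div]
  have hpos := h.ae_radon_nonneg
  have h1 : ∫ a, (ENNReal.ofReal (radon (wigner ρ) a.1 a.2)).toReal •
      Complex.exp (-Complex.I * t * (z.1 * Real.cos a.2 + z.2 * Real.sin a.2 - a.1 : ℝ))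
      ∂stripMeasure = ∫ a, Complex.exp (-Complex.I * t *
        (z.1 * Real.cos a.2 + z.2 * Real.sin a.2 - a.1 : ℝ)) * (radon (wigner ρ) a.1 a.2 : ℂ)
      ∂stripMeasure := by
    refine integral_congr_ae ?_
    filter_upwards [hpos] with a ha
    rw [ENNReal.toReal_ofReal ha, Complex.real_smul, mul_comm]
  rw [h1]
  have hI : Integrable (fun a : ℝ × ℝ => Complex.exp (-Complex.I * t *
        (z.1 * Real.cos a.2 + z.2 * Real.sin a.2 - a.1 : ℝ)) * (radon (wigner ρ) a.1 a.2 : ℂ))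
      stripMeasure := by
    refine h.integrable_radon_strip.ofReal.bdd_mul (c := 1) (by fun_prop)
      (Eventually.of_forall fun a => ?_)
    rw [show -Complex.I * (t : ℂ) * ((z.1 * Real.cos a.2 + z.2 * Real.sin a.2 - a.1 : ℝ) : ℂ) =
      ((-t * (z.1 * Real.cos a.2 + z.2 * Real.sin a.2 - a.1) : ℝ) : ℂ) * Complex.I by
        push_cast; ring, Complex.norm_exp_ofReal_mul_I]
  rw [stripMeasure] at hI ⊢
  rw [integral_prod_symm _ hI]
  refine integral_congr_ae (Eventually.of_forall fun φ => ?_)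
  simp only
  -- For each angle, the projection-slice theorem at frequency `-t`.
  rw [← h.integral_exp_mul_radon, ← integral_const_mul]
  refine integral_congr_ae (Eventually.of_forall fun x => ?_)
  simp only
  rw [← mul_assoc, ← Complex.exp_add]
  congr 2
  push_cast
  ring

end FockDecay

/-! ### Polar coordinates over half-turns -/

theorem setIntegral_disc_eq_polar {F : ℝ × ℝ → ℂ} {R : ℝ} (hF : Continuous F) (hR : 0 ≤ R) :
    ∫ w in disc R, F w = ∫ s in (0 : ℝ)..R, ∫ θ in (-Real.pi)..Real.pi,
      (s : ℂ) * F (s * Real.cos θ, s * Real.sin θ) := by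
  rw [← integral_indicator (measurableSet_disc R), ← integral_comp_polarCoord_symm,
    polarCoord_target]
  have h1 : ∀ p ∈ Ioi (0 : ℝ) ×ˢ Ioo (-Real.pi) Real.pi,
      p.1 • (disc R).indicator F (polarCoord.symm p) =
      (Ioc (0 : ℝ) R ×ˢ (univ : Set ℝ)).indicator
        (fun p : ℝ × ℝ => (p.1 : ℂ) * F (p.1 * Real.cos p.2, p.1 * Real.sin p.2)) p := by
    rintro ⟨s, θ⟩ ⟨hs, -⟩
    have hs' : 0 < s := hs
    have hmem : polarCoord.symm (s, θ) ∈ disc R ↔ (s, θ) ∈ Ioc (0 : ℝ) R ×ˢ (univ : Set ℝ) := by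
      simp only [disc, polarCoord_symm_apply, mem_ofPred_eq, mem_prod, mem_Ioc, mem_univ, and_true]
      rw [show (s * Real.cos θ) ^ 2 + (s * Real.sin θ) ^ 2 = s ^ 2 by
        linear_combination s ^ 2 * Real.cos_sq_add_sin_sq θ, Real.sqrt_sq hs'.le]
      simp [hs']
    by_cases hm : (s, θ) ∈ Ioc (0 : ℝ) R ×ˢ (univ : Set ℝ)
    · rw [indicator_of_mem hm, indicator_of_mem (hmem.2 hm), Complex.real_smul]
      rfl
    · rw [indicator_of_notMem hm, indicator_of_notMem (fun h => hm (hmem.1 h)), smul_zero]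
  rw [setIntegral_congr_fun (measurableSet_Ioi.prod measurableSet_Ioo) h1,
    setIntegral_indicator (measurableSet_Ioc.prod MeasurableSet.univ), prod_inter_prod,
    inter_univ]
  have h2 : Ioi (0 : ℝ) ∩ Ioc 0 R = Ioc 0 R := by
    ext x
    simp only [mem_inter_iff, mem_Ioi, mem_Ioc]
    tauto
  have hc : Continuous fun p : ℝ × ℝ =>
      (p.1 : ℂ) * F (p.1 * Real.cos p.2, p.1 * Real.sin p.2) := by fun_prop
  have hi : IntegrableOn (fun p : ℝ × ℝ =>
      (p.1 : ℂ) * F (p.1 * Real.cos p.2, p.1 * Real.sin p.2))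
      (Ioc 0 R ×ˢ Ioo (-Real.pi) Real.pi) (volume.prod volume) :=
    (hc.continuousOn.integrableOn_compact (isCompact_Icc.prod isCompact_Icc)).mono_set
      (prod_mono Ioc_subset_Icc_self Ioo_subset_Icc_self)
  rw [h2, Measure.volume_eq_prod, setIntegral_prod _ hi, intervalIntegral.integral_of_le hR]
  refine setIntegral_congr_fun measurableSet_Ioc fun s _ => ?_
  simp only
  rw [intervalIntegral.integral_of_le (by linarith [Real.pi_pos]), integral_Ioc_eq_integral_Ioo]

/-- Negative `t` sweeps the upper half of the disc and positive `t` the lower half, with `|t|` as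
polar Jacobian. -/
theorem integral_halfTurn_eq_setIntegral_disc {F : ℝ × ℝ → ℂ} {R : ℝ} (hF : Continuous F)
    (hR : 0 ≤ R) :
    ∫ t in (-R)..R, ((|t| : ℝ) : ℂ) * ∫ φ in Icc 0 Real.pi, F (-t * Real.cos φ, -t * Real.sin φ) =
      ∫ w in disc R, F w := by
  have hπ := Real.pi_pos
  set J : ℝ → ℂ := fun t => ((|t| : ℝ) : ℂ) * ∫ φ in (0 : ℝ)..Real.pi,
    F (-t * Real.cos φ, -t * Real.sin φ) with hJ
  have hJc : Continuous J := by
    refine (by fun_prop : Continuous fun t : ℝ => ((|t| : ℝ) : ℂ)).mul ?_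
    exact intervalIntegral.continuous_parametric_intervalIntegral_of_continuous'
      (f := fun t φ => F (-t * Real.cos φ, -t * Real.sin φ)) (by fun_prop) 0 Real.pi
  have h0 : ∫ t in (-R)..R, ((|t| : ℝ) : ℂ) * ∫ φ in Icc 0 Real.pi,
      F (-t * Real.cos φ, -t * Real.sin φ) = ∫ t in (-R)..R, J t := by
    refine intervalIntegral.integral_congr fun t _ => ?_
    simp only [hJ]
    rw [intervalIntegral.integral_of_le hπ.le, integral_Icc_eq_integral_Ioc]
  have hJn : ∀ s, 0 ≤ s → J (-s) + J s = ∫ θ in (-Real.pi)..Real.pi,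
      (s : ℂ) * F (s * Real.cos θ, s * Real.sin θ) := by
    intro s hs
    have e1 : J (-s) = (s : ℂ) * ∫ φ in (0 : ℝ)..Real.pi, F (s * Real.cos φ, s * Real.sin φ) := by
      simp only [hJ, abs_neg, abs_of_nonneg hs, neg_neg]
    have e2 : J s = (s : ℂ) *
        ∫ φ in (-Real.pi)..0, F (s * Real.cos φ, s * Real.sin φ) := by
      simp only [hJ, abs_of_nonneg hs]
      have := intervalIntegral.integral_comp_sub_right (a := 0) (b := Real.pi)
        (fun φ => F (s * Real.cos φ, s * Real.sin φ)) Real.pi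
      rw [zero_sub, sub_self] at this
      rw [← this]
      simp only [Real.cos_sub_pi, Real.sin_sub_pi, mul_neg, neg_mul]
    have hc : Continuous fun φ : ℝ => F (s * Real.cos φ, s * Real.sin φ) := by fun_prop
    rw [intervalIntegral.integral_const_mul, e1, e2, ← mul_add, add_comm,
      intervalIntegral.integral_add_adjacent_intervals (hc.intervalIntegrable _ _)
        (hc.intervalIntegrable _ _)]
  rw [h0, setIntegral_disc_eq_polar hF hR,
    ← intervalIntegral.integral_add_adjacent_intervals (hJc.intervalIntegrable (-R) 0)
      (hJc.intervalIntegrable 0 R)]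
  have hJn' : Continuous fun s => J (-s) := hJc.comp continuous_neg
  have h2 : ∫ t in (-R)..0, J t = ∫ s in (0 : ℝ)..R, J (-s) := by
    rw [intervalIntegral.integral_comp_neg, neg_zero]
  rw [h2, ← intervalIntegral.integral_add (hJn'.intervalIntegrable 0 R)
    (hJc.intervalIntegrable 0 R)]
  refine intervalIntegral.integral_congr fun s hs => ?_
  rw [uIcc_of_le hR] at hs
  exact hJn s hs.1

/-! ### The kernel -/

theorem noiseFourier_eq {η : ℝ} (hη : η < 1) (t : ℝ) :
    noiseFourier η t = Complex.exp (-((1 - η) / 4 * t ^ 2 : ℝ)) := by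
  have hv : Real.toNNReal ((1 - η) / 2) ≠ 0 := by
    rw [Ne, Real.toNNReal_eq_zero, not_le]
    linarith
  have h := charFun_gaussianReal (μ := 0) (v := Real.toNNReal ((1 - η) / 2)) (-t)
  rw [charFun_apply_real, integral_gaussianReal_eq_integral_smul hv] at h
  have h1 : noiseFourier η t = ∫ x : ℝ, gaussianPDFReal 0 (Real.toNNReal ((1 - η) / 2)) x •
      Complex.exp (((-t : ℝ) : ℂ) * x * Complex.I) := by
    refine integral_congr_ae (Eventually.of_forall fun x => ?_)
    simp only [noiseDensity, Complex.real_smul]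
    rw [mul_comm]
    congr 2
    push_cast
    ring
  rw [h1, h, Real.coe_toNNReal ((1 - η) / 2) (by linarith)]
  congr 1
  push_cast
  ring

/-- The weight `|t| exp(γ t²) / (4π)` of the frequency `t` in the kernel. -/
noncomputable def frequencyWeight (γ t : ℝ) : ℝ := |t| * Real.exp (γ * t ^ 2) / (4 * Real.pi)

theorem continuous_frequencyWeight (γ : ℝ) : Continuous (frequencyWeight γ) := by
  unfold frequencyWeight
  fun_prop

theorem frequencyWeight_nonneg (γ t : ℝ) : 0 ≤ frequencyWeight γ t := by
  unfold frequencyWeight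
  positivity

/-- On the half-line `t e^{γt²}` has an explicit primitive; the constants are not optimised. -/
theorem integral_frequencyWeight_le {γ R : ℝ} (hγ : 0 < γ) :
    ∫ t in (-R)..R, frequencyWeight γ t ≤ Real.exp (γ * R ^ 2) / (2 * γ) := by
  have hc : ∀ a b : ℝ, IntervalIntegrable (frequencyWeight γ) volume a b := fun a b =>
    (continuous_frequencyWeight γ).intervalIntegrable a b
  have hsymm : ∫ t in (-R)..0, frequencyWeight γ t = ∫ t in (0)..R, frequencyWeight γ t := by
    have h := intervalIntegral.integral_comp_neg (a := 0) (b := R) (frequencyWeight γ)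
    rw [neg_zero] at h
    rw [← h]
    simp [frequencyWeight]
  rw [← intervalIntegral.integral_add_adjacent_intervals (hc (-R) 0) (hc 0 R), hsymm]
  have hhalf : ∫ t in (0)..R, frequencyWeight γ t ≤
      Real.exp (γ * R ^ 2) / (4 * γ) := by
    have hderiv : ∀ t : ℝ, HasDerivAt (fun t => Real.exp (γ * t ^ 2) / (2 * γ))
        (t * Real.exp (γ * t ^ 2)) t := by
      intro t
      have h := ((((hasDerivAt_pow 2 t).const_mul γ).exp).div_const (2 * γ))
      refine h.congr_deriv ?_
      rw [div_eq_iff (by positivity)]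
      push_cast
      ring
    have hint : ∀ a b : ℝ, ∫ t in a..b, t * Real.exp (γ * t ^ 2) =
        Real.exp (γ * b ^ 2) / (2 * γ) - Real.exp (γ * a ^ 2) / (2 * γ) := fun a b =>
      intervalIntegral.integral_eq_sub_of_hasDerivAt (fun t _ => hderiv t)
        (Continuous.intervalIntegrable (by fun_prop) _ _)
    have hE := Real.exp_pos (γ * R ^ 2)
    have h1 : (1 : ℝ) ≤ Real.exp (γ * R ^ 2) := Real.one_le_exp (by positivity)
    have hpi : (2 : ℝ) ≤ 4 * Real.pi := by linarith [Real.two_le_pi]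
    have hbound : (Real.exp (γ * R ^ 2) - 1) / (2 * γ) / (4 * Real.pi) ≤
        Real.exp (γ * R ^ 2) / (4 * γ) := by
      rw [div_div, div_le_div_iff₀ (by positivity) (by positivity)]
      nlinarith [mul_le_mul_of_nonneg_left hpi (by positivity : 0 ≤ Real.exp (γ * R ^ 2) * γ),
        mul_pos hγ Real.pi_pos]
    rcases le_total 0 R with hR | hR
    · have h : ∫ t in (0)..R, frequencyWeight γ t =
          (∫ t in (0)..R, t * Real.exp (γ * t ^ 2)) / (4 * Real.pi) := by
        rw [← intervalIntegral.integral_div]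
        refine intervalIntegral.integral_congr fun t ht => ?_
        rw [uIcc_of_le hR] at ht
        simp only [frequencyWeight, abs_of_nonneg ht.1]
      rw [h, hint]
      convert hbound using 2
      simp [sub_div]
    · refine le_trans ?_ (by positivity : (0 : ℝ) ≤ Real.exp (γ * R ^ 2) / (4 * γ))
      rw [intervalIntegral.integral_symm, neg_nonpos]
      exact intervalIntegral.integral_nonneg hR fun t _ => frequencyWeight_nonneg γ t
  calc _ ≤ Real.exp (γ * R ^ 2) / (4 * γ) + Real.exp (γ * R ^ 2) / (4 * γ) :=
        add_le_add hhalf hhalf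
    _ = _ := by field_simp; ring

theorem kernel_eq {η : ℝ} (h0 : 0 < η) (h1 : η < 1) (h u : ℝ) :
    kernel η h u = (∫ t in (-(1 / h))..(1 / h),
      Complex.exp (-Complex.I * u * t) * (frequencyWeight ((1 - η) / (4 * η)) t : ℂ)).re := by
  unfold kernel
  rw [← intervalIntegral.integral_const_mul]
  congr 2
  funext t
  rw [noiseFourier_eq h1, div_pow, Real.sq_sqrt h0.le, ← Complex.ofReal_neg, ← Complex.ofReal_exp]
  have he : Real.exp (-((1 - η) / 4 * (t ^ 2 / η))) =
      (Real.exp ((1 - η) / (4 * η) * t ^ 2))⁻¹ := by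
    rw [← Real.exp_neg]
    congr 1
    field_simp
  rw [he, frequencyWeight]
  push_cast
  rw [div_inv_eq_mul]
  ring

theorem norm_exp_neg_I_mul (u t : ℝ) : ‖Complex.exp (-Complex.I * u * t)‖ = 1 := by
  rw [show -Complex.I * (u : ℂ) * t = ((-(u * t) : ℝ) : ℂ) * Complex.I by push_cast; ring,
    Complex.norm_exp_ofReal_mul_I]

/-- The triangle inequality is enough: squared, it already has the exponent `2γ/h²` of the variance
bound. -/
theorem abs_kernel_le {η h : ℝ} (h0 : 0 < η) (h1 : η < 1) (hh : 0 < h) (u : ℝ) :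
    |kernel η h u| ≤ Real.exp ((1 - η) / (4 * η) / h ^ 2) / (2 * ((1 - η) / (4 * η))) := by
  have hγ : 0 < (1 - η) / (4 * η) := div_pos (by linarith) (by linarith)
  have hR : -(1 / h) ≤ 1 / h := by
    have : 0 < 1 / h := by positivity
    linarith
  rw [kernel_eq h0 h1]
  refine (Complex.abs_re_le_norm _).trans ?_
  refine (intervalIntegral.norm_integral_le_integral_norm hR).trans ?_
  simp only [norm_mul, norm_exp_neg_I_mul, one_mul, Complex.norm_real, Real.norm_eq_abs,
    abs_of_nonneg (frequencyWeight_nonneg _ _)]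
  refine (integral_frequencyWeight_le hγ).trans_eq ?_
  rw [div_pow, one_pow, mul_one_div]

theorem continuous_kernel {η : ℝ} (h0 : 0 < η) (h1 : η < 1) (h : ℝ) :
    Continuous (kernel η h) := by
  have hk : kernel η h = fun u : ℝ => (∫ t in (-(1 / h))..(1 / h),
      Complex.exp (-Complex.I * u * t) * (frequencyWeight ((1 - η) / (4 * η)) t : ℂ)).re :=
    funext fun u => kernel_eq h0 h1 h u
  rw [hk]
  have hw := continuous_frequencyWeight ((1 - η) / (4 * η))
  exact Complex.continuous_re.comp
    (intervalIntegral.continuous_parametric_intervalIntegral_of_continuous'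
      (by simp only [Function.uncurry_def]; fun_prop) _ _)

/-- Fubini: the mean of the kernel involves the law of `U` only through its characteristic function.
-/
theorem integral_kernel {η h : ℝ} (h0 : 0 < η) (h1 : η < 1) (hh : 0 < h) {Ω : Type*}
    [MeasurableSpace Ω] {μ : Measure Ω} [IsProbabilityMeasure μ] {U : Ω → ℝ}
    (hU : AEMeasurable U μ) :
    ∫ ω, kernel η h (U ω) ∂μ = (∫ t in (-(1 / h))..(1 / h),
      (∫ ω, Complex.exp (-Complex.I * U ω * t) ∂μ) *
        (frequencyWeight ((1 - η) / (4 * η)) t : ℂ)).re := by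
  have hR : -(1 / h) ≤ 1 / h := by
    have : 0 < 1 / h := by positivity
    linarith
  have hw := continuous_frequencyWeight ((1 - η) / (4 * η))
  set G : ℝ → ℝ := frequencyWeight ((1 - η) / (4 * η)) with hG
  set ν : Measure ℝ := volume.restrict (Ioc (-(1 / h)) (1 / h)) with hν
  have hGi : Integrable G ν := (hw.intervalIntegrable _ _).1
  have hm : AEStronglyMeasurable
      (fun q : Ω × ℝ => Complex.exp (-Complex.I * U q.1 * q.2) * (G q.2 : ℂ)) (μ.prod ν) := by
    have hc : Continuous fun q : ℝ × ℝ => Complex.exp (-Complex.I * q.1 * q.2) * (G q.2 : ℂ) := by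
      fun_prop
    have hp : AEMeasurable (fun q : Ω × ℝ => (U q.1, q.2)) (μ.prod ν) :=
      (hU.comp_quasiMeasurePreserving Measure.quasiMeasurePreserving_fst).prodMk
        measurable_snd.aemeasurable
    exact (hc.measurable.comp_aemeasurable hp).aestronglyMeasurable
  have hint : Integrable
      (fun q : Ω × ℝ => Complex.exp (-Complex.I * U q.1 * q.2) * (G q.2 : ℂ)) (μ.prod ν) := by
    refine (hGi.comp_snd μ).mono' hm (Eventually.of_forall fun q => ?_)
    rw [norm_mul, norm_exp_neg_I_mul, one_mul, Complex.norm_real, Real.norm_eq_abs,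
      abs_of_nonneg (frequencyWeight_nonneg _ _)]
  simp only [kernel_eq h0 h1, intervalIntegral.integral_of_le hR]
  have hre := integral_re hint.integral_prod_left
  simp only [RCLike.re_eq_complex_re] at hre
  rw [hre]
  congr 1
  rw [integral_integral_swap hint]
  refine integral_congr_ae (Eventually.of_forall fun t => ?_)
  exact integral_mul_const _ _

/-! ### The mean of the estimator -/

/-- The argument of the kernel at the point `z` for the `l`-th observation. -/
noncomputable def kernelArgument (η : ℝ) {Ω : Type*} {n : ℕ} (X Φ ξ : Fin n → Ω → ℝ) (z : ℝ × ℝ)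
    (l : Fin n) (ω : Ω) : ℝ :=
  z.1 * Real.cos (Φ l ω) + z.2 * Real.sin (Φ l ω) - noisy η X ξ l ω / Real.sqrt η

theorem kernelArgument_eq {η : ℝ} (h0 : 0 < η) {Ω : Type*} {n : ℕ} (X Φ ξ : Fin n → Ω → ℝ)
    (z : ℝ × ℝ) (l : Fin n) (ω : Ω) :
    kernelArgument η X Φ ξ z l ω =
      z.1 * Real.cos (Φ l ω) + z.2 * Real.sin (Φ l ω) - X l ω -
        Real.sqrt ((1 - η) / 2) / Real.sqrt η * ξ l ω := by
  have h := (Real.sqrt_pos.2 h0).ne'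
  unfold kernelArgument noisy
  field_simp
  ring

namespace IsHomodyneSample

variable {Ω : Type*} [MeasurableSpace Ω] {μ : Measure Ω} {ρ : QuantumState} {n : ℕ}
  {X Φ ξ : Fin n → Ω → ℝ}

theorem aemeasurable_fst (hs : IsHomodyneSample μ ρ X Φ ξ) (l : Fin n) : AEMeasurable (X l) μ :=
  measurable_fst.comp_aemeasurable (hs.law l).aemeasurable

theorem aemeasurable_snd (hs : IsHomodyneSample μ ρ X Φ ξ) (l : Fin n) : AEMeasurable (Φ l) μ :=
  measurable_snd.comp_aemeasurable (hs.law l).aemeasurable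

theorem aemeasurable_kernelArgument (hs : IsHomodyneSample μ ρ X Φ ξ) (η : ℝ) (l : Fin n) :
    AEMeasurable (fun q : Ω × (ℝ × ℝ) => kernelArgument η X Φ ξ q.2 l q.1) (μ.prod volume) := by
  have hc : Continuous fun q : (ℝ × ℝ × ℝ) × (ℝ × ℝ) => q.2.1 * Real.cos q.1.2.1 +
      q.2.2 * Real.sin q.1.2.1 - (Real.sqrt η * q.1.1 + Real.sqrt ((1 - η) / 2) * q.1.2.2) /
        Real.sqrt η := by fun_prop
  have hp : AEMeasurable (fun q : Ω × (ℝ × ℝ) => ((X l q.1, Φ l q.1, ξ l q.1), q.2))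
      (μ.prod volume) := by
    refine AEMeasurable.prodMk ?_ measurable_snd.aemeasurable
    exact ((hs.aemeasurable_fst l).prodMk ((hs.aemeasurable_snd l).prodMk
      (hs.noise_law l).aemeasurable)).comp_quasiMeasurePreserving
        Measure.quasiMeasurePreserving_fst
  exact hc.measurable.comp_aemeasurable hp

theorem aemeasurable_kernelArgument_apply (hs : IsHomodyneSample μ ρ X Φ ξ) (η : ℝ) (z : ℝ × ℝ)
    (l : Fin n) : AEMeasurable (kernelArgument η X Φ ξ z l) μ := by
  have h1 := hs.aemeasurable_fst l
  have h2 := hs.aemeasurable_snd l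
  have h3 := (hs.noise_law l).aemeasurable
  unfold kernelArgument noisy
  fun_prop

/-- Independence splits off the noise, which after division by `√η` is Gaussian of variance `(1 -
η)/(2η)`. -/
theorem integral_exp_kernelArgument (hs : IsHomodyneSample μ ρ X Φ ξ) {η : ℝ} (h0 : 0 < η)
    (h1 : η < 1) (z : ℝ × ℝ) (l : Fin n) (t : ℝ) :
    ∫ ω, Complex.exp (-Complex.I * kernelArgument η X Φ ξ z l ω * t) ∂μ =
      (∫ a, Complex.exp (-Complex.I * t * (z.1 * Real.cos a.2 + z.2 * Real.sin a.2 - a.1 : ℝ))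
        ∂(homodyneLaw ρ)) * Complex.exp (-((1 - η) / (4 * η) * t ^ 2 : ℝ)) := by
  set c : ℝ := Real.sqrt ((1 - η) / 2) / Real.sqrt η with hc
  have hc2 : c ^ 2 = (1 - η) / (2 * η) := by
    rw [hc, div_pow, Real.sq_sqrt (by linarith), Real.sq_sqrt h0.le]
    field_simp
  set f : ℝ × ℝ → ℂ := fun a =>
    Complex.exp (-Complex.I * t * (z.1 * Real.cos a.2 + z.2 * Real.sin a.2 - a.1 : ℝ)) with hf
  set g : ℝ → ℂ := fun x => Complex.exp (((t * c : ℝ) : ℂ) * x * Complex.I) with hg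
  have hfc : Continuous f := by fun_prop
  have hgc : Continuous g := by fun_prop
  have hpair : IndepFun (fun ω => (X l ω, Φ l ω)) (ξ l) μ :=
    hs.indep_noise.comp (measurable_pi_apply l) (measurable_pi_apply l)
  have hind : IndepFun (fun ω => f (X l ω, Φ l ω)) (fun ω => g (ξ l ω)) μ :=
    hpair.comp hfc.measurable hgc.measurable
  have hfm := hfc.measurable.comp_aemeasurable (hs.law l).aemeasurable
  have hgm := hgc.measurable.comp_aemeasurable (hs.noise_law l).aemeasurable
  have hprod := hind.integral_fun_mul_eq_mul_integral hfm.aestronglyMeasurable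
    hgm.aestronglyMeasurable
  have hfi : ∫ ω, f (X l ω, Φ l ω) ∂μ = ∫ a, f a ∂(homodyneLaw ρ) := by
    rw [← (hs.law l).map_eq, integral_map (hs.law l).aemeasurable hfc.aestronglyMeasurable]
  have hgi : ∫ ω, g (ξ l ω) ∂μ = Complex.exp (-((1 - η) / (4 * η) * t ^ 2 : ℝ)) := by
    rw [← integral_map (hs.noise_law l).aemeasurable hgc.aestronglyMeasurable,
      (hs.noise_law l).map_eq, hg, ← charFun_apply_real, charFun_gaussianReal,
      ← Complex.ofReal_pow, mul_pow, hc2]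
    congr 1
    push_cast
    field_simp
    ring
  rw [← hfi, ← hgi, ← hprod]
  refine integral_congr_ae (Eventually.of_forall fun ω => ?_)
  simp only [hf, hg, kernelArgument_eq h0, ← hc, ← Complex.exp_add]
  congr 1
  push_cast
  ring

variable {b r : ℝ} {a : ℕ × ℕ → ℝ}

/-- Deconvolution: `e^{γt²}` cancels the noise factor. The remaining `|t|/(4π)` and the `1/π` of the
law are the polar Jacobian and the inversion constant `1/(2π)²`, so only the frequency cut-off is
felt. -/
theorem integral_kernel_eq [IsProbabilityMeasure μ] (hs : IsHomodyneSample μ ρ X Φ ξ)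
    (hρ : FockDecay ρ b r a) {η h : ℝ} (h0 : 0 < η) (h1 : η < 1) (hh : 0 < h) (z : ℝ × ℝ)
    (l : Fin n) :
    ∫ ω, kernel η h (kernelArgument η X Φ ξ z l ω) ∂μ =
      (1 / (2 * (Real.pi : ℂ)) ^ 2 * ∫ w in disc (1 / h),
        Complex.exp (Complex.I * (w.1 * z.1 + w.2 * z.2)) * wignerFourier ρ w.1 w.2).re := by
  -- As an image of `μ` the law has mass one; nonnegativity of the homodyne density is drawn from
  -- this.
  have hlaw : IsProbabilityMeasure (homodyneLaw ρ) := by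
    rw [← (hs.law l).map_eq]
    exact Measure.isProbabilityMeasure_map (hs.law l).aemeasurable
  have hF : Continuous fun w : ℝ × ℝ =>
      Complex.exp (Complex.I * (w.1 * z.1 + w.2 * z.2)) * wignerFourier ρ w.1 w.2 :=
    (by fun_prop : Continuous fun w : ℝ × ℝ =>
      Complex.exp (Complex.I * (w.1 * z.1 + w.2 * z.2))).mul hρ.continuous_wignerFourier
  rw [integral_kernel h0 h1 hh (hs.aemeasurable_kernelArgument_apply η z l),
    ← integral_halfTurn_eq_setIntegral_disc hF (by positivity),
    ← intervalIntegral.integral_const_mul]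
  congr 2
  funext t
  rw [hs.integral_exp_kernelArgument h0 h1, hρ.integral_exp_homodyneLaw]
  set J : ℂ := ∫ φ in Icc 0 Real.pi,
    Complex.exp (Complex.I * ((-t * Real.cos φ : ℝ) * z.1 + (-t * Real.sin φ : ℝ) * z.2)) *
      wignerFourier ρ (-t * Real.cos φ) (-t * Real.sin φ)
  have he : Complex.exp (-((1 - η) / (4 * η) * t ^ 2 : ℝ)) *
      (frequencyWeight ((1 - η) / (4 * η)) t : ℂ) = (|t| : ℝ) / (4 * (Real.pi : ℂ)) := by
    rw [← Complex.ofReal_neg, ← Complex.ofReal_exp, ← Complex.ofReal_mul, frequencyWeight,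
      mul_div_assoc', mul_left_comm, ← Real.exp_add, neg_add_cancel, Real.exp_zero]
    push_cast
    ring
  have hπ : (Real.pi : ℂ) ≠ 0 := Complex.ofReal_ne_zero.2 Real.pi_ne_zero
  rw [mul_assoc, he]
  field_simp
  ring

theorem integrable_kernel [IsProbabilityMeasure μ] (hs : IsHomodyneSample μ ρ X Φ ξ) {η h : ℝ}
    (h0 : 0 < η) (h1 : η < 1) (hh : 0 < h) (z : ℝ × ℝ) (l : Fin n) :
    Integrable (fun ω => kernel η h (kernelArgument η X Φ ξ z l ω)) μ :=
  Integrable.of_bound ((continuous_kernel h0 h1 h).measurable.comp_aemeasurable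
    (hs.aemeasurable_kernelArgument_apply η z l)).aestronglyMeasurable _
    (Eventually.of_forall fun _ => abs_kernel_le h0 h1 hh _)

theorem meanEstimator_eq [IsProbabilityMeasure μ] (hs : IsHomodyneSample μ ρ X Φ ξ)
    (hρ : FockDecay ρ b r a) {η h : ℝ} (h0 : 0 < η) (h1 : η < 1) (hh : 0 < h) (hn : n ≠ 0)
    (z : ℝ × ℝ) :
    meanEstimator η h μ (noisy η X ξ) Φ z =
      (1 / (2 * (Real.pi : ℂ)) ^ 2 * ∫ w in disc (1 / h),
        Complex.exp (Complex.I * (w.1 * z.1 + w.2 * z.2)) * wignerFourier ρ w.1 w.2).re := by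
  have hn' : (n : ℝ) ≠ 0 := Nat.cast_ne_zero.2 hn
  simp only [meanEstimator, wignerEstimator]
  have hi := hs.integrable_kernel h0 h1 hh z
  have he := hs.integral_kernel_eq hρ h0 h1 hh z
  simp only [kernelArgument] at hi he
  rw [integral_const_mul, integral_finsetSum _ fun l _ => hi l]
  simp only [he, Finset.sum_const, Finset.card_univ, Fintype.card_fin, nsmul_eq_mul]
  rw [← mul_assoc, one_div, inv_mul_cancel₀ hn', one_mul]

/-- The bias of the estimator is controlled by the high frequencies of the Wigner function. -/
theorem normSqOn_bias_le [IsProbabilityMeasure μ] (hs : IsHomodyneSample μ ρ X Φ ξ)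
    (hρ : FockDecay ρ b r a) {η h s : ℝ} (h0 : 0 < η) (h1 : η < 1) (hh : 0 < h) (hn : n ≠ 0)
    (hs0 : 0 < s) :
    normSqOn (disc s) (fun z => meanEstimator η h μ (noisy η X ξ) Φ z - wigner ρ z) ≤
      ENNReal.ofReal (Real.exp 1 * (8 * Real.pi ^ 2)) *
        ∫⁻ w in (disc (1 / h))ᶜ, ‖wignerFourier ρ w.1 w.2‖ₑ ^ 2 := by
  have hd := (measurableSet_disc (1 / h)).compl
  set g : ℝ × ℝ → ℂ := (disc (1 / h))ᶜ.indicator fun w => wignerFourier ρ w.1 w.2 with hg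
  have hgi : Integrable g := hρ.integrable_wignerFourier.indicator hd
  have hsq : ∫⁻ w, ‖g w‖ₑ ^ 2 = ∫⁻ w in (disc (1 / h))ᶜ, ‖wignerFourier ρ w.1 w.2‖ₑ ^ 2 := by
    rw [← lintegral_indicator hd]
    refine lintegral_congr fun w => ?_
    by_cases hw : w ∈ (disc (1 / h))ᶜ
    · simp only [hg, indicator_of_mem hw]
    · simp only [hg, indicator_of_notMem hw, enorm_zero, ne_eq, OfNat.ofNat_ne_zero,
        not_false_eq_true, zero_pow]
  rw [← hsq]
  refine le_trans ?_ (setLIntegral_disc_sq_planeFourier_le hgi hs0)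
  refine lintegral_mono fun z => ENNReal.ofReal_le_ofReal ?_
  have hsub : ((meanEstimator η h μ (noisy η X ξ) Φ z - wigner ρ z : ℝ)) =
      (-(1 / (2 * (Real.pi : ℂ)) ^ 2 * planeFourier g z)).re := by
    have hw : wigner ρ z = (1 / (2 * (Real.pi : ℂ)) ^ 2 * ∫ w : ℝ × ℝ,
      Complex.exp (Complex.I * (w.1 * z.1 + w.2 * z.2)) * wignerFourier ρ w.1 w.2).re := rfl
    rw [hs.meanEstimator_eq hρ h0 h1 hh hn z, hw, ← Complex.sub_re, ← mul_sub]
    have hi := integrable_exp_I_mul hρ.integrable_wignerFourier z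
    have hsplit := integral_add_compl (measurableSet_disc (1 / h)) hi
    have hp : planeFourier g z = ∫ w in (disc (1 / h))ᶜ,
        Complex.exp (Complex.I * (w.1 * z.1 + w.2 * z.2)) * wignerFourier ρ w.1 w.2 := by
      rw [planeFourier, ← integral_indicator hd]
      congr 1
      funext w
      by_cases hw : w ∈ (disc (1 / h))ᶜ
      · simp only [hg, indicator_of_mem hw]
      · simp only [hg, indicator_of_notMem hw, mul_zero]
    rw [hp, ← hsplit]
    congr 1
    ring
  have hk : ‖(1 / (2 * (Real.pi : ℂ)) ^ 2 : ℂ)‖ ≤ 1 := by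
    rw [norm_div, norm_one, norm_pow, norm_mul, Complex.norm_real, Complex.norm_two,
      Real.norm_of_nonneg Real.pi_pos.le]
    refine div_le_one_of_le₀ ?_ (by positivity)
    exact one_le_pow₀ (by linarith [Real.two_le_pi])
  beta_reduce
  rw [hsub, ← sq_abs]
  gcongr
  refine (Complex.abs_re_le_norm _).trans ?_
  rw [norm_neg, norm_mul]
  exact mul_le_of_le_one_left (norm_nonneg _) hk

end IsHomodyneSample

/-! ### Integrals outside a disc -/

/-- Outside the disc a factor `exp(-2β R^r)` is pulled out, and the gap `b - β` keeps the rest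
integrable. The positive part of `β` is needed because for negative `β` the comparison of radii goes
the wrong way. -/
theorem setLIntegral_compl_disc_sq_le {A b β r R : ℝ} (hb : 0 < b) (hβ : β < b) (hr : 0 < r)
    (hR : 0 ≤ R) :
    ∫⁻ w in (disc R)ᶜ, ENNReal.ofReal
        ((A * Real.exp (-b * Real.sqrt (w.1 ^ 2 + w.2 ^ 2) ^ r)) ^ 2) ≤
      ENNReal.ofReal (A ^ 2 * (∫ w : ℝ × ℝ, Real.exp
        (-(2 * (b - max β 0)) * Real.sqrt (w.1 ^ 2 + w.2 ^ 2) ^ r)) *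
          Real.exp (-2 * β * R ^ r)) := by
  have hδ : 0 < 2 * (b - max β 0) := by
    have := max_lt hβ hb
    linarith
  have hint := integrable_exp_neg_mul_sqrt_rpow hδ hr
  set E : ℝ × ℝ → ℝ := fun w =>
    Real.exp (-(2 * (b - max β 0)) * Real.sqrt (w.1 ^ 2 + w.2 ^ 2) ^ r) with hE
  calc _ ≤ ∫⁻ w in (disc R)ᶜ, ENNReal.ofReal (A ^ 2 * Real.exp (-2 * β * R ^ r) * E w) := by
        refine setLIntegral_mono' (measurableSet_disc R).compl fun w hw => ?_
        apply ENNReal.ofReal_le_ofReal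
        have hw' : R < Real.sqrt (w.1 ^ 2 + w.2 ^ 2) := not_le.1 hw
        have hx : R ^ r ≤ Real.sqrt (w.1 ^ 2 + w.2 ^ 2) ^ r :=
          Real.rpow_le_rpow hR hw'.le hr.le
        have hR' : 0 ≤ R ^ r := Real.rpow_nonneg hR r
        rw [mul_pow, mul_assoc, hE]
        refine mul_le_mul_of_nonneg_left ?_ (sq_nonneg A)
        rw [← Real.exp_add, ← Real.exp_nat_mul, Real.exp_le_exp]
        have h1 := mul_le_mul_of_nonneg_left hx (le_max_right β 0)
        have h2 := mul_le_mul_of_nonneg_right (le_max_left β 0) hR'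
        push_cast
        nlinarith
    _ ≤ ∫⁻ w, ENNReal.ofReal (A ^ 2 * Real.exp (-2 * β * R ^ r) * E w) :=
        setLIntegral_le_lintegral _ _
    _ = _ := by
        rw [← ofReal_integral_eq_lintegral_ofReal (hint.const_mul _)
          (Eventually.of_forall fun w => by positivity), integral_const_mul]
        congr 1
        ring

/-! ### The variance of the estimator -/

theorem comap_prodMk_eq_generateFrom {Ω α β : Type*} [MeasurableSpace α]
    [MeasurableSpace β] (f : Ω → α) (g : Ω → β) :
    MeasurableSpace.comap (fun ω => (f ω, g ω)) inferInstance =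
      MeasurableSpace.generateFrom (preimage (fun ω => (f ω, g ω)) ''
        image2 (· ×ˢ ·) {s : Set α | MeasurableSet s} {t : Set β | MeasurableSet t}) := by
  rw [← MeasurableSpace.comap_generateFrom, generateFrom_prod]

section Independence

variable {Ω α α' β β' : Type*} [MeasurableSpace Ω] [MeasurableSpace α] [MeasurableSpace α']
  [MeasurableSpace β] [MeasurableSpace β'] {μ : Measure Ω} {f : Ω → α} {f' : Ω → α'} {g : Ω → β}
  {g' : Ω → β'}

/-- On rectangles the hypotheses factor the probability into four terms, which may be regrouped;
rectangles form a generating π-system. -/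
theorem indepFun_prodMk_prodMk_of_measurable [IsProbabilityMeasure μ] (hf : Measurable f)
    (hf' : Measurable f') (hg : Measurable g) (hg' : Measurable g') (h1 : IndepFun f f' μ)
    (h2 : IndepFun g g' μ) (h : IndepFun (fun ω => (f ω, f' ω)) (fun ω => (g ω, g' ω)) μ) :
    IndepFun (fun ω => (f ω, g ω)) (fun ω => (f' ω, g' ω)) μ := by
  rw [IndepFun_iff_Indep, comap_prodMk_eq_generateFrom, comap_prodMk_eq_generateFrom]
  refine IndepSets.indep' ?_ ?_ ?_ ?_ ?_
  · rintro _ ⟨_, ⟨s, hs, t, ht, rfl⟩, rfl⟩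
    exact (hf.prodMk hg) (MeasurableSet.prod hs ht)
  · rintro _ ⟨_, ⟨s, hs, t, ht, rfl⟩, rfl⟩
    exact (hf'.prodMk hg') (MeasurableSet.prod hs ht)
  · exact isPiSystem_prod.comap _
  · exact isPiSystem_prod.comap _
  · rw [IndepSets_iff]
    rintro _ _ ⟨_, ⟨s, hs, t, ht, rfl⟩, rfl⟩ ⟨_, ⟨s', hs', t', ht', rfl⟩, rfl⟩
    have e1 := h.measure_inter_preimage_eq_mul _ _ (MeasurableSet.prod hs hs')
      (MeasurableSet.prod ht ht')
    have e2 := h1.measure_inter_preimage_eq_mul _ _ hs hs'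
    have e3 := h2.measure_inter_preimage_eq_mul _ _ ht ht'
    have hfg : IndepFun f g μ := h.comp measurable_fst measurable_fst
    have hfg' : IndepFun f' g' μ := h.comp measurable_snd measurable_snd
    have e4 := hfg.measure_inter_preimage_eq_mul _ _ hs ht
    have e5 := hfg'.measure_inter_preimage_eq_mul _ _ hs' ht'
    simp only [mk_preimage_prod] at *
    rw [inter_inter_inter_comm, e1, e2, e3, e4, e5]
    ring

theorem indepFun_prodMk_prodMk [IsProbabilityMeasure μ] (hf : AEMeasurable f μ)
    (hf' : AEMeasurable f' μ) (hg : AEMeasurable g μ) (hg' : AEMeasurable g' μ)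
    (h1 : IndepFun f f' μ) (h2 : IndepFun g g' μ)
    (h : IndepFun (fun ω => (f ω, f' ω)) (fun ω => (g ω, g' ω)) μ) :
    IndepFun (fun ω => (f ω, g ω)) (fun ω => (f' ω, g' ω)) μ := by
  refine (indepFun_prodMk_prodMk_of_measurable hf.measurable_mk hf'.measurable_mk hg.measurable_mk
    hg'.measurable_mk (h1.congr hf.ae_eq_mk hf'.ae_eq_mk) (h2.congr hg.ae_eq_mk hg'.ae_eq_mk)
    (h.congr (hf.ae_eq_mk.prodMk hf'.ae_eq_mk) (hg.ae_eq_mk.prodMk hg'.ae_eq_mk))).congr ?_ ?_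
  · exact (hf.ae_eq_mk.prodMk hg.ae_eq_mk).symm
  · exact (hf'.ae_eq_mk.prodMk hg'.ae_eq_mk).symm

/-- The mean of `n` pairwise independent random variables bounded by `M` has variance at most
`M² / n`. -/
theorem variance_average_le [IsProbabilityMeasure μ] {n : ℕ} (hn : n ≠ 0) {V : Fin n → Ω → ℝ}
    {M : ℝ} (hV : ∀ l, AEStronglyMeasurable (V l) μ) (hM : ∀ l ω, |V l ω| ≤ M)
    (hind : Pairwise fun i j => IndepFun (V i) (V j) μ) :
    variance (fun ω => 1 / (n : ℝ) * ∑ l, V l ω) μ ≤ M ^ 2 / n := by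
  have hn' : (0 : ℝ) < n := Nat.cast_pos.2 (Nat.pos_of_ne_zero hn)
  have hmem : ∀ l, MemLp (V l) 2 μ := fun l =>
    MemLp.of_bound (hV l) M (Eventually.of_forall (hM l))
  have hvar : ∀ l, variance (V l) μ ≤ M ^ 2 := by
    intro l
    refine (variance_le_expectation_sq (hV l)).trans ?_
    have h := integral_mono_of_nonneg (μ := μ) (f := (V l) ^ 2) (g := fun _ => M ^ 2)
      (Eventually.of_forall fun ω => sq_nonneg (V l ω)) (integrable_const _)
      (Eventually.of_forall fun ω => sq_le_sq.2 ((hM l ω).trans (le_abs_self M)))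
    simpa using h
  have hsum := IndepFun.variance_sum (s := Finset.univ) (fun l _ => hmem l)
    fun i _ j _ hij => hind hij
  have he : (fun ω => 1 / (n : ℝ) * ∑ l, V l ω) = fun ω => 1 / (n : ℝ) * (∑ l, V l) ω := by
    funext ω
    rw [Finset.sum_apply]
  rw [he, variance_const_mul, hsum]
  calc (1 / (n : ℝ)) ^ 2 * ∑ l, variance (V l) μ ≤ (1 / (n : ℝ)) ^ 2 * ∑ _l : Fin n, M ^ 2 := by
        gcongr with l
        exact hvar l
    _ = M ^ 2 / n := by
        rw [Finset.sum_const, Finset.card_univ, Fintype.card_fin, nsmul_eq_mul]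
        field_simp

end Independence

theorem volume_disc_le {s : ℝ} (hs : 0 ≤ s) : volume (disc s) ≤ ENNReal.ofReal (4 * s ^ 2) := by
  have hsub : disc s ⊆ Icc (-s) s ×ˢ Icc (-s) s := by
    intro z hz
    have hz' : z.1 ^ 2 + z.2 ^ 2 ≤ s ^ 2 := (Real.sqrt_le_left hs).1 hz
    refine ⟨abs_le.1 (abs_le_of_sq_le_sq ?_ hs), abs_le.1 (abs_le_of_sq_le_sq ?_ hs)⟩
    · nlinarith [sq_nonneg z.2]
    · nlinarith [sq_nonneg z.1]
  refine (measure_mono hsub).trans_eq ?_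
  rw [Measure.volume_eq_prod, Measure.prod_prod, Real.volume_Icc,
    ← ENNReal.ofReal_mul (by linarith)]
  congr 1
  ring

namespace IsHomodyneSample

variable {Ω : Type*} [MeasurableSpace Ω] {μ : Measure Ω} {ρ : QuantumState} {n : ℕ}
  {X Φ ξ : Fin n → Ω → ℝ}

theorem indepFun_kernelArgument [IsProbabilityMeasure μ] (hs : IsHomodyneSample μ ρ X Φ ξ)
    (η : ℝ) (z : ℝ × ℝ) {i j : Fin n} (hij : i ≠ j) :
    IndepFun (kernelArgument η X Φ ξ z i) (kernelArgument η X Φ ξ z j) μ := by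
  have h := indepFun_prodMk_prodMk (hs.law i).aemeasurable (hs.law j).aemeasurable
    (hs.noise_law i).aemeasurable (hs.noise_law j).aemeasurable (hs.indep.indepFun hij)
    (hs.noise_indep.indepFun hij)
    (hs.indep_noise.comp ((measurable_pi_apply i).prodMk (measurable_pi_apply j))
      ((measurable_pi_apply i).prodMk (measurable_pi_apply j)))
  have hm : Measurable fun q : (ℝ × ℝ) × ℝ => z.1 * Real.cos q.1.2 + z.2 * Real.sin q.1.2 -
      (Real.sqrt η * q.1.1 + Real.sqrt ((1 - η) / 2) * q.2) / Real.sqrt η := by fun_prop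
  exact h.comp hm hm

theorem aemeasurable_wignerEstimator (hs : IsHomodyneSample μ ρ X Φ ξ) {η h : ℝ} (h0 : 0 < η)
    (h1 : η < 1) :
    AEMeasurable (fun q : Ω × (ℝ × ℝ) => wignerEstimator η h (noisy η X ξ) Φ q.2 q.1)
      (μ.prod volume) :=
  (Finset.aemeasurable_fun_sum _ fun l _ => (continuous_kernel h0 h1 h).measurable.comp_aemeasurable
    (hs.aemeasurable_kernelArgument η l)).const_mul _

theorem variance_wignerEstimator_le [IsProbabilityMeasure μ] (hs : IsHomodyneSample μ ρ X Φ ξ)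
    {η h : ℝ} (h0 : 0 < η) (h1 : η < 1) (hh : 0 < h) (hn : n ≠ 0) (z : ℝ × ℝ) :
    variance (wignerEstimator η h (noisy η X ξ) Φ z) μ ≤
      (Real.exp ((1 - η) / (4 * η) / h ^ 2) / (2 * ((1 - η) / (4 * η)))) ^ 2 / n :=
  variance_average_le hn (V := fun l ω => kernel η h (kernelArgument η X Φ ξ z l ω))
    (fun l => (hs.integrable_kernel h0 h1 hh z l).aestronglyMeasurable)
    (fun _ _ => abs_kernel_le h0 h1 hh _)
    fun _ _ hij => (hs.indepFun_kernelArgument η z hij).comp (continuous_kernel h0 h1 h).measurable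
      (continuous_kernel h0 h1 h).measurable

theorem lintegral_normSqOn_le [IsProbabilityMeasure μ] (hs : IsHomodyneSample μ ρ X Φ ξ)
    {η h s : ℝ} (h0 : 0 < η) (h1 : η < 1) (hh : 0 < h) (hn : n ≠ 0) (hs0 : 0 ≤ s) :
    ∫⁻ ω, normSqOn (disc s) (fun z => wignerEstimator η h (noisy η X ξ) Φ z ω -
        meanEstimator η h μ (noisy η X ξ) Φ z) ∂μ ≤
      ENNReal.ofReal ((Real.exp ((1 - η) / (4 * η) / h ^ 2) / (2 * ((1 - η) / (4 * η)))) ^ 2 / n *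
        (4 * s ^ 2)) := by
  set M : ℝ := (Real.exp ((1 - η) / (4 * η) / h ^ 2) / (2 * ((1 - η) / (4 * η)))) ^ 2 / n with hM
  have hac : μ.prod (volume.restrict (disc s)) ≪ μ.prod (volume : Measure (ℝ × ℝ)) :=
    Measure.AbsolutelyContinuous.prod Measure.AbsolutelyContinuous.rfl
      Measure.restrict_le_self.absolutelyContinuous
  have hW := hs.aemeasurable_wignerEstimator (h := h) h0 h1
  have hmean : AEMeasurable (fun z => meanEstimator η h μ (noisy η X ξ) Φ z)
      (volume : Measure (ℝ × ℝ)) :=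
    hW.aestronglyMeasurable.prod_swap.integral_prod_right'.aemeasurable
  have hm : AEMeasurable (fun q : Ω × (ℝ × ℝ) => ENNReal.ofReal
      ((wignerEstimator η h (noisy η X ξ) Φ q.2 q.1 -
        meanEstimator η h μ (noisy η X ξ) Φ q.2) ^ 2)) (μ.prod (volume.restrict (disc s))) :=
    (((hW.sub (hmean.comp_quasiMeasurePreserving
      Measure.quasiMeasurePreserving_snd)).pow_const 2).ennreal_ofReal).mono_ac hac
  simp only [normSqOn]
  -- By Tonelli the inner integral becomes the variance of the estimator at `z`.
  rw [lintegral_lintegral_swap hm]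
  have hpoint : ∀ z, ∫⁻ ω, ENNReal.ofReal ((wignerEstimator η h (noisy η X ξ) Φ z ω -
      meanEstimator η h μ (noisy η X ξ) Φ z) ^ 2) ∂μ ≤ ENNReal.ofReal M := by
    intro z
    have hae : AEMeasurable (wignerEstimator η h (noisy η X ξ) Φ z) μ :=
      (Finset.aemeasurable_fun_sum _ fun l _ =>
        (hs.integrable_kernel h0 h1 hh z l).aestronglyMeasurable.aemeasurable).const_mul _
    have hV : ∀ l, MemLp (fun ω => kernel η h (kernelArgument η X Φ ξ z l ω)) 2 μ := fun l =>
      MemLp.of_bound (hs.integrable_kernel h0 h1 hh z l).aestronglyMeasurable _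
        (Eventually.of_forall fun _ => abs_kernel_le h0 h1 hh _)
    have hsum : MemLp (fun ω => ∑ l, kernel η h (kernelArgument η X Φ ξ z l ω)) 2 μ :=
      memLp_finsetSum Finset.univ fun l _ => hV l
    have hmem : MemLp (wignerEstimator η h (noisy η X ξ) Φ z) 2 μ :=
      hsum.const_mul (1 / (n : ℝ))
    have h := ENNReal.ofReal_le_ofReal (hs.variance_wignerEstimator_le h0 h1 hh hn z)
    rw [hmem.ofReal_variance_eq, evariance_eq_lintegral_ofReal] at h
    exact h
  calc _ ≤ ∫⁻ _z in disc s, ENNReal.ofReal M := lintegral_mono fun z => hpoint z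
    _ = ENNReal.ofReal M * volume (disc s) := by rw [setLIntegral_const]
    _ ≤ ENNReal.ofReal M * ENNReal.ofReal (4 * s ^ 2) := by
        gcongr
        exact volume_disc_le hs0
    _ = _ := by rw [← ENNReal.ofReal_mul (by positivity)]

end IsHomodyneSample

/-! ### The constants -/

theorem FockDecay.normSqOn_compl_disc_wigner_le {ρ : QuantumState} {b r β s : ℝ} {a : ℕ × ℕ → ℝ}
    (hρ : FockDecay ρ b r a) (hβ : β < b) (hs : 0 ≤ s) :
    normSqOn (disc s)ᶜ (wigner ρ) ≤ ENNReal.ofReal ((∑' p, a p) ^ 2 * (∫ w : ℝ × ℝ, Real.exp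
        (-(2 * (b - max β 0)) * Real.sqrt (w.1 ^ 2 + w.2 ^ 2) ^ r)) *
          Real.exp (-2 * β * s ^ r)) := by
  refine le_trans ?_ (setLIntegral_compl_disc_sq_le hρ.rate_pos hβ hρ.exponent_pos hs)
  refine lintegral_mono fun z => ENNReal.ofReal_le_ofReal ?_
  rw [← sq_abs]
  have := hρ.abs_wigner_le z
  gcongr

theorem FockDecay.setLIntegral_compl_disc_wignerFourier_le {ρ : QuantumState} {b r β R : ℝ}
    {a : ℕ × ℕ → ℝ} (hρ : FockDecay ρ b r a) (hβ : β < b) (hR : 0 ≤ R) :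
    ∫⁻ w in (disc R)ᶜ, ‖wignerFourier ρ w.1 w.2‖ₑ ^ 2 ≤
      ENNReal.ofReal ((∑' p, a p) ^ 2 * (∫ w : ℝ × ℝ, Real.exp
        (-(2 * (b / 2 ^ r - max (β / 2 ^ r) 0)) * Real.sqrt (w.1 ^ 2 + w.2 ^ 2) ^ r)) *
          Real.exp (-2 * (β / 2 ^ r) * R ^ r)) := by
  have hβ' : β / 2 ^ r < b / 2 ^ r := by gcongr
  refine le_trans ?_ (setLIntegral_compl_disc_sq_le hρ.rate_half_pos hβ' hρ.exponent_pos hR)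
  refine lintegral_mono fun w => ?_
  rw [← ofReal_norm, ← ENNReal.ofReal_pow (norm_nonneg _)]
  have := hρ.norm_wignerFourier_le w
  gcongr

/-- The hypotheses stand inside the existential so that `C` becomes a function of all triples;
inadmissible ones get `C = 1`. -/
theorem exists_normSqOn_compl_disc_wigner_le (β B r : ℝ) : ∃ C : ℝ, 0 < C ∧
    (0 < B → AdmissibleRate B r β → ∀ s : ℝ, 1 ≤ s → ∀ ρ ∈ stateClass B r,
      normSqOn (disc s)ᶜ (wigner ρ) ≤
        ENNReal.ofReal (C * s ^ (10 - 3 * r) * Real.exp (-2 * β * s ^ r))) := by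
  by_cases hB : 0 < B ∧ AdmissibleRate B r β
  swap
  · exact ⟨1, one_pos, fun h h' => absurd ⟨h, h'⟩ hB⟩
  obtain ⟨b, a, hβ, hb, H⟩ := hB.2.exists_fockDecay hB.1
  set K : ℝ := (∑' p, a p) ^ 2 * ∫ w : ℝ × ℝ, Real.exp
    (-(2 * (b - max β 0)) * Real.sqrt (w.1 ^ 2 + w.2 ^ 2) ^ r) with hK
  have hK0 : 0 ≤ K := mul_nonneg (sq_nonneg _) (integral_nonneg fun _ => (Real.exp_pos _).le)
  refine ⟨K + 1, by positivity, fun _ _ s hs ρ hρ => ?_⟩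
  refine ((H ρ hρ).normSqOn_compl_disc_wigner_le hβ (by linarith)).trans ?_
  -- As `r ≤ 2`, the exponent is positive and the polynomial factor can be inserted for free.
  have hpow : 1 ≤ s ^ (10 - 3 * r) := Real.one_le_rpow hs (by linarith [hB.2.le_two])
  rw [← hK]
  exact ENNReal.ofReal_le_ofReal
    (mul_le_mul_of_nonneg_right (by nlinarith) (Real.exp_pos _).le)

theorem exists_normSqOn_bias_le (β B r : ℝ) : ∃ C : ℝ, 0 < C ∧
    (0 < B → AdmissibleRate B r β → ∀ h : ℝ, 0 < h → h ≤ 1 → ∀ ρ ∈ stateClass B r,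
      ENNReal.ofReal (Real.exp 1 * (8 * Real.pi ^ 2)) *
        ∫⁻ w in (disc (1 / h))ᶜ, ‖wignerFourier ρ w.1 w.2‖ₑ ^ 2 ≤
        ENNReal.ofReal (C * h ^ (3 * r - 10) * Real.exp (-((2 : ℝ) ^ (1 - r) * β / h ^ r)))) := by
  by_cases hB : 0 < B ∧ AdmissibleRate B r β
  swap
  · exact ⟨1, one_pos, fun h h' => absurd ⟨h, h'⟩ hB⟩
  obtain ⟨b, a, hβ, hb, H⟩ := hB.2.exists_fockDecay hB.1
  set K : ℝ := (∑' p, a p) ^ 2 * ∫ w : ℝ × ℝ, Real.exp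
    (-(2 * (b / 2 ^ r - max (β / 2 ^ r) 0)) * Real.sqrt (w.1 ^ 2 + w.2 ^ 2) ^ r) with hK
  have hK0 : 0 ≤ K := mul_nonneg (sq_nonneg _) (integral_nonneg fun _ => (Real.exp_pos _).le)
  refine ⟨Real.exp 1 * (8 * Real.pi ^ 2) * K + 1, by positivity, fun _ _ h hh hh1 ρ hρ => ?_⟩
  have hle := (H ρ hρ).setLIntegral_compl_disc_wignerFourier_le hβ
    (by positivity : (0 : ℝ) ≤ 1 / h)
  have hpow : 1 ≤ h ^ (3 * r - 10) :=
    Real.one_le_rpow_of_pos_of_le_one_of_nonpos hh hh1 (by linarith [hB.2.le_two])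
  -- Squaring doubles the frequency rate `β/2^r`.
  have hexp : -2 * (β / 2 ^ r) * (1 / h) ^ r = -((2 : ℝ) ^ (1 - r) * β / h ^ r) := by
    rw [Real.div_rpow zero_le_one hh.le, Real.one_rpow, Real.rpow_sub two_pos, Real.rpow_one]
    ring
  rw [hexp] at hle
  have hc : 0 ≤ Real.exp 1 * (8 * Real.pi ^ 2) := by positivity
  calc _ ≤ ENNReal.ofReal (Real.exp 1 * (8 * Real.pi ^ 2)) *
        ENNReal.ofReal (K * Real.exp (-((2 : ℝ) ^ (1 - r) * β / h ^ r))) := by gcongr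
    _ = ENNReal.ofReal (Real.exp 1 * (8 * Real.pi ^ 2) * K * 1 *
        Real.exp (-((2 : ℝ) ^ (1 - r) * β / h ^ r))) := by
        rw [← ENNReal.ofReal_mul hc]
        congr 1
        ring
    _ ≤ _ := by
        gcongr
        linarith

/-- The factor `1/h` is a gift, since `h ≤ 1`. The added one lets the same expression serve as a
positive constant even when `γ = 0`. -/
theorem variance_bound_le {γ h s n : ℝ} (hγ : 0 < γ) (hh : 0 < h) (hh1 : h ≤ 1) (hn : 0 < n) :
    (Real.exp (γ / h ^ 2) / (2 * γ)) ^ 2 / n * (4 * s ^ 2) ≤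
      ((γ ^ 2)⁻¹ + 1) * (s ^ 2 / (n * h)) * Real.exp (2 * γ / h ^ 2) := by
  have he : Real.exp (2 * γ / h ^ 2) = Real.exp (γ / h ^ 2) ^ 2 := by
    rw [← Real.exp_nat_mul]
    congr 1
    push_cast
    ring
  have hle : s ^ 2 / n ≤ s ^ 2 / (n * h) := by
    gcongr
    exact mul_le_of_le_one_right hn.le hh1
  calc _ = (γ ^ 2)⁻¹ * (s ^ 2 / n) * Real.exp (γ / h ^ 2) ^ 2 := by field_simp; ring
    _ ≤ ((γ ^ 2)⁻¹ + 1) * (s ^ 2 / (n * h)) * Real.exp (γ / h ^ 2) ^ 2 := by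
        gcongr
        linarith
    _ = _ := by rw [he]

end HomodyneTomography

/-! ### Assembly of the three bounds -/

open HomodyneTomography in
theorem proposition6 :
    ∃ C₁ C₂ : ℝ → ℝ → ℝ → ℝ, ∃ C₃ : ℝ → ℝ,
      (∀ β B r : ℝ, 0 < C₁ β B r ∧ 0 < C₂ β B r) ∧ (∀ η : ℝ, 0 < C₃ η) ∧
      ∀ (B r β η : ℝ), 0 < B →
        ((0 < r ∧ r < 2 ∧ β < B) ∨ (r = 2 ∧ β = B / (1 + Real.sqrt B) ^ 2)) →
        0 < η → η < 1 →
        ∀ (h s : ℕ → ℝ), Tendsto h atTop (𝓝[>] 0) → Tendsto s atTop atTop →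
          ∀ᶠ n : ℕ in atTop,
            (⨆ ρ ∈ stateClass B r, normSqOn (disc (s n))ᶜ (wigner ρ)) ≤
                ENNReal.ofReal
                  (C₁ β B r * s n ^ (10 - 3 * r) * Real.exp (-2 * β * s n ^ r)) ∧
            ∀ ρ ∈ stateClass B r,
              ∀ (Ω : Type*) [MeasurableSpace Ω] (μ : Measure Ω) [IsProbabilityMeasure μ]
                (X Φ ξ : Fin n → Ω → ℝ), IsHomodyneSample μ ρ X Φ ξ →
                normSqOn (disc (s n))
                    (fun z => meanEstimator η (h n) μ (noisy η X ξ) Φ z - wigner ρ z) ≤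
                  ENNReal.ofReal (C₂ β B r * h n ^ (3 * r - 10) *
                    Real.exp (-((2 : ℝ) ^ (1 - r) * β / h n ^ r))) ∧
                ∫⁻ ω, normSqOn (disc (s n))
                    (fun z => wignerEstimator η (h n) (noisy η X ξ) Φ z ω -
                      meanEstimator η (h n) μ (noisy η X ξ) Φ z) ∂μ ≤
                  ENNReal.ofReal (C₃ η * (s n ^ 2 / (n * h n)) *
                    Real.exp (2 * ((1 - η) / (4 * η)) / h n ^ 2)) := by
  choose C₁ hC₁ H₁ using exists_normSqOn_compl_disc_wigner_le
  choose C₂ hC₂ H₂ using exists_normSqOn_bias_le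
  refine ⟨C₁, C₂, fun η => (((1 - η) / (4 * η)) ^ 2)⁻¹ + 1, fun β B r => ⟨hC₁ β B r, hC₂ β B r⟩,
    fun η => by positivity, ?_⟩
  intro B r β η hB hr h0 h1 h s hh hs
  have hγ : 0 < (1 - η) / (4 * η) := div_pos (by linarith) (by linarith)
  have hpos : ∀ᶠ n in atTop, 0 < h n := hh.eventually self_mem_nhdsWithin
  have hle : ∀ᶠ n in atTop, h n < 1 :=
    (tendsto_nhds_of_tendsto_nhdsWithin hh).eventually (gt_mem_nhds one_pos)
  filter_upwards [hpos, hle, hs.eventually_ge_atTop 1, eventually_ne_atTop 0] with n hn1 hn2 hn3 hn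
  have hn' : (0 : ℝ) < n := Nat.cast_pos.2 (Nat.pos_of_ne_zero hn)
  refine ⟨iSup₂_le fun ρ hρ => H₁ β B r hB hr (s n) hn3 ρ hρ, ?_⟩
  intro ρ hρ Ω _ μ _ X Φ ξ hS
  -- Only continuity, integrability and inversion are drawn from this decay, so `b` and `a` need not
  -- be those behind `C₂`.
  obtain ⟨b, a, -, -, H⟩ := AdmissibleRate.exists_fockDecay hB hr
  refine ⟨?_, ?_⟩
  · exact (hS.normSqOn_bias_le (H ρ hρ) h0 h1 hn1 hn (by linarith)).trans
      (H₂ β B r hB hr (h n) hn1 hn2.le ρ hρ)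
  · exact (hS.lintegral_normSqOn_le h0 h1 hn1 hn (by linarith)).trans
      (ENNReal.ofReal_le_ofReal (variance_bound_le hγ hn1 hn2.le hn'))
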